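/- Let $K$ be an infinite field, let $d\ge 1$, $\tau\ge 1$ and $e\ge 0$ be integers and put $m=d+e$. Let $R=K[\![x_1,\dots,x_m]\!]$ and $S=K[\![x_{d+1},\dots,x_m]\!]$ (local case), or $R=K[x_1,\dots,x_m]$ and $S=K[x_{d+1},\dots,x_m]$ (graded case), and let $\mathcal M=(x_1,\dots,x_m)\subseteq R$. Let $\mathcal D=K_{DP}[X_1,\dots,X_m]$ be the divided power ring, an $R$-module by contraction, where $x^{\mathbf p}\circ X^{\mathbf q}=X^{\mathbf q-\mathbf p}$ if $\mathbf q\ge\mathbf p$ and $0$ otherwise; products of monomials $X^{\mathbf q}$ below are formal. Let $H^1,\dots,H^\tau\in K_{DP}[X_{d+1},\dots,X_m]$ be polynomials (homogeneous, in the graded case) of the same degree $b$ whose forms of degree $b$ are linearly independent over $K$. For $\mathbf n\in\mathbb N_+^d$ put $H^j_{\mathbf n}=X_1^{n_1-1}\cdots X_d^{n_d-1}H^j$, and let $W\subseteq\mathcal D$ be the $R$-submodule generated by all $H^j_{\mathbf n}$ ($1\le j\le\tau$, $\mathbf n\in\mathbb N^d_+$). Then, in both cases: 1. $W$ is (local,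 resp. graded) $L_d^\tau$-admissible, with the generators $H^j_{\mathbf n}$ and with respect to the sequence $x_1,\dots,x_d$. 2. $R/\operatorname{ann}_R(W)$ is a (local, resp. homogeneous) level $K$-algebra of dimension $d$ and type $\tau$. 3. $\operatorname{ann}_R(W)$ is the cone of $\operatorname{ann}_S\langle H^1,\dots,H^\tau\rangle$, that is, $\operatorname{ann}_R(W)=\operatorname{ann}_S\langle H^1,\dots,H^\tau\rangle\,R$. Here the terms have the following meaning. *Admissibility.* $\{H^j_{\mathbf n}\}$ is an admissible system of generators of $W$ with respect to $z_1,\dots,z_d\in\mathcal M$ if it generates $W$ and, for some extension of $z_1,\dots,z_d$ to a minimal system of generators $z_1,\dots,z_m$ of $\mathcal M$ (by linear forms, in the graded case), with $Z^{\mathbf k}\in\mathcal D$ the basis dual to the monomials $z^{\mathbf k}$ under $\langle f,F\rangle=(f\circ F)(0)$: (1) for each $\mathbf n\in\mathbb N^d_+$ the $H^1_{\mathbf n},\dots,H^\tau_{\mathbf n}$ have a common degree $s_{\mathbf n}$ and linearly independent forms of degree $s_{\mathbf n}$; (2) $z_i\circ H^j_{\mathbf n}$ is $H^j_{\mathbf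 n-\mathbf e_i}$ if $n_i\ge2$, and $0$ otherwise; (3) if $n_i\ge2$ then $W_{\mathbf n}\cap V^i_{\mathbf n}\subseteq W_{\mathbf n-\mathbf e_i}$, where $W_{\mathbf n}=\langle H^1_{\mathbf n},\dots,H^\tau_{\mathbf n}\rangle$ and $V^i_{\mathbf n}=\langle Z^{\mathbf k}: k_i\le n_i-2,\ |\mathbf k|\le s_{\mathbf n}\rangle$. In the graded case $W$ is graded $L_d^\tau$-admissible with respect to $z$ if moreover all $H^j_{\mathbf n}$ are homogeneous and $z$ is a regular sequence of linear forms. In the local case $W$ is local $L_d^\tau$-admissible with respect to $z$ if moreover $z$ is general: there is a proper Zariski-dense open set $U\subseteq K^{dm}$, containing the residues of the coefficients $a_{it}\in R$ of some expression $z_i=\sum_t a_{it}x_t$ ($1\le i\le d$), such that $W$ has an admissible system of $\tau$-tuples of generators with respect to every sequence $z'_i=\sum_t a'_{it}x_t$ whose residues $(\overline{a'_{it}})$ lie in $U$. *Level algebras.* A Cohen–Macaulay algebra $A=R/I$ of dimension $d$ with maximal (homogeneous) ideal $\mathfrak m$ has type $\tau=\dim_K\operatorname{Ext}^d_A(A/\mathfrak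 m,A)$. In the graded case, $A$ ($I$ homogeneous) is level if its graded canonical module has a minimal set of generators of the same degree. In the local case, $A$ is level if for some proper Zariski-dense open set $U\subseteq K^{dm}$ and all $a_i=\sum_t a_{it}\overline{x_t}$ ($1\le i\le d$) with residues $(\overline{a_{it}})\in U$, the ideal $J=(a_1,\dots,a_d)$ is a minimal reduction of $\mathfrak m$ and $A/J$ is Artinian level, i.e. the socle of $A/J$ is the last nonzero power of its maximal ideal. -/

import Mathlib

open CategoryTheory

universe u

noncomputable section

namespace LevelAlgebra

/-! ### The divided power module and the contraction action -/

/-- The divided power ring `K_DP[X_s : s ∈ σ]`, as a `K`-vector space: finite linear combinations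
of the formal monomials `X^k`, `k ∈ ℕ^σ`. -/
def DP (σ : Type) (K : Type u) [Field K] : Type u := (σ →₀ ℕ) →₀ K

namespace DP

variable {σ : Type} {K : Type u} [Field K]

instance : AddCommGroup (DP σ K) := inferInstanceAs (AddCommGroup ((σ →₀ ℕ) →₀ K))

instance : Module K (DP σ K) := inferInstanceAs (Module K ((σ →₀ ℕ) →₀ K))

/-- The element `c X^k`. -/
def mono (k : σ →₀ ℕ) (c : K) : DP σ K := Finsupp.single k c

/-- The coefficient of `X^k`. -/
def coeff (k : σ →₀ ℕ) (F : DP σ K) : K := (show (σ →₀ ℕ) →₀ K from F) k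

/-- The finite set of exponents that occur in `F`. -/
def exponents (F : DP σ K) : Finset (σ →₀ ℕ) := (show (σ →₀ ℕ) →₀ K from F).support

/-- The (total) degree of `F`. -/
def degree (F : DP σ K) : ℕ := F.exponents.sup Finsupp.degree

/-- The form of degree `s` of `F`, that is, its homogeneous component of degree `s`. -/
def form (s : ℕ) (F : DP σ K) : DP σ K :=
  Finsupp.filter (fun k : σ →₀ ℕ => k.degree = s) (show (σ →₀ ℕ) →₀ K from F)

/-- `F` is homogeneous of degree `s`. -/
def IsHomogeneous (s : ℕ) (F : DP σ K) : Prop := ∀ k ∈ F.exponents, k.degree = s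

open Classical in
/-- Contraction of a single term: `f ∘ (c X^l) = ∑_{p + q = l} f_p c X^q`. -/
def contractTerm (f : MvPowerSeries σ K) (l : σ →₀ ℕ) : K →+ DP σ K where
  toFun c := ∑ p ∈ Finset.HasAntidiagonal.antidiagonal l, mono p.2 (MvPowerSeries.coeff p.1 f * c)
  map_zero' := Finset.sum_eq_zero fun p _ => by
    rw [mul_zero]; exact Finsupp.single_zero _
  map_add' a b := by
    rw [← Finset.sum_add_distrib]
    refine Finset.sum_congr rfl fun p _ => ?_
    rw [mul_add]; exact Finsupp.single_add _ _ _

/-- The contraction action `f ∘ F` of power series on the divided power module. -/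
def contract (f : MvPowerSeries σ K) : DP σ K →+ DP σ K :=
  Finsupp.liftAddHom (contractTerm f)

open Classical in
theorem contract_mono (f : MvPowerSeries σ K) (l : σ →₀ ℕ) (c : K) :
    contract f (mono l c)
      = ∑ p ∈ Finset.HasAntidiagonal.antidiagonal l, mono p.2 (MvPowerSeries.coeff p.1 f * c) :=
  Finsupp.liftAddHom_apply_single (contractTerm f) l c

theorem addHom_ext' {f g : DP σ K →+ DP σ K} (h : ∀ k c, f (mono k c) = g (mono k c)) : f = g :=
  Finsupp.addHom_ext h

theorem mono_add (k : σ →₀ ℕ) (a b : K) : mono k (a + b) = mono k a + mono k b :=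
  Finsupp.single_add _ _ _

theorem mono_zero (k : σ →₀ ℕ) : mono k (0 : K) = 0 := Finsupp.single_zero _

theorem mono_sum {ι : Type*} (k : σ →₀ ℕ) (s : Finset ι) (g : ι → K) :
    mono k (∑ i ∈ s, g i) = ∑ i ∈ s, mono k (g i) :=
  map_sum (Finsupp.singleAddHom k : K →+ ((σ →₀ ℕ) →₀ K)) g s

theorem contract_one : contract (1 : MvPowerSeries σ K) = AddMonoidHom.id _ := by
  classical
  refine addHom_ext' fun l c => ?_
  rw [contract_mono, Finset.sum_eq_single (0, l)]
  · simp
  · rintro ⟨p, q⟩ hp hne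
    have : p ≠ 0 := by
      rintro rfl
      apply hne
      simpa using hp
    simp [MvPowerSeries.coeff_one, this, mono_zero]
  · intro h; simp at h

theorem contract_mul (f g : MvPowerSeries σ K) :
    contract (f * g) = (contract f).comp (contract g) := by
  classical
  refine addHom_ext' fun l c => ?_
  rw [AddMonoidHom.comp_apply, contract_mono, contract_mono, map_sum]
  simp only [contract_mono, MvPowerSeries.coeff_mul, Finset.sum_mul, mono_sum, Finset.sum_sigma']
  refine Finset.sum_nbij' (fun x => ⟨(x.2.2, x.2.1 + x.1.2), (x.2.1, x.1.2)⟩)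
    (fun x => ⟨(x.2.1 + x.1.1, x.2.2), (x.2.1, x.1.1)⟩) ?_ ?_ ?_ ?_ ?_
  · rintro ⟨⟨p, q⟩, ⟨i, j⟩⟩ h
    simp only [Finset.mem_sigma, Finset.HasAntidiagonal.mem_antidiagonal] at h ⊢
    obtain ⟨rfl, rfl⟩ := h
    exact ⟨by abel, trivial⟩
  · rintro ⟨⟨p, q⟩, ⟨i, j⟩⟩ h
    simp only [Finset.mem_sigma, Finset.HasAntidiagonal.mem_antidiagonal] at h ⊢
    obtain ⟨rfl, rfl⟩ := h
    exact ⟨by abel, trivial⟩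
  · rintro ⟨⟨p, q⟩, ⟨i, j⟩⟩ h
    simp only [Finset.mem_sigma, Finset.HasAntidiagonal.mem_antidiagonal] at h
    obtain ⟨rfl, rfl⟩ := h
    rfl
  · rintro ⟨⟨p, q⟩, ⟨i, j⟩⟩ h
    simp only [Finset.mem_sigma, Finset.HasAntidiagonal.mem_antidiagonal] at h
    obtain ⟨rfl, rfl⟩ := h
    rfl
  · rintro ⟨⟨p, q⟩, ⟨i, j⟩⟩ _
    simp only [mul_assoc]

theorem contract_add (f g : MvPowerSeries σ K) : contract (f + g) = contract f + contract g := by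
  classical
  refine addHom_ext' fun l c => ?_
  rw [AddMonoidHom.add_apply]
  simp only [contract_mono, map_add, add_mul, mono_add, Finset.sum_add_distrib]

theorem contract_zero : contract (0 : MvPowerSeries σ K) = 0 := by
  classical
  refine addHom_ext' fun l c => ?_
  rw [contract_mono]
  simp [mono_zero]

/-- The divided power module as a module over the power series ring, by contraction. -/
instance : Module (MvPowerSeries σ K) (DP σ K) where
  smul f F := contract f F
  one_smul F := DFunLike.congr_fun contract_one F
  mul_smul f g F := DFunLike.congr_fun (contract_mul f g) F
  smul_zero f := map_zero (contract f)
  smul_add f := map_add (contract f)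
  add_smul f g F := DFunLike.congr_fun (contract_add f g) F
  zero_smul F := DFunLike.congr_fun contract_zero F

/-- The divided power module as a module over the polynomial ring, by contraction. -/
instance : Module (MvPolynomial σ K) (DP σ K) :=
  Module.compHom (DP σ K) (MvPolynomial.coeToMvPowerSeries.ringHom (R := K) (σ := σ))

/-- The element `X_1^{n_1-1} ⋯ X_d^{n_d-1} H` (formal multiplication) of
`K_DP[X_1, …, X_d, X_{d+1}, …, X_{d+e}]`, for `H ∈ K_DP[X_{d+1}, …, X_{d+e}]`. -/
def coneTerm {d e : ℕ} (n : Fin d → ℕ) (H : DP (Fin e) K) : DP (Fin d ⊕ Fin e) K :=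
  Finsupp.mapDomain
    (fun k : Fin e →₀ ℕ => Finsupp.sumElim (Finsupp.equivFunOnFinite.symm fun i => n i - 1) k)
    (show (Fin e →₀ ℕ) →₀ K from H)

end DP

/-! ### Admissible submodules -/

section Admissible

variable {σ : Type} [Fintype σ] {K : Type u} [Field K]
  {R : Type u} [CommRing R] [Module R (DP σ K)]

/-- `Z k` (`k ∈ ℕ^σ`) are the monomials `Z^k` in the elements dual to `z`: the basis of the divided
power module that is dual to the monomials in `z` under the pairing `⟨f, F⟩ = (f ∘ F)(0)`.
In particular `z_i ∘ Z_j = δ_ij`. -/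
def IsDualMonomials (z : σ → R) (Z : (σ →₀ ℕ) → DP σ K) : Prop :=
  open Classical in
  ∀ k l : σ →₀ ℕ, DP.coeff 0 ((k.prod fun i a => z i ^ a) • Z l) = if k = l then 1 else 0

/-- Multi-indices all of whose entries are positive. -/
def IsPos {d : ℕ} (n : Fin d → ℕ) : Prop := ∀ i, 0 < n i

/-- `W_n`, the submodule generated by `H_n^1, …, H_n^τ`. -/
def piece (R : Type u) [CommRing R] [Module R (DP σ K)] {d τ : ℕ}
    (H : (Fin d → ℕ) → Fin τ → DP σ K) (n : Fin d → ℕ) : Submodule R (DP σ K) :=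
  Submodule.span R (Set.range (H n))

/-- The submodule generated by all `H_n^j`, `n ∈ ℕ_+^d`. (Only the values of `H` at positive
multi-indices are ever used.) -/
def generated (R : Type u) [CommRing R] [Module R (DP σ K)] {d τ : ℕ}
    (H : (Fin d → ℕ) → Fin τ → DP σ K) : Submodule R (DP σ K) :=
  Submodule.span R {F | ∃ n j, IsPos n ∧ F = H n j}

/-- `V_n^i`: the submodule generated by the `Z^k` with `k_i ≤ n_i - 2` and `|k| ≤ s`
(`ι i` is the place of the `i`-th element of the sequence in the system of generators). -/
def boundedPart (R : Type u) [CommRing R] [Module R (DP σ K)] (Z : (σ →₀ ℕ) → DP σ K)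
    {d : ℕ} (ι : Fin d → σ) (n : Fin d → ℕ) (i : Fin d) (s : ℕ) : Submodule R (DP σ K) :=
  Submodule.span R {F | ∃ k : σ →₀ ℕ, k (ι i) + 2 ≤ n i ∧ k.degree ≤ s ∧ F = Z k}

open Classical in
/-- `{H_n^j}` is a system of generators of `W` that satisfies the conditions of
`L_d^τ`-admissibility with respect to the sequence `z_1, …, z_d`. Here `𝔐` is the maximal
(homogeneous) ideal of `R`, and `P` is the set of elements from which a system of generators of `𝔐`
may be formed (all of `𝔐` in the local case, the linear forms in the graded case). -/
structure IsAdmissibleSystem (𝔐 : Ideal R) (P : Set R) {d τ : ℕ} (z : Fin d → R)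
    (H : (Fin d → ℕ) → Fin τ → DP σ K) (W : Submodule R (DP σ K)) : Prop where
  generates : W = generated R H
  /-- The sequence `z` extends to a minimal system of generators of `𝔐` (one generator per
  variable), with dual monomials `Z^k`, such that the conditions hold with `s_n` the common degree
  of `H_n^1, …, H_n^τ`. -/
  conditions : ∃ (ι : Fin d ↪ σ) (y : σ → R) (Z : (σ →₀ ℕ) → DP σ K) (s : (Fin d → ℕ) → ℕ),
    (∀ i, y (ι i) = z i) ∧ (∀ t, y t ∈ P) ∧ Ideal.span (Set.range y) = 𝔐 ∧
    IsDualMonomials y Z ∧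
    (∀ n, IsPos n → (∀ j, (H n j).degree = s n) ∧
      LinearIndependent K fun j => DP.form (s n) (H n j)) ∧
    (∀ n, IsPos n → ∀ i j,
      z i • H n j = if IsPos (n - Pi.single i 1) then H (n - Pi.single i 1) j else 0) ∧
    (∀ n i, IsPos n → IsPos (n - Pi.single i 1) →
      piece R H n ⊓ boundedPart R Z ι n i (s n) ≤ piece R H (n - Pi.single i 1))

end Admissible

/-! ### General elements -/

section General

variable {σ : Type} [Fintype σ] {K : Type u} [Field K]

/-- `U` is a proper, Zariski-open, Zariski-dense subset of the affine space `K^ι`. -/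
def IsProperDenseOpen {ι : Type} (U : Set (ι → K)) : Prop :=
  let IsOpen' : Set (ι → K) → Prop := fun V =>
    ∃ I : Ideal (MvPolynomial ι K), V = {x | ∃ p ∈ I, MvPolynomial.eval x p ≠ 0}
  U ≠ Set.univ ∧ IsOpen' U ∧ ∀ V, IsOpen' V → V.Nonempty → (U ∩ V).Nonempty

/-- The elements `z_i = ∑_t a_{it} x_t`. -/
def linearCombs {d : ℕ} (a : Fin d → σ → MvPowerSeries σ K) : Fin d → MvPowerSeries σ K :=
  fun i => ∑ t, a i t * MvPowerSeries.X t

/-- The residues of the `a_{it}` in `K`. -/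
def residues {d : ℕ} (a : Fin d → σ → MvPowerSeries σ K) : Fin d × σ → K :=
  fun p => MvPowerSeries.constantCoeff (a p.1 p.2)

/-- `z_1, …, z_d` is a sequence of general elements of the maximal ideal as regards the
property `Q`: there is a proper dense Zariski-open set of coefficient matrices that contains the
residues of a coefficient matrix of `z`, and all sequences with residues in it have `Q`. -/
def IsGeneral {d : ℕ} (Q : (Fin d → MvPowerSeries σ K) → Prop) (z : Fin d → MvPowerSeries σ K) :
    Prop :=
  ∃ U : Set (Fin d × σ → K), IsProperDenseOpen U ∧
    (∃ a, residues a ∈ U ∧ z = linearCombs a) ∧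
    ∀ a : Fin d → σ → MvPowerSeries σ K, residues a ∈ U → Q (linearCombs a)

end General

section LocalGraded

variable (σ : Type) [Fintype σ] (K : Type u) [Field K]

/-- The maximal ideal `(x_1, …, x_m)` of the power series ring. -/
def maxIdealS : Ideal (MvPowerSeries σ K) := Ideal.span (Set.range MvPowerSeries.X)

/-- The maximal homogeneous ideal `(x_1, …, x_m)` of the polynomial ring. -/
def maxIdealP : Ideal (MvPolynomial σ K) := Ideal.span (Set.range MvPolynomial.X)

variable {σ K}

/-- `W` is local `L_d^τ`-admissible with respect to `z`, with system of generators `H`. -/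
def IsLocalAdmissibleWrt {d τ : ℕ} (z : Fin d → MvPowerSeries σ K)
    (H : (Fin d → ℕ) → Fin τ → DP σ K) (W : Submodule (MvPowerSeries σ K) (DP σ K)) : Prop :=
  IsAdmissibleSystem (maxIdealS σ K) (maxIdealS σ K : Set (MvPowerSeries σ K)) z H W ∧
    IsGeneral (fun z' => ∃ H' : (Fin d → ℕ) → Fin τ → DP σ K,
      IsAdmissibleSystem (maxIdealS σ K) (maxIdealS σ K : Set (MvPowerSeries σ K)) z' H' W) z

/-- `W` is a local `L_d^τ`-admissible submodule. -/
def IsLocalAdmissible (d τ : ℕ) (W : Submodule (MvPowerSeries σ K) (DP σ K)) : Prop :=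
  ∃ (z : Fin d → MvPowerSeries σ K) (H : (Fin d → ℕ) → Fin τ → DP σ K),
    IsLocalAdmissibleWrt z H W

/-- `W` is graded `L_d^τ`-admissible with respect to `z`, with system of generators `H`: the
`H_n^j` are homogeneous and `z` is a regular sequence of linear forms. -/
def IsGradedAdmissibleWrt {d τ : ℕ} (z : Fin d → MvPolynomial σ K)
    (H : (Fin d → ℕ) → Fin τ → DP σ K) (W : Submodule (MvPolynomial σ K) (DP σ K)) : Prop :=
  IsAdmissibleSystem (maxIdealP σ K) {f : MvPolynomial σ K | f.IsHomogeneous 1} z H W ∧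
    (∀ n, IsPos n → ∀ j, ∃ s, (H n j).IsHomogeneous s) ∧
    (∀ i, (z i).IsHomogeneous 1) ∧
    RingTheory.Sequence.IsRegular (MvPolynomial σ K) (List.ofFn z)

/-- `W` is a graded `L_d^τ`-admissible submodule. -/
def IsGradedAdmissible (d τ : ℕ) (W : Submodule (MvPolynomial σ K) (DP σ K)) : Prop :=
  ∃ (z : Fin d → MvPolynomial σ K) (H : (Fin d → ℕ) → Fin τ → DP σ K),
    IsGradedAdmissibleWrt z H W

end LocalGraded

/-! ### Level algebras -/

section Level

/-- `A`, with maximal (homogeneous) ideal `𝔪`, is Cohen–Macaulay of dimension `d`: it is Noetherian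
of Krull dimension `d`, and `𝔪` contains an `A`-regular sequence of length `d`. -/
def IsCohenMacaulayOfDim (A : Type u) [CommRing A] (𝔪 : Ideal A) (d : ℕ) : Prop :=
  IsNoetherianRing A ∧ 𝔪.IsMaximal ∧ ringKrullDim A = d ∧
    ∃ rs : List A, rs.length = d ∧ (∀ r ∈ rs, r ∈ 𝔪) ∧ RingTheory.Sequence.IsRegular A rs

/-- The Cohen–Macaulay algebra `A` of dimension `d` has type `τ`: `Ext^d_A(A/𝔪, A)` is
`τ`-dimensional over `A/𝔪`. -/
def HasType (A : Type u) [CommRing A] (𝔪 : Ideal A) (d τ : ℕ) : Prop :=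
  Nonempty
    (Abelian.Ext (ModuleCat.of A (A ⧸ 𝔪)) (ModuleCat.of A A) d ≃ₗ[A] (Fin τ → A ⧸ 𝔪))

/-- `J` is a reduction of `𝔪`. -/
def IsReduction {A : Type u} [CommRing A] (𝔪 J : Ideal A) : Prop :=
  J ≤ 𝔪 ∧ ∃ k : ℕ, 𝔪 ^ (k + 1) = J * 𝔪 ^ k

/-- An Artinian local ring `B` with maximal ideal `𝔪` is level: the socle `(0 : 𝔪)` equals
`𝔪 ^ s`, where `s` is the socle degree, the largest integer with `𝔪 ^ s ≠ 0`. -/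
def IsArtinianLevel (B : Type u) [CommRing B] (𝔪 : Ideal B) : Prop :=
  IsArtinianRing B ∧ ∃ s : ℕ, 𝔪 ^ s ≠ ⊥ ∧ 𝔪 ^ (s + 1) = ⊥ ∧ Submodule.annihilator 𝔪 = 𝔪 ^ s

variable {σ : Type} [Fintype σ] {K : Type u} [Field K]

/-- `A = K⟦x_1, …, x_m⟧ / I` is a local level `K`-algebra of dimension `d` and type `τ`: it is
Cohen–Macaulay of dimension `d` and type `τ`, and `A/J` is Artinian level for a general minimal
reduction `J` of its maximal ideal. -/
structure IsLocalLevel (I : Ideal (MvPowerSeries σ K)) (d τ : ℕ) : Prop where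
  cohenMacaulay : IsCohenMacaulayOfDim (MvPowerSeries σ K ⧸ I)
    ((maxIdealS σ K).map (Ideal.Quotient.mk I)) d
  type : HasType (MvPowerSeries σ K ⧸ I) ((maxIdealS σ K).map (Ideal.Quotient.mk I)) d τ
  level : ∃ z : Fin d → MvPowerSeries σ K, IsGeneral (fun a =>
    let 𝔪 : Ideal (MvPowerSeries σ K ⧸ I) := (maxIdealS σ K).map (Ideal.Quotient.mk I)
    let J : Ideal (MvPowerSeries σ K ⧸ I) :=
      Ideal.span (Set.range fun i => Ideal.Quotient.mk I (a i))
    Minimal (IsReduction 𝔪) J ∧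
      IsArtinianLevel ((MvPowerSeries σ K ⧸ I) ⧸ J) (𝔪.map (Ideal.Quotient.mk J))) z

/-- The graded module `ω = ⊕_j 𝒲_j` over `A = K[x_1, …, x_m] / I` is a graded canonical module of
`A`, where `A` is Cohen–Macaulay of dimension `d`, up to a shift of the grading: it is a finitely
generated graded module, `Ext^i_A(K, ω) = 0` for `i ≠ d`, and `Ext^d_A(K, ω) ≅ K`, with
`K = A/𝔪`. -/
structure IsGradedCanonicalModule (I : Ideal (MvPolynomial σ K)) (d : ℕ)
    (ω : ModuleCat.{u} (MvPolynomial σ K ⧸ I)) (𝒲 : ℤ → AddSubgroup ω) : Prop where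
  finite : Module.Finite (MvPolynomial σ K ⧸ I) ω
  decomposition : DirectSum.IsInternal 𝒲
  smul_mem : ∀ (i : ℕ) (j : ℤ) (f : MvPolynomial σ K) (w : ω), f.IsHomogeneous i → w ∈ 𝒲 j →
    Ideal.Quotient.mk I f • w ∈ 𝒲 (i + j)
  ext_eq_zero : ∀ i : ℕ, i ≠ d → Subsingleton (Abelian.Ext
    (ModuleCat.of (MvPolynomial σ K ⧸ I)
      ((MvPolynomial σ K ⧸ I) ⧸ (maxIdealP σ K).map (Ideal.Quotient.mk I))) ω i)
  ext_dim : Nonempty (Abelian.Ext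
    (ModuleCat.of (MvPolynomial σ K ⧸ I)
      ((MvPolynomial σ K ⧸ I) ⧸ (maxIdealP σ K).map (Ideal.Quotient.mk I))) ω d
    ≃ₗ[MvPolynomial σ K ⧸ I]
      ((MvPolynomial σ K ⧸ I) ⧸ (maxIdealP σ K).map (Ideal.Quotient.mk I)))

attribute [local instance] MvPolynomial.gradedAlgebra

/-- `A = K[x_1, …, x_m] / I` is a homogeneous level `K`-algebra of dimension `d` and type `τ`: `I`
is homogeneous, `A` is Cohen–Macaulay of dimension `d` and type `τ`, and its canonical module has a
minimal set of generators that all have the same degree. -/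
structure IsGradedLevel (I : Ideal (MvPolynomial σ K)) (d τ : ℕ) : Prop where
  homogeneous : I.IsHomogeneous (MvPolynomial.homogeneousSubmodule σ K)
  cohenMacaulay : IsCohenMacaulayOfDim (MvPolynomial σ K ⧸ I)
    ((maxIdealP σ K).map (Ideal.Quotient.mk I)) d
  type : HasType (MvPolynomial σ K ⧸ I) ((maxIdealP σ K).map (Ideal.Quotient.mk I)) d τ
  level : ∃ (ω : ModuleCat.{u} (MvPolynomial σ K ⧸ I)) (𝒲 : ℤ → AddSubgroup ω),
    IsGradedCanonicalModule I d ω 𝒲 ∧ ∃ (c : ℤ) (S : Set ω), S ⊆ 𝒲 c ∧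
      Minimal (fun T : Set ω => Submodule.span (MvPolynomial σ K ⧸ I) T = ⊤) S

end Level

end LevelAlgebra

end

noncomputable section

namespace LevelAlgebra

namespace DP

variable {σ : Type} {K : Type u} [Field K]

/-! ### Coefficients of contractions -/

/-! Everything is read off from slices. Collecting the terms with a fixed monomial in the first `d`
variables writes an element of the divided power module as a finite sum `∑ X^p G_p` and a series as
`∑ x^p f_p`, with `G_p` and `f_p` in the last variables only. An element is in `W` iff all its
slices are in `⟨H^1, …, H^τ⟩` (`mem_span_coneTerm_iff`), and `f` kills `W` iff all its slices lie in
`𝔞 = ann_S⟨H⟩` (`mem_annihilator_span_coneTerm_iff`). Such an `f` is in `𝔞R`: for series because `𝔞`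
is finitely generated, for polynomials because there are only finitely many slices. So `A = R/ann W`
is the power series or polynomial ring over `S/𝔞` in `x_1, …, x_d`; these variables form a regular
sequence, and modulo them `A` becomes `S/𝔞`.

Independence of the leading forms enters through dual forms `g_i` of degree `b` with `g_i ∘ H^j =
δ_ij` (`IndepTop.exists_dual`). Their classes are a basis of the socle of `S/𝔞`, which is therefore
the `b`-th power of the maximal ideal: `S/𝔞` is Artinian level with a `τ`-dimensional socle. The
isomorphism `Ext^d(A/𝔪, A) ≅ Hom(A/𝔪, A/(x_1, …, x_d))` (`ext_of_isWeaklyRegular`) gives the type of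
`A`.

A general sequence `z` has an invertible matrix of coefficients at `x_1, …, x_d`, so together with
the last variables it generates the maximal ideal. The adjoint of the substitution, inverted, is a
linear automorphism `coordChange` that turns contraction by the variables into contraction by the
new generators, respects degrees and commutes with series in the last variables. By double
annihilation `W` is exactly the set of elements killed by `𝔞`, hence `coordChange` maps `W` onto
itself and the cone system to an admissible system with respect to `z`. In the same way `A/(z)` is
the quotient by the annihilator of `τ` elements with independent leading forms, hence level. The
ideal `(z)` is a reduction because all forms of degree `b + 1` in the last variables lie in `𝔞`. It
is minimal because a smaller ideal would act too trivially on the divided powers of a linear form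
that vanishes on its linear parts (`generator_mem_of_reduction`).

In the graded case the canonical module is realised by Laurent tails with coefficients in `⟨H⟩`:
finite sums over exponents in `ℤ^d`, with `x_i` lowering exponents. The tails with all exponents
negative form the canonical module `ω`; all tails modulo those with some negative exponent give `W`.
The cone `W` is injective over `A` (Baer's criterion and Artin–Rees) with a one-dimensional socle.
Going from `W` to `ω` one variable at a time gives short exact sequences whose middle term has a
bijective `x_j`, hence no `Ext` from the residue field, and each raises the degree of the only
nonzero `Ext` by one. Finally, `ω` is minimally generated by `τ` elements of degree `d - b`. -/

@[ext]
theorem ext {F G : DP σ K} (h : ∀ k, coeff k F = coeff k G) : F = G := Finsupp.ext h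

@[simp]
theorem coeff_add (k : σ →₀ ℕ) (F G : DP σ K) : coeff k (F + G) = coeff k F + coeff k G := rfl

@[simp]
theorem coeff_zero (k : σ →₀ ℕ) : coeff k (0 : DP σ K) = 0 := rfl

@[simp]
theorem coeff_smul (k : σ →₀ ℕ) (c : K) (F : DP σ K) : coeff k (c • F) = c * coeff k F := rfl

/-- Taking a coefficient, as a linear functional. -/
def lcoeff (k : σ →₀ ℕ) : DP σ K →ₗ[K] K where
  toFun := coeff k
  map_add' := coeff_add k
  map_smul' c F := coeff_smul k c F

@[simp]
theorem coeff_sum {ι : Type*} (k : σ →₀ ℕ) (s : Finset ι) (F : ι → DP σ K) :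
    coeff k (∑ i ∈ s, F i) = ∑ i ∈ s, coeff k (F i) :=
  map_sum (lcoeff k) F s

open Classical in
theorem coeff_mono (k l : σ →₀ ℕ) (c : K) : coeff k (mono l c) = if l = k then c else 0 :=
  Finsupp.single_apply

theorem mem_exponents {k : σ →₀ ℕ} {F : DP σ K} : k ∈ F.exponents ↔ coeff k F ≠ 0 :=
  Finsupp.mem_support_iff

theorem eq_sum_mono (F : DP σ K) : F = ∑ k ∈ F.exponents, mono k (coeff k F) :=
  (Finsupp.sum_single (show (σ →₀ ℕ) →₀ K from F)).symm

theorem smul_def (f : MvPowerSeries σ K) (F : DP σ K) : f • F = contract f F := rfl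

open Classical in
theorem coeff_smul_mono (f : MvPowerSeries σ K) (k l : σ →₀ ℕ) (c : K) :
    coeff k (f • mono l c) = if k ≤ l then MvPowerSeries.coeff (l - k) f * c else 0 := by
  rw [smul_def, contract_mono, coeff_sum]
  simp only [coeff_mono]
  split_ifs with h
  · rw [Finset.sum_eq_single (l - k, k)]
    · simp
    · rintro ⟨p, q⟩ hpq hne
      rw [if_neg]
      rintro rfl
      rw [Finset.HasAntidiagonal.mem_antidiagonal] at hpq
      subst hpq
      simp at hne
    · intro h'
      simp [tsub_add_cancel_of_le h] at h'
  · refine Finset.sum_eq_zero ?_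
    rintro ⟨p, q⟩ hpq
    rw [if_neg]
    rintro rfl
    rw [Finset.HasAntidiagonal.mem_antidiagonal] at hpq
    exact h (hpq ▸ le_add_self)

open Classical in
theorem coeff_series_smul (f : MvPowerSeries σ K) (k : σ →₀ ℕ) (F : DP σ K) :
    coeff k (f • F) =
      ∑ l ∈ F.exponents, if k ≤ l then MvPowerSeries.coeff (l - k) f * coeff l F else 0 := by
  conv_lhs => rw [eq_sum_mono F, Finset.smul_sum, coeff_sum]
  simp only [coeff_smul_mono]

theorem coeff_zero_series_smul (f : MvPowerSeries σ K) (F : DP σ K) :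
    coeff 0 (f • F) = ∑ l ∈ F.exponents, MvPowerSeries.coeff l f * coeff l F := by
  classical
  rw [coeff_series_smul]
  simp

theorem coeff_monomial_smul (p k : σ →₀ ℕ) (a : K) (F : DP σ K) :
    coeff k (MvPowerSeries.monomial p a • F) = a * coeff (k + p) F := by
  classical
  rw [coeff_series_smul]
  simp only [MvPowerSeries.coeff_monomial]
  by_cases h : coeff (k + p) F = 0
  · rw [h, mul_zero]
    refine Finset.sum_eq_zero fun l _ => ?_
    split_ifs with h1 h2
    · rw [← h2, add_tsub_cancel_of_le h1] at h
      rw [h, mul_zero]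
    · simp
    · rfl
  · rw [Finset.sum_eq_single (k + p)]
    · simp
    · intro l _ hne
      split_ifs with h1 h2
      · rw [← h2, add_tsub_cancel_of_le h1] at hne
        exact absurd rfl hne
      · simp
      · rfl
    · intro h'
      exact absurd (mem_exponents.2 h) h'

theorem coeff_X_smul (s : σ) (k : σ →₀ ℕ) (F : DP σ K) :
    coeff k ((MvPowerSeries.X s : MvPowerSeries σ K) • F) = coeff (k + Finsupp.single s 1) F := by
  rw [MvPowerSeries.X, coeff_monomial_smul, one_mul]

theorem C_smul (c : K) (F : DP σ K) : (MvPowerSeries.C c : MvPowerSeries σ K) • F = c • F := by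
  ext k
  rw [← MvPowerSeries.monomial_zero_eq_C_apply, coeff_monomial_smul, add_zero, coeff_smul]

/-- The coefficients of `F` are the values of the pairing with the monomials. -/
theorem coeff_eq_coeff_zero_smul (k : σ →₀ ℕ) (F : DP σ K) :
    coeff k F = coeff 0 ((MvPowerSeries.monomial k (1 : K)) • F) := by
  rw [coeff_monomial_smul, one_mul, zero_add]

instance : IsScalarTower K (MvPowerSeries σ K) (DP σ K) where
  smul_assoc c f F := by
    rw [MvPowerSeries.smul_eq_C_mul, mul_smul, C_smul]

theorem polynomial_smul (f : MvPolynomial σ K) (F : DP σ K) :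
    f • F = (f : MvPowerSeries σ K) • F := rfl

instance : IsScalarTower K (MvPolynomial σ K) (DP σ K) where
  smul_assoc c f F := by
    rw [polynomial_smul, polynomial_smul, ← smul_assoc]
    congr 1

instance : SMulCommClass (MvPowerSeries σ K) K (DP σ K) where
  smul_comm f c F := by
    rw [← C_smul, ← C_smul, ← mul_smul, ← mul_smul, mul_comm]

/-! ### The degree filtration -/

/-- The elements all of whose terms have degree less than `s`. -/
def degLT (σ : Type) (K : Type u) [Field K] (s : ℕ) : Submodule K (DP σ K) where
  carrier := {F | ∀ k, s ≤ k.degree → coeff k F = 0}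
  add_mem' hF hG k hk := by rw [coeff_add, hF k hk, hG k hk, add_zero]
  zero_mem' _ _ := rfl
  smul_mem' c F hF k hk := by rw [coeff_smul, hF k hk, mul_zero]

theorem degLT_mono {s t : ℕ} (h : s ≤ t) : degLT σ K s ≤ degLT σ K t :=
  fun _ hF k hk => hF k (h.trans hk)

theorem eq_zero_of_mem_degLT_zero {F : DP σ K} (h : F ∈ degLT σ K 0) : F = 0 :=
  ext fun k => h k (Nat.zero_le _)

theorem degree_lt_of_mem_exponents {F : DP σ K} {k : σ →₀ ℕ} (hk : k ∈ F.exponents) :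
    k.degree ≤ F.degree :=
  Finset.le_sup (f := Finsupp.degree) hk

theorem mem_degLT_succ_degree (F : DP σ K) : F ∈ degLT σ K (F.degree + 1) := by
  intro k hk
  by_contra h
  have := degree_lt_of_mem_exponents (mem_exponents.2 h)
  omega

theorem degree_le_of_mem_degLT {F : DP σ K} {s : ℕ} (h : F ∈ degLT σ K (s + 1)) :
    F.degree ≤ s := by
  refine Finset.sup_le fun k hk => ?_
  by_contra h'
  exact mem_exponents.1 hk (h k (by omega))

theorem smul_mem_degLT (f : MvPowerSeries σ K) {s : ℕ} {F : DP σ K} (hF : F ∈ degLT σ K s) :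
    f • F ∈ degLT σ K s := by
  classical
  intro k hk
  rw [coeff_series_smul]
  refine Finset.sum_eq_zero fun l _ => ?_
  split_ifs with h
  · rw [hF l (hk.trans (Finsupp.degree_mono h)), mul_zero]
  · rfl

/-- Only the constant coefficient of `f` leaves a monomial in place; all other terms lower its
degree. -/
theorem smul_mem_degLT_of_constantCoeff_eq_zero {f : MvPowerSeries σ K}
    (hf : MvPowerSeries.constantCoeff f = 0) {s : ℕ} {F : DP σ K}
    (hF : F ∈ degLT σ K (s + 1)) : f • F ∈ degLT σ K s := by
  classical
  intro k hk
  rw [coeff_series_smul]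
  refine Finset.sum_eq_zero fun l _ => ?_
  split_ifs with h
  · by_cases hl : l = k
    · subst hl
      rw [tsub_self, MvPowerSeries.coeff_zero_eq_constantCoeff, hf, zero_mul]
    · rw [hF l, mul_zero]
      have h1 : (l - k).degree + k.degree = l.degree := by
        rw [← map_add, tsub_add_cancel_of_le h]
      have h2 : (l - k).degree ≠ 0 := by
        rw [Ne, Finsupp.degree_eq_zero_iff]
        intro h0
        exact hl (le_antisymm (tsub_eq_zero_iff_le.1 h0) h)
      omega
  · rfl

theorem smul_eq_of_mem_degLT_one (f : MvPowerSeries σ K) {F : DP σ K}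
    (hF : F ∈ degLT σ K 1) : f • F = MvPowerSeries.constantCoeff f • F := by
  have h : (f - MvPowerSeries.C (MvPowerSeries.constantCoeff f)) • F = 0 :=
    eq_zero_of_mem_degLT_zero (smul_mem_degLT_of_constantCoeff_eq_zero (by simp) hF)
  rwa [sub_smul, C_smul, sub_eq_zero] at h

theorem eq_mono_of_mem_degLT_one {F : DP σ K} (hF : F ∈ degLT σ K 1) :
    F = mono 0 (coeff 0 F) := by
  ext k
  classical
  rw [coeff_mono]
  split_ifs with h
  · rw [h]
  · refine hF k ?_
    have : k.degree ≠ 0 := by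
      rw [Ne, Finsupp.degree_eq_zero_iff]
      exact fun h' => h h'.symm
    omega

/-! ### The maximal ideal of the power series ring and its action on the degree filtration -/

section MaxIdeal

variable [Fintype σ]

theorem mem_maxIdealS_iff {f : MvPowerSeries σ K} :
    f ∈ maxIdealS σ K ↔ MvPowerSeries.constantCoeff f = 0 := by
  classical
  constructor
  · intro h
    have : maxIdealS σ K ≤ RingHom.ker (MvPowerSeries.constantCoeff (σ := σ) (R := K)) := by
      rw [maxIdealS, Ideal.span_le]
      rintro _ ⟨s, rfl⟩
      simp
    exact this h
  -- Induction on a set `T` of variables that meets every monomial of `f`: the terms free of `x_s`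
  -- are met by the smaller set, and the remaining ones are divisible by `x_s`.
  · suffices h : ∀ (T : Finset σ) (f : MvPowerSeries σ K),
        (∀ k : σ →₀ ℕ, (∀ s ∈ T, k s = 0) → MvPowerSeries.coeff k f = 0) → f ∈ maxIdealS σ K by
      intro hf
      refine h Finset.univ f fun k hk => ?_
      have : k = 0 := Finsupp.ext fun s => hk s (Finset.mem_univ s)
      rw [this, MvPowerSeries.coeff_zero_eq_constantCoeff, hf]
    intro T
    induction T using Finset.induction_on with
    | empty =>
      intro f hf
      have : f = 0 := MvPowerSeries.ext fun k => hf k (by simp)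
      rw [this]
      exact zero_mem _
    | insert s T _ ih =>
      intro f hf
      let g : MvPowerSeries σ K := fun k => if k s = 0 then MvPowerSeries.coeff k f else 0
      have hg : ∀ k, MvPowerSeries.coeff k g = if k s = 0 then MvPowerSeries.coeff k f else 0 :=
        fun _ => rfl
      have h1 : g ∈ maxIdealS σ K := by
        refine ih g fun k hk => ?_
        rw [hg]
        split_ifs with h0
        · refine hf k fun t ht => ?_
          rcases Finset.mem_insert.1 ht with rfl | ht
          exacts [h0, hk t ht]
        · rfl
      have h2 : f - g ∈ maxIdealS σ K := by
        have : MvPowerSeries.X s ∣ f - g := by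
          rw [MvPowerSeries.X_dvd_iff]
          intro m hm
          rw [map_sub, hg, if_pos hm, sub_self]
        obtain ⟨c, hc⟩ := this
        rw [hc]
        exact Ideal.mul_mem_right _ _ (Ideal.subset_span ⟨s, rfl⟩)
      have := add_mem h2 h1
      rwa [sub_add_cancel] at this

theorem smul_mem_degLT_of_mem_maxIdealS {f : MvPowerSeries σ K} (hf : f ∈ maxIdealS σ K) {s : ℕ}
    {F : DP σ K} (hF : F ∈ degLT σ K (s + 1)) : f • F ∈ degLT σ K s :=
  smul_mem_degLT_of_constantCoeff_eq_zero (mem_maxIdealS_iff.1 hf) hF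

theorem smul_mem_degLT_of_mem_pow {f : MvPowerSeries σ K} {k s : ℕ} (hf : f ∈ maxIdealS σ K ^ k)
    {F : DP σ K} (hF : F ∈ degLT σ K (s + k)) : f • F ∈ degLT σ K s := by
  induction k generalizing f F with
  | zero => exact smul_mem_degLT f hF
  | succ k ih =>
    rw [pow_succ] at hf
    induction hf using Submodule.mul_induction_on' with
    | mem_mul_mem a ha b hb =>
      rw [mul_smul]
      exact ih ha (smul_mem_degLT_of_mem_maxIdealS hb hF)
    | add a _ b _ h1 h2 =>
      rw [add_smul]
      exact add_mem h1 h2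

theorem smul_eq_zero_of_mem_pow {f : MvPowerSeries σ K} {k : ℕ} (hf : f ∈ maxIdealS σ K ^ k)
    {F : DP σ K} (hF : F ∈ degLT σ K k) : f • F = 0 :=
  eq_zero_of_mem_degLT_zero (smul_mem_degLT_of_mem_pow hf (by rwa [zero_add]))

/-- A subspace that is closed under a system of generators of the maximal ideal is a submodule. -/
theorem smul_mem_of_forall_generator {ι : Type*} [Finite ι] {z : ι → MvPowerSeries σ K}
    (hz : Ideal.span (Set.range z) = maxIdealS σ K) {N : Submodule K (DP σ K)}
    (hN : ∀ i, ∀ F ∈ N, z i • F ∈ N) (f : MvPowerSeries σ K) {F : DP σ K} (hF : F ∈ N) :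
    f • F ∈ N := by
  have := Fintype.ofFinite ι
  -- The induction is on the degree of `F`: `f` minus its constant term is some `∑ c_i z_i`, and
  -- `z_i` lowers the degree before the arbitrary series `c_i` acts.
  have key : ∀ (s : ℕ) (f : MvPowerSeries σ K) (F : DP σ K), F ∈ N → F ∈ degLT σ K s →
      f • F ∈ N := by
    intro s
    induction s with
    | zero =>
      intro f F _ hs
      rw [eq_zero_of_mem_degLT_zero hs, smul_zero]
      exact zero_mem _
    | succ s ih =>
      intro f F hF hs
      have hmem : f - MvPowerSeries.C (MvPowerSeries.constantCoeff f) ∈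
          Ideal.span (Set.range z) := by
        rw [hz, mem_maxIdealS_iff]
        simp
      obtain ⟨c, hc⟩ := (Ideal.mem_span_range_iff_exists_fun).1 hmem
      have hf : f = MvPowerSeries.C (MvPowerSeries.constantCoeff f) + ∑ i, c i * z i := by
        rw [hc]; ring
      rw [hf, add_smul, C_smul, Finset.sum_smul]
      refine add_mem (N.smul_mem _ hF) (sum_mem fun i _ => ?_)
      rw [mul_smul]
      refine ih _ _ (hN i F hF) (smul_mem_degLT_of_mem_maxIdealS ?_ hs)
      rw [← hz]
      exact Ideal.subset_span ⟨i, rfl⟩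
  exact key _ f F hF (mem_degLT_succ_degree F)

theorem smul_mem_of_forall_X {N : Submodule K (DP σ K)}
    (hN : ∀ s, ∀ F ∈ N, (MvPowerSeries.X s : MvPowerSeries σ K) • F ∈ N) (f : MvPowerSeries σ K)
    {F : DP σ K} (hF : F ∈ N) : f • F ∈ N :=
  smul_mem_of_forall_generator (z := MvPowerSeries.X) rfl hN f hF

end MaxIdeal

/-! ### Families with independent leading forms -/

/-- The elements `F_j` have degree at most `b`, and all nontrivial linear combinations have
degree `b`. -/
def IndepTop {τ : ℕ} (b : ℕ) (F : Fin τ → DP σ K) : Prop :=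
  (∀ j, F j ∈ degLT σ K (b + 1)) ∧ ∀ c : Fin τ → K, ∑ j, c j • F j ∈ degLT σ K b → ∀ j, c j = 0

open Classical in
theorem coeff_form (s : ℕ) (k : σ →₀ ℕ) (F : DP σ K) :
    coeff k (form s F) = if k.degree = s then coeff k F else 0 :=
  Finsupp.filter_apply _ _ _

/-- When all `F j` have degree at most `b`, a linear combination drops below degree `b` exactly when
the same combination of the forms of degree `b` vanishes. The version with the filtration is the one
that is easily carried through changes of coordinates. -/
theorem indepTop_iff {τ b : ℕ} {F : Fin τ → DP σ K} :
    IndepTop b F ↔ (∀ j, (F j).degree = b) ∧ LinearIndependent K fun j => form b (F j) := by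
  classical
  have key (hle : ∀ j, F j ∈ degLT σ K (b + 1)) (c : Fin τ → K) :
      ∑ j, c j • form b (F j) = 0 ↔ ∑ j, c j • F j ∈ degLT σ K b := by
    constructor
    · intro h k hk
      rcases hk.eq_or_lt with hk | hk
      · have := congrArg (coeff k) h
        simpa [coeff_form, hk.symm] using this
      · rw [coeff_sum]
        refine Finset.sum_eq_zero fun j _ => ?_
        rw [coeff_smul, hle j k hk, mul_zero]
    · intro h
      ext k
      by_cases hk : k.degree = b
      · have := h k hk.ge
        simpa [coeff_form, hk] using this
      · simp [coeff_form, hk]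
  constructor
  · rintro ⟨hle, hind⟩
    refine ⟨fun j => ?_, ?_⟩
    · refine le_antisymm (degree_le_of_mem_degLT (hle j)) ?_
      by_contra hlt
      have h1 : F j ∈ degLT σ K b :=
        degLT_mono (by omega) (mem_degLT_succ_degree (F j))
      have := hind (Pi.single j 1) (by simpa [Pi.single_apply] using h1) j
      simp at this
    · rw [Fintype.linearIndependent_iff]
      intro c hc
      exact hind c ((key hle c).1 hc)
  · rintro ⟨hdeg, hind⟩
    have hle : ∀ j, F j ∈ degLT σ K (b + 1) := fun j => hdeg j ▸ mem_degLT_succ_degree (F j)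
    refine ⟨hle, fun c hc => ?_⟩
    rw [Fintype.linearIndependent_iff] at hind
    exact hind c ((key hle c).2 hc)

/-- The linear functionals on the divided power module are the power series. -/
def toSeries (l : DP σ K →ₗ[K] K) : MvPowerSeries σ K := fun k => l (mono k 1)

theorem coeff_zero_toSeries_smul (l : DP σ K →ₗ[K] K) (F : DP σ K) :
    coeff 0 (toSeries l • F) = l F := by
  have h (k : σ →₀ ℕ) (c : K) : mono k c = c • mono k (1 : K) := by
    classical
    ext m
    simp only [coeff_smul, coeff_mono]
    split_ifs <;> simp
  rw [coeff_zero_series_smul]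
  conv_rhs => rw [eq_sum_mono F, map_sum]
  refine Finset.sum_congr rfl fun k _ => ?_
  rw [h, map_smul, smul_eq_mul, mul_comm]
  rfl

/-- The dual basis of the leading forms extends to functionals on the whole module. The part of
degree `b` of such a functional, read as a series, is a form `g i`; it kills the terms of `F j`
below degree `b` and sends those of degree `b` to constants. -/
theorem IndepTop.exists_dual [Fintype σ] {τ b : ℕ} {F : Fin τ → DP σ K} (hF : IndepTop b F) :
    ∃ g : Fin τ → MvPolynomial σ K, (∀ i, (g i).IsHomogeneous b) ∧
      ∀ i j, (g i : MvPowerSeries σ K) • F j = mono 0 (if i = j then 1 else 0) := by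
  classical
  obtain ⟨hdeg, hind⟩ := indepTop_iff.1 hF
  have hex (i : Fin τ) : ∃ l : DP σ K →ₗ[K] K, ∀ j, l (form b (F j)) = if i = j then 1 else 0 := by
    obtain ⟨l, hl⟩ := LinearMap.exists_extend
      ((Finsupp.lapply i : (Fin τ →₀ K) →ₗ[K] K).comp hind.repr)
    refine ⟨l, fun j => ?_⟩
    have hmem : form b (F j) ∈ Submodule.span K (Set.range fun j => form b (F j)) :=
      Submodule.subset_span ⟨j, rfl⟩
    have h1 : l (form b (F j)) = hind.repr ⟨form b (F j), hmem⟩ i :=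
      LinearMap.congr_fun hl ⟨form b (F j), hmem⟩
    rw [h1, hind.repr_eq_single j ⟨form b (F j), hmem⟩ rfl, Finsupp.single_apply]
    simp [eq_comm]
  choose l hl using hex
  have hfin : {k : σ →₀ ℕ | k.degree = b}.Finite :=
    (Finsupp.finite_of_degree_le b).subset fun k hk => le_of_eq hk
  let g (i : Fin τ) : MvPolynomial σ K :=
    ∑ k ∈ hfin.toFinset, MvPolynomial.monomial k (l i (mono k 1))
  have hg (i : Fin τ) (k : σ →₀ ℕ) :
      MvPowerSeries.coeff k (g i : MvPowerSeries σ K) =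
        if k.degree = b then l i (mono k 1) else 0 := by
    simp [g, MvPolynomial.coeff_sum, MvPolynomial.coeff_monomial]
  refine ⟨g, fun i => ?_, fun i j => ?_⟩
  · exact MvPolynomial.IsHomogeneous.sum _ _ _ fun k hk =>
      MvPolynomial.isHomogeneous_monomial _ (by simpa using hk)
  · have h1 : (g i : MvPowerSeries σ K) • F j ∈ degLT σ K 1 := by
      intro k hk
      rw [coeff_series_smul]
      refine Finset.sum_eq_zero fun m _ => ?_
      split_ifs with hkm
      · rw [hg]
        split_ifs with hm
        · rw [hF.1 j m, mul_zero]
          have : (m - k).degree + k.degree = m.degree := by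
            rw [← map_add, tsub_add_cancel_of_le hkm]
          omega
        · rw [zero_mul]
      · rfl
    rw [eq_mono_of_mem_degLT_one h1]
    congr 1
    -- The pairing of `g i` with `F j` sees only exponents of degree `b`, where the coefficients of
    -- `g i` are those of the functional `l i`.
    rw [← hl i j, ← coeff_zero_toSeries_smul, coeff_zero_series_smul, coeff_zero_series_smul]
    have hsub : (form b (F j)).exponents ⊆ (F j).exponents := by
      intro k hk
      rw [mem_exponents, coeff_form] at hk
      rw [mem_exponents]
      intro h0
      simp [h0] at hk
    rw [← Finset.sum_subset hsub]
    · refine Finset.sum_congr rfl fun k hk => ?_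
      rw [mem_exponents, coeff_form] at hk
      have hkb : k.degree = b := by by_contra h0; simp [h0] at hk
      rw [hg, if_pos hkb, coeff_form, if_pos hkb]
      rfl
    · intro k hk hk'
      rw [mem_exponents, coeff_form, not_not] at hk'
      rw [hg]
      split_ifs with hkb
      · rw [if_pos hkb] at hk'
        rw [hk', mul_zero]
      · rw [zero_mul]

end DP

/-! ### Polynomials and power series -/

section SeriesRing

variable {σ : Type} {K : Type u} [Field K] {R : Type u} [CommRing R] [Module R (DP σ K)]

/-- `R` is the polynomial ring or the power series ring: a subring `ι : R → K⟦x⟧` that contains the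
polynomials and is closed under restriction of the set of monomials and under division by
variables. -/
structure IsSeriesRing (ι : R →+* MvPowerSeries σ K) : Prop where
  injective : Function.Injective ι
  smul_eq : ∀ (f : R) (F : DP σ K), f • F = ι f • F
  exists_polynomial : ∀ p : MvPolynomial σ K, ∃ f : R, ι f = p
  exists_restrict : ∀ (T : Set (σ →₀ ℕ)) (f : R), ∃ g : R, ∀ k,
    (k ∈ T → MvPowerSeries.coeff k (ι g) = MvPowerSeries.coeff k (ι f)) ∧
    (k ∉ T → MvPowerSeries.coeff k (ι g) = 0)
  exists_eq_X_mul : ∀ (s : σ) (f : R), (∀ k : σ →₀ ℕ, k s = 0 → MvPowerSeries.coeff k (ι f) = 0) →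
    ∃ h : R, ι f = MvPowerSeries.X s * ι h

theorem isSeriesRing_id : IsSeriesRing (RingHom.id (MvPowerSeries σ K)) where
  injective := Function.injective_id
  smul_eq _ _ := rfl
  exists_polynomial p := ⟨p, rfl⟩
  exists_restrict T f := by
    classical
    exact ⟨fun k => if k ∈ T then MvPowerSeries.coeff k f else 0,
      fun k => ⟨fun h => if_pos h, fun h => if_neg h⟩⟩
  exists_eq_X_mul s f hf := MvPowerSeries.X_dvd_iff.2 hf

theorem isSeriesRing_polynomial :
    IsSeriesRing (MvPolynomial.coeToMvPowerSeries.ringHom (R := K) (σ := σ)) where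
  injective := MvPolynomial.coe_injective σ K
  smul_eq _ _ := rfl
  exists_polynomial p := ⟨p, rfl⟩
  exists_restrict T f := by
    classical
    refine ⟨∑ k ∈ f.support.filter (· ∈ T), MvPolynomial.monomial k (MvPolynomial.coeff k f),
      fun k => ?_⟩
    simp only [MvPolynomial.coeToMvPowerSeries.ringHom_apply, MvPolynomial.coeff_coe,
      MvPolynomial.coeff_sum, MvPolynomial.coeff_monomial]
    constructor <;> intro hk <;> simp +contextual [hk, eq_comm]
  exists_eq_X_mul s f hf := by
    have h : f ∈ Ideal.span (MvPolynomial.X '' {s} : Set (MvPolynomial σ K)) := by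
      rw [MvPolynomial.mem_ideal_span_X_image]
      intro m hm
      refine ⟨s, rfl, fun h0 => ?_⟩
      have := hf m h0
      simp at this hm
      exact hm this
    rw [Set.image_singleton, Ideal.mem_span_singleton] at h
    obtain ⟨g, hg⟩ := h
    refine ⟨g, ?_⟩
    rw [hg, map_mul]
    simp

variable {ι : R →+* MvPowerSeries σ K}

/-- Constants and variables come from `R`. Every element has finite degree, so closure under these
is already closure under all series. Hence spans over polynomials and over power series agree. -/
theorem IsSeriesRing.smul_mem (hι : IsSeriesRing ι) [Fintype σ] (N : Submodule R (DP σ K))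
    (f : MvPowerSeries σ K) {F : DP σ K} (hF : F ∈ N) : f • F ∈ N := by
  let N' : Submodule K (DP σ K) :=
    { N.toAddSubmonoid with
      smul_mem' := fun c G hG => by
        obtain ⟨r, hr⟩ := hι.exists_polynomial (MvPolynomial.C c)
        have : r • G = c • G := by
          rw [hι.smul_eq, hr, MvPolynomial.coe_C, DP.C_smul]
        exact this ▸ N.smul_mem r hG }
  refine DP.smul_mem_of_forall_X (N := N') (fun s G hG => ?_) f hF
  obtain ⟨r, hr⟩ := hι.exists_polynomial (MvPolynomial.X s)
  have : r • G = (MvPowerSeries.X s : MvPowerSeries σ K) • G := by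
    rw [hι.smul_eq, hr, MvPolynomial.coe_X]
  exact this ▸ N.smul_mem r hG

theorem IsSeriesRing.mem_span_iff (hι : IsSeriesRing ι) [Fintype σ] {A : Set (DP σ K)}
    {F : DP σ K} : F ∈ Submodule.span R A ↔ F ∈ Submodule.span (MvPowerSeries σ K) A := by
  constructor
  · intro h
    induction h using Submodule.span_induction with
    | mem x hx => exact Submodule.subset_span hx
    | zero => exact zero_mem _
    | add x y _ _ hx hy => exact add_mem hx hy
    | smul a x _ hx =>
      rw [hι.smul_eq]
      exact Submodule.smul_mem _ _ hx
  · intro h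
    induction h using Submodule.span_induction with
    | mem x hx => exact Submodule.subset_span hx
    | zero => exact zero_mem _
    | add x y _ _ hx hy => exact add_mem hx hy
    | smul a x _ hx => exact hι.smul_mem _ a hx

theorem IsSeriesRing.mem_annihilator_span_iff (hι : IsSeriesRing ι) [Fintype σ]
    {A : Set (DP σ K)} {f : R} : f ∈ (Submodule.span R A).annihilator ↔
      ι f ∈ (Submodule.span (MvPowerSeries σ K) A).annihilator := by
  rw [Submodule.mem_annihilator_span, Submodule.mem_annihilator_span]
  simp only [hι.smul_eq]

end SeriesRing

/-! ### Slices with respect to the first variables -/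

section SumElim

variable {α β : Type}

theorem sumElim_le_sumElim {p p' : α →₀ ℕ} {q q' : β →₀ ℕ} :
    Finsupp.sumElim p q ≤ Finsupp.sumElim p' q' ↔ p ≤ p' ∧ q ≤ q' := by
  simp only [Finsupp.le_def, Sum.forall, Finsupp.sumElim_inl, Finsupp.sumElim_inr]

theorem sumElim_sub_sumElim (p p' : α →₀ ℕ) (q q' : β →₀ ℕ) :
    Finsupp.sumElim p q - Finsupp.sumElim p' q' = Finsupp.sumElim (p - p') (q - q') := by
  ext (i | i) <;> simp

theorem sumElim_add_sumElim (p p' : α →₀ ℕ) (q q' : β →₀ ℕ) :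
    Finsupp.sumElim p q + Finsupp.sumElim p' q' = Finsupp.sumElim (p + p') (q + q') := by
  ext (i | i) <;> simp

theorem sumElim_inj {p p' : α →₀ ℕ} {q q' : β →₀ ℕ} :
    Finsupp.sumElim p q = Finsupp.sumElim p' q' ↔ p = p' ∧ q = q' := by
  rw [le_antisymm_iff, sumElim_le_sumElim, sumElim_le_sumElim, le_antisymm_iff, le_antisymm_iff]
  tauto

theorem exists_sumElim (k : α ⊕ β →₀ ℕ) :
    ∃ (p : α →₀ ℕ) (q : β →₀ ℕ), k = Finsupp.sumElim p q :=
  ⟨_, _, (Finsupp.sumFinsuppEquivProdFinsupp.symm_apply_apply k).symm⟩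

theorem degree_sumElim [Fintype α] [Fintype β] (p : α →₀ ℕ) (q : β →₀ ℕ) :
    (Finsupp.sumElim p q).degree = p.degree + q.degree := by
  simp [Finsupp.degree_eq_sum]

theorem sumElim_zero_zero : Finsupp.sumElim (0 : α →₀ ℕ) (0 : β →₀ ℕ) = 0 := by
  ext (i | i) <;> simp

theorem single_inl (i : α) (a : ℕ) :
    Finsupp.single (Sum.inl i : α ⊕ β) a = Finsupp.sumElim (Finsupp.single i a) 0 := by
  classical
  ext (j | j) <;> simp [Finsupp.single_apply]

end SumElim

variable {d e τ : ℕ} {K : Type u} [Field K]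

/-- The coefficient of `x^p`, a power series in the last variables. -/
def seriesSlice (p : Fin d →₀ ℕ) (f : MvPowerSeries (Fin d ⊕ Fin e) K) :
    MvPowerSeries (Fin e) K :=
  fun q => MvPowerSeries.coeff (Finsupp.sumElim p q) f

theorem coeff_seriesSlice (p : Fin d →₀ ℕ) (q : Fin e →₀ ℕ)
    (f : MvPowerSeries (Fin d ⊕ Fin e) K) :
    MvPowerSeries.coeff q (seriesSlice p f) = MvPowerSeries.coeff (Finsupp.sumElim p q) f := rfl

theorem seriesSlice_add (p : Fin d →₀ ℕ) (f g : MvPowerSeries (Fin d ⊕ Fin e) K) :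
    seriesSlice p (f + g) = seriesSlice p f + seriesSlice p g := rfl

theorem series_ext_slice {f g : MvPowerSeries (Fin d ⊕ Fin e) K}
    (h : ∀ p, seriesSlice p f = seriesSlice p g) : f = g := by
  ext k
  obtain ⟨p, q, rfl⟩ := exists_sumElim k
  rw [← coeff_seriesSlice, h, coeff_seriesSlice]

open Classical in
theorem seriesSlice_X_mul (i : Fin d) (p : Fin d →₀ ℕ) (f : MvPowerSeries (Fin d ⊕ Fin e) K) :
    seriesSlice p (MvPowerSeries.X (Sum.inl i) * f) =
      if 1 ≤ p i then seriesSlice (p - Finsupp.single i 1) f else 0 := by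
  ext q
  rw [coeff_seriesSlice, MvPowerSeries.X, MvPowerSeries.coeff_monomial_mul]
  simp only [single_inl, sumElim_le_sumElim, sumElim_sub_sumElim, Finsupp.single_le_iff, zero_le,
    and_true, one_mul, tsub_zero]
  split_ifs <;> rfl

/-- The inclusion of the power series in the last variables. -/
abbrev inclS (d : ℕ) : MvPowerSeries (Fin e) K →ₐ[K] MvPowerSeries (Fin d ⊕ Fin e) K :=
  MvPowerSeries.rename (R := K) (Sum.inr : Fin e → Fin d ⊕ Fin e)

theorem mapDomain_inr (q : Fin e →₀ ℕ) :
    Finsupp.mapDomain (Sum.inr : Fin e → Fin d ⊕ Fin e) q = Finsupp.sumElim 0 q := by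
  ext (i | i)
  · rw [Finsupp.mapDomain_of_notMem_range _ _ (by simp)]
    simp
  · rw [Finsupp.mapDomain_apply Sum.inr_injective]
    simp

theorem seriesSlice_inclS (p : Fin d →₀ ℕ) (g : MvPowerSeries (Fin e) K) :
    seriesSlice p (inclS d g) = if p = 0 then g else 0 := by
  ext q
  rw [coeff_seriesSlice]
  split_ifs with h
  · subst h
    have h1 := MvPowerSeries.coeff_embDomain_rename
      (Function.Embedding.inr : Fin e ↪ Fin d ⊕ Fin e) g q
    rw [Finsupp.embDomain_eq_mapDomain] at h1
    rw [← mapDomain_inr]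
    exact h1
  · refine MvPowerSeries.coeff_rename_eq_zero (Sum.inr : Fin e → Fin d ⊕ Fin e) g ?_
    rintro ⟨q', hq'⟩
    rw [mapDomain_inr, sumElim_inj] at hq'
    exact h hq'.1.symm

namespace DP

/-- The element `X^p G`. -/
def embed (p : Fin d →₀ ℕ) (G : DP (Fin e) K) : DP (Fin d ⊕ Fin e) K :=
  Finsupp.mapDomain (fun q : Fin e →₀ ℕ => Finsupp.sumElim p q) (show (Fin e →₀ ℕ) →₀ K from G)

theorem coneTerm_eq_embed (n : Fin d → ℕ) (G : DP (Fin e) K) :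
    coneTerm n G = embed (Finsupp.equivFunOnFinite.symm fun i => n i - 1) G := rfl

theorem sumElim_injective (p : Fin d →₀ ℕ) :
    Function.Injective fun q : Fin e →₀ ℕ => Finsupp.sumElim p q :=
  fun _ _ h => (sumElim_inj.1 h).2

open Classical in
theorem coeff_embed (p p' : Fin d →₀ ℕ) (q : Fin e →₀ ℕ) (G : DP (Fin e) K) :
    coeff (Finsupp.sumElim p' q) (embed p G) = if p' = p then coeff q G else 0 := by
  split_ifs with h
  · subst h
    exact Finsupp.mapDomain_apply (sumElim_injective p') _ _
  · refine Finsupp.mapDomain_of_notMem_range _ _ ?_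
    rintro ⟨q', hq'⟩
    exact h (sumElim_inj.1 hq').1.symm

theorem embed_add (p : Fin d →₀ ℕ) (G G' : DP (Fin e) K) :
    embed p (G + G') = embed p G + embed p G' := Finsupp.mapDomain_add

theorem embed_zero (p : Fin d →₀ ℕ) : embed p (0 : DP (Fin e) K) = 0 := Finsupp.mapDomain_zero

theorem embed_smul (p : Fin d →₀ ℕ) (c : K) (G : DP (Fin e) K) :
    embed p (c • G) = c • embed p G := Finsupp.mapDomain_smul _ _

theorem embed_sum {ι : Type*} (p : Fin d →₀ ℕ) (s : Finset ι) (G : ι → DP (Fin e) K) :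
    embed p (∑ i ∈ s, G i) = ∑ i ∈ s, embed p (G i) :=
  map_sum (AddMonoidHom.mk' (embed p) (embed_add p)) G s

/-- The coefficient of `X^p`, an element of the divided power module in the last variables. -/
def slice (p : Fin d →₀ ℕ) : DP (Fin d ⊕ Fin e) K →ₗ[K] DP (Fin e) K :=
  Finsupp.lcomapDomain (fun q : Fin e →₀ ℕ => Finsupp.sumElim p q) (sumElim_injective p)

theorem coeff_slice (p : Fin d →₀ ℕ) (q : Fin e →₀ ℕ) (F : DP (Fin d ⊕ Fin e) K) :
    coeff q (slice p F) = coeff (Finsupp.sumElim p q) F := rfl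

theorem ext_slice {F G : DP (Fin d ⊕ Fin e) K} (h : ∀ p, slice p F = slice p G) : F = G := by
  ext k
  obtain ⟨p, q, rfl⟩ := exists_sumElim k
  rw [← coeff_slice, h, coeff_slice]

theorem slice_embed (p p' : Fin d →₀ ℕ) (G : DP (Fin e) K) :
    slice p' (embed p G) = if p' = p then G else 0 := by
  ext q
  rw [coeff_slice, coeff_embed]
  split_ifs <;> rfl

theorem exists_eq_sum_embed (F : DP (Fin d ⊕ Fin e) K) :
    ∃ T : Finset (Fin d →₀ ℕ), F = ∑ p ∈ T, embed p (slice p F) := by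
  classical
  refine ⟨F.exponents.image fun k => (Finsupp.sumFinsuppEquivProdFinsupp k).1,
    ext_slice fun p => ?_⟩
  rw [map_sum]
  simp only [slice_embed]
  rw [Finset.sum_ite_eq]
  split_ifs with h
  · rfl
  · ext q
    rw [coeff_slice]
    by_contra h0
    refine h (Finset.mem_image.2 ⟨_, mem_exponents.2 h0, ?_⟩)
    exact congrArg Prod.fst (Finsupp.sumFinsuppEquivProdFinsupp.apply_symm_apply (p, q))

open Classical in
theorem slice_smul_embed (f : MvPowerSeries (Fin d ⊕ Fin e) K) (p p' : Fin d →₀ ℕ)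
    (G : DP (Fin e) K) :
    slice p' (f • embed p G) = if p' ≤ p then seriesSlice (p - p') f • G else 0 := by
  have hexp : (embed p G).exponents =
      G.exponents.map ⟨fun q => Finsupp.sumElim p q, sumElim_injective p⟩ := by
    ext k
    obtain ⟨r, q, rfl⟩ := exists_sumElim k
    simp only [mem_exponents, coeff_embed, Finset.mem_map, Function.Embedding.coeFn_mk,
      sumElim_inj]
    constructor
    · intro h
      by_cases hr : r = p
      · exact ⟨q, by simpa [hr] using h, hr.symm, rfl⟩
      · simp [hr] at h
    · rintro ⟨q', h, rfl, rfl⟩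
      simpa using h
  ext q
  rw [coeff_slice, coeff_series_smul, hexp, Finset.sum_map]
  simp only [Function.Embedding.coeFn_mk, sumElim_le_sumElim, sumElim_sub_sumElim, coeff_embed,
    if_true]
  split_ifs with h
  · rw [coeff_series_smul]
    simp only [h, true_and, coeff_seriesSlice]
  · simp [h]

theorem inclS_smul_embed (g : MvPowerSeries (Fin e) K) (p : Fin d →₀ ℕ) (G : DP (Fin e) K) :
    inclS d g • embed p G = embed p (g • G) := by
  refine ext_slice fun p' => ?_
  rw [slice_smul_embed, slice_embed, seriesSlice_inclS]
  by_cases h : p' = p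
  · subst h; simp
  · rw [if_neg h]
    split_ifs with h1 h2
    · exact absurd (le_antisymm h1 (tsub_eq_zero_iff_le.1 h2)) h
    · rw [zero_smul]
    · rfl

theorem slice_inclS_smul (g : MvPowerSeries (Fin e) K) (p : Fin d →₀ ℕ)
    (F : DP (Fin d ⊕ Fin e) K) : slice p (inclS d g • F) = g • slice p F := by
  obtain ⟨T, hT⟩ := exists_eq_sum_embed F
  conv_lhs => rw [hT]
  conv_rhs => rw [hT]
  rw [Finset.smul_sum, map_sum, map_sum, Finset.smul_sum]
  refine Finset.sum_congr rfl fun q _ => ?_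
  rw [inclS_smul_embed, slice_embed, slice_embed]
  split_ifs
  · rfl
  · rw [smul_zero]

open Classical in
theorem X_inl_smul_embed (i : Fin d) (p : Fin d →₀ ℕ) (G : DP (Fin e) K) :
    (MvPowerSeries.X (Sum.inl i) : MvPowerSeries (Fin d ⊕ Fin e) K) • embed p G =
      if 1 ≤ p i then embed (p - Finsupp.single i 1) G else 0 := by
  refine ext_slice fun p' => ?_
  ext q
  rw [coeff_slice, coeff_X_smul, single_inl, sumElim_add_sumElim, coeff_embed]
  have hiff : p' + Finsupp.single i 1 = p ↔ 1 ≤ p i ∧ p' = p - Finsupp.single i 1 := by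
    rw [← Finsupp.single_le_iff]
    constructor
    · rintro rfl
      simp
    · rintro ⟨h1, rfl⟩
      exact tsub_add_cancel_of_le h1
  by_cases h1 : 1 ≤ p i
  · rw [if_pos h1, slice_embed]
    by_cases h2 : p' = p - Finsupp.single i 1
    · rw [if_pos h2, if_pos (hiff.2 ⟨h1, h2⟩), add_zero]
    · rw [if_neg h2, if_neg fun h => h2 (hiff.1 h).2, coeff_zero]
  · rw [if_neg h1, if_neg fun h => h1 (hiff.1 h).1]
    rfl

theorem monomial_smul_embed {p p' : Fin d →₀ ℕ} (h : p' ≤ p) (G : DP (Fin e) K) :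
    (MvPowerSeries.monomial (Finsupp.sumElim (p - p') (0 : Fin e →₀ ℕ)) (1 : K)) • embed p G =
      embed p' G := by
  classical
  refine ext_slice fun r => ?_
  ext q
  rw [coeff_slice, coeff_monomial_smul, sumElim_add_sumElim, coeff_embed, one_mul, slice_embed,
    add_zero]
  have hiff : r + (p - p') = p ↔ r = p' := by
    constructor
    · intro h'
      rw [← add_tsub_cancel_of_le h] at h'
      simpa using h'
    · rintro rfl
      exact add_tsub_cancel_of_le h
  simp only [hiff]
  split_ifs <;> rfl

theorem embed_mem_degLT {p : Fin d →₀ ℕ} {G : DP (Fin e) K} {s : ℕ} :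
    embed p G ∈ degLT _ K (p.degree + s) ↔ G ∈ degLT _ K s := by
  classical
  constructor
  · intro h q hq
    have := h (Finsupp.sumElim p q) (by rw [degree_sumElim]; omega)
    rwa [coeff_embed, if_pos rfl] at this
  · intro h k hk
    obtain ⟨p', q, rfl⟩ := exists_sumElim k
    rw [coeff_embed]
    split_ifs with hp
    · subst hp
      rw [degree_sumElim] at hk
      exact h q (by omega)
    · rfl

theorem IndepTop.embed {b : ℕ} {H : Fin τ → DP (Fin e) K} (hH : IndepTop b H) (p : Fin d →₀ ℕ) :
    IndepTop (p.degree + b) fun j => DP.embed p (H j) := by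
  refine ⟨fun j => ?_, fun c hc => hH.2 c ?_⟩
  · rw [add_assoc]
    exact embed_mem_degLT.2 (hH.1 j)
  · simp only [← embed_smul, ← embed_sum] at hc
    exact embed_mem_degLT.1 hc

/-! ### Double annihilators -/

/-- Every submodule of the divided power module is the set of elements that are killed by its
annihilator. -/
theorem mem_of_forall_annihilator_smul_eq_zero {σ : Type}
    {N : Submodule (MvPowerSeries σ K) (DP σ K)} {F : DP σ K}
    (h : ∀ f ∈ N.annihilator, f • F = 0) : F ∈ N := by
  by_contra hF
  -- A functional that vanishes on `N` but not at `F` is, read as a series, in the annihilator: the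
  -- `k`-th coefficient of its action on `G ∈ N` is its value at `x^k ∘ G`, which is again in `N`.
  obtain ⟨l, hl1, hl2⟩ := Submodule.exists_le_ker_of_notMem (p := N.restrictScalars K) hF
  refine hl1 ?_
  rw [← coeff_zero_toSeries_smul, h, coeff_zero]
  rw [Submodule.mem_annihilator]
  intro G hG
  ext k
  rw [coeff_eq_coeff_zero_smul, smul_comm, coeff_zero_toSeries_smul, coeff_zero]
  exact hl2 (N.smul_mem _ hG)

end DP

/-! ### The submodule generated by the terms of the cone -/

open DP

/-- The elements of the divided power module all of whose slices are in the submodule generated by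
the `H^j`. -/
theorem mem_span_coneTerm_iff {H : Fin τ → DP (Fin e) K} {F : DP (Fin d ⊕ Fin e) K} :
    F ∈ Submodule.span (MvPowerSeries (Fin d ⊕ Fin e) K)
        {F | ∃ (n : Fin d → ℕ) (j : Fin τ), (∀ i, 0 < n i) ∧ F = coneTerm n (H j)} ↔
      ∀ p, slice p F ∈ Submodule.span (MvPowerSeries (Fin e) K) (Set.range H) := by
  classical
  constructor
  · intro h
    induction h using Submodule.span_induction with
    | mem x hx =>
      obtain ⟨n, j, -, rfl⟩ := hx
      intro p
      rw [coneTerm_eq_embed, slice_embed]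
      split_ifs
      · exact Submodule.subset_span ⟨j, rfl⟩
      · exact zero_mem _
    | zero => intro p; rw [map_zero]; exact zero_mem _
    | add x y _ _ hx hy => intro p; rw [map_add]; exact add_mem (hx p) (hy p)
    | smul a x _ hx =>
      intro p
      obtain ⟨T, hT⟩ := exists_eq_sum_embed x
      rw [hT, Finset.smul_sum, map_sum]
      refine sum_mem fun q _ => ?_
      rw [slice_smul_embed]
      split_ifs
      · exact Submodule.smul_mem _ _ (hx q)
      · exact zero_mem _
  · intro h
    obtain ⟨T, hT⟩ := exists_eq_sum_embed F
    rw [hT]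
    refine sum_mem fun p _ => ?_
    have key : ∀ G ∈ Submodule.span (MvPowerSeries (Fin e) K) (Set.range H),
        embed p G ∈ Submodule.span (MvPowerSeries (Fin d ⊕ Fin e) K)
          {F | ∃ (n : Fin d → ℕ) (j : Fin τ), (∀ i, 0 < n i) ∧ F = coneTerm n (H j)} := by
      intro G hG
      induction hG using Submodule.span_induction with
      | mem x hx =>
        obtain ⟨j, rfl⟩ := hx
        refine Submodule.subset_span ⟨fun i => p i + 1, j, fun i => Nat.succ_pos _, ?_⟩
        rw [coneTerm_eq_embed]
        congr 1
        ext i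
        simp
      | zero => rw [embed_zero]; exact zero_mem _
      | add x y _ _ hx hy => rw [embed_add]; exact add_mem hx hy
      | smul a x _ hx => rw [← inclS_smul_embed]; exact Submodule.smul_mem _ _ hx
    exact key _ (h p)

/-- Contraction moves slices to smaller exponents only, and conversely `x^(p - q)` moves the slice
at `p` to any `q ≤ p`. In this form the intersection condition of admissibility becomes a statement
about exponents. -/
theorem mem_span_embed_iff {H : Fin τ → DP (Fin e) K} {p : Fin d →₀ ℕ}
    {F : DP (Fin d ⊕ Fin e) K} :
    F ∈ Submodule.span (MvPowerSeries (Fin d ⊕ Fin e) K) (Set.range fun j => embed p (H j)) ↔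
      ∀ q, slice q F ∈ Submodule.span (MvPowerSeries (Fin e) K) (Set.range H) ∧
        (¬ q ≤ p → slice q F = 0) := by
  classical
  constructor
  · intro h
    induction h using Submodule.span_induction with
    | mem x hx =>
      obtain ⟨j, rfl⟩ := hx
      intro q
      simp only [slice_embed]
      split_ifs with hq
      · exact ⟨Submodule.subset_span ⟨j, rfl⟩, fun h => absurd hq.le h⟩
      · exact ⟨zero_mem _, fun _ => rfl⟩
    | zero => intro q; rw [map_zero]; exact ⟨zero_mem _, fun _ => rfl⟩
    | add x y _ _ hx hy =>
      intro q
      rw [map_add]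
      exact ⟨add_mem (hx q).1 (hy q).1, fun h => by rw [(hx q).2 h, (hy q).2 h, add_zero]⟩
    | smul a x _ hx =>
      intro q
      obtain ⟨T, hT⟩ := exists_eq_sum_embed x
      rw [hT, Finset.smul_sum, map_sum]
      constructor
      · refine sum_mem fun r _ => ?_
        rw [slice_smul_embed]
        split_ifs
        · exact Submodule.smul_mem _ _ (hx r).1
        · exact zero_mem _
      · intro hq
        refine Finset.sum_eq_zero fun r _ => ?_
        rw [slice_smul_embed]
        split_ifs with hr
        · rw [(hx r).2 fun h => hq (hr.trans h), smul_zero]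
        · rfl
  · intro h
    obtain ⟨T, hT⟩ := exists_eq_sum_embed F
    rw [hT]
    refine sum_mem fun q _ => ?_
    by_cases hq : q ≤ p
    · have key : ∀ G ∈ Submodule.span (MvPowerSeries (Fin e) K) (Set.range H),
          embed q G ∈ Submodule.span (MvPowerSeries (Fin d ⊕ Fin e) K)
            (Set.range fun j => embed p (H j)) := by
        intro G hG
        induction hG using Submodule.span_induction with
        | mem x hx =>
          obtain ⟨j, rfl⟩ := hx
          rw [← monomial_smul_embed hq]
          exact Submodule.smul_mem _ _ (Submodule.subset_span ⟨j, rfl⟩)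
        | zero => rw [embed_zero]; exact zero_mem _
        | add x y _ _ hx hy => rw [embed_add]; exact add_mem hx hy
        | smul a x _ hx => rw [← inclS_smul_embed]; exact Submodule.smul_mem _ _ hx
      exact key _ (h q).1
    · rw [(h q).2 hq, embed_zero]
      exact zero_mem _

/-- The annihilator of the cone consists of the series all of whose slices annihilate the `H^j`. -/
theorem mem_annihilator_span_coneTerm_iff {H : Fin τ → DP (Fin e) K}
    {f : MvPowerSeries (Fin d ⊕ Fin e) K} :
    f ∈ (Submodule.span (MvPowerSeries (Fin d ⊕ Fin e) K)
        {F | ∃ (n : Fin d → ℕ) (j : Fin τ), (∀ i, 0 < n i) ∧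
          F = coneTerm n (H j)}).annihilator ↔
      ∀ p, seriesSlice p f ∈
        (Submodule.span (MvPowerSeries (Fin e) K) (Set.range H)).annihilator := by
  classical
  simp only [Submodule.mem_annihilator_span, Subtype.forall, Set.mem_range, forall_exists_index,
    forall_apply_eq_imp_iff, Set.mem_ofPred_eq]
  constructor
  · intro h p j
    have h1 := h (coneTerm (fun i => p i + 1) (H j)) _ j ⟨fun i => Nat.succ_pos _, rfl⟩
    have h2 : (Finsupp.equivFunOnFinite.symm fun i => p i + 1 - 1) = p := by ext i; simp
    rw [coneTerm_eq_embed, h2] at h1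
    have h3 := slice_smul_embed f p 0 (H j)
    rw [h1, map_zero, if_pos zero_le, tsub_zero] at h3
    exact h3.symm
  · rintro h _ n j ⟨-, rfl⟩
    refine ext_slice fun p => ?_
    rw [coneTerm_eq_embed, slice_smul_embed, h, map_zero, ite_self]

/-! ### The annihilator as a cone -/

theorem annihilator_span_coneTerm_eq_map (H : Fin τ → DP (Fin e) K) :
    (Submodule.span (MvPowerSeries (Fin d ⊕ Fin e) K)
        {F | ∃ (n : Fin d → ℕ) (j : Fin τ), (∀ i, 0 < n i) ∧
          F = coneTerm n (H j)}).annihilator =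
      (Submodule.span (MvPowerSeries (Fin e) K) (Set.range H)).annihilator.map (inclS d) := by
  apply le_antisymm
  · intro f hf
    rw [mem_annihilator_span_coneTerm_iff] at hf
    -- Finitely many generators are needed: the coefficients chosen slice by slice are assembled
    -- into one series for each generator.
    obtain ⟨s, hs⟩ := IsNoetherian.noetherian
      (Submodule.span (MvPowerSeries (Fin e) K) (Set.range H)).annihilator
    simp only [← hs, Submodule.mem_span_finset'] at hf
    choose c hc using hf
    let C (g : s) : MvPowerSeries (Fin d ⊕ Fin e) K := fun k =>
      MvPowerSeries.coeff (Finsupp.sumFinsuppEquivProdFinsupp k).2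
        (c (Finsupp.sumFinsuppEquivProdFinsupp k).1 g)
    have hC (g : s) (p : Fin d →₀ ℕ) : seriesSlice p (C g) = c p g := by
      ext q
      have := Finsupp.sumFinsuppEquivProdFinsupp.apply_symm_apply (p, q)
      change MvPowerSeries.coeff (Finsupp.sumFinsuppEquivProdFinsupp
        (Finsupp.sumFinsuppEquivProdFinsupp.symm (p, q))).2
        (c (Finsupp.sumFinsuppEquivProdFinsupp
          (Finsupp.sumFinsuppEquivProdFinsupp.symm (p, q))).1 g) = _
      rw [this]
    -- Multiplication by a series in the last variables is slicewise: the coefficient at `x^p x^q`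
    -- is the pairing with `X^p X^q`, to which the contraction formulas apply.
    have hmul (p : Fin d →₀ ℕ) (F : MvPowerSeries (Fin d ⊕ Fin e) K)
        (g : MvPowerSeries (Fin e) K) : seriesSlice p (F * inclS d g) = seriesSlice p F * g := by
      classical
      have key (q : Fin e →₀ ℕ) : MvPowerSeries.coeff q (seriesSlice p (F * inclS d g)) =
          MvPowerSeries.coeff q (seriesSlice p F * g) := by
        have h1 (A : MvPowerSeries (Fin d ⊕ Fin e) K) : MvPowerSeries.coeff q (seriesSlice p A) =
            coeff 0 (slice 0 (A • embed p (mono q 1))) := by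
          rw [slice_smul_embed, if_pos zero_le, tsub_zero, coeff_smul_mono,
            if_pos zero_le, tsub_zero, mul_one]
        have h2 (A : MvPowerSeries (Fin e) K) : MvPowerSeries.coeff q A =
            coeff 0 (A • mono q 1) := by
          rw [coeff_smul_mono, if_pos zero_le, tsub_zero, mul_one]
        rw [h1, h2, mul_smul, inclS_smul_embed, slice_smul_embed, if_pos zero_le, tsub_zero,
          mul_smul]
      exact MvPowerSeries.ext key
    have hf' : f = ∑ g, C g * inclS d g.1 := by
      refine series_ext_slice fun p => ?_
      have hsum : seriesSlice p (∑ g, C g * inclS d g.1) =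
          ∑ g, seriesSlice p (C g * inclS d g.1) :=
        map_sum (AddMonoidHom.mk' (seriesSlice p) (seriesSlice_add p)) _ _
      rw [hsum, ← hc p]
      refine Finset.sum_congr rfl fun g _ => ?_
      rw [hmul, hC, smul_eq_mul]
    rw [hf']
    refine sum_mem fun g _ => Ideal.mul_mem_left _ _ (Ideal.mem_map_of_mem _ ?_)
    rw [← hs]
    exact Submodule.subset_span g.2
  · rw [Ideal.map_le_iff_le_comap]
    intro g hg
    rw [Ideal.mem_comap, mem_annihilator_span_coneTerm_iff]
    intro p
    rw [seriesSlice_inclS]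
    split_ifs
    · exact hg
    · exact zero_mem _

theorem coe_rename_inr (g : MvPolynomial (Fin e) K) :
    ((MvPolynomial.rename Sum.inr g : MvPolynomial (Fin d ⊕ Fin e) K) :
      MvPowerSeries (Fin d ⊕ Fin e) K) = inclS d (g : MvPowerSeries (Fin e) K) :=
  (MvPowerSeries.rename_coe _ g).symm

/-- A polynomial has finitely many nonzero slices `g p`, so `f = ∑ x^p g_p` is a finite sum with
every `g p` in the annihilator of the `H^j`. -/
theorem annihilator_span_coneTerm_eq_map_polynomial (H : Fin τ → DP (Fin e) K) :
    (Submodule.span (MvPolynomial (Fin d ⊕ Fin e) K)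
        {F | ∃ (n : Fin d → ℕ) (j : Fin τ), (∀ i, 0 < n i) ∧
          F = coneTerm n (H j)}).annihilator =
      (Submodule.span (MvPolynomial (Fin e) K) (Set.range H)).annihilator.map
        (MvPolynomial.rename (R := K) (Sum.inr : Fin e → Fin d ⊕ Fin e)) := by
  classical
  apply le_antisymm
  · intro f hf
    rw [isSeriesRing_polynomial.mem_annihilator_span_iff,
      mem_annihilator_span_coneTerm_iff] at hf
    let g (p : Fin d →₀ ℕ) : MvPolynomial (Fin e) K :=
      ∑ k ∈ f.support.filter (fun k => (Finsupp.sumFinsuppEquivProdFinsupp k).1 = p),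
        MvPolynomial.monomial (Finsupp.sumFinsuppEquivProdFinsupp k).2 (MvPolynomial.coeff k f)
    have hg (p : Fin d →₀ ℕ) : (g p : MvPowerSeries (Fin e) K) =
        seriesSlice p (f : MvPowerSeries (Fin d ⊕ Fin e) K) := by
      ext q
      rw [coeff_seriesSlice, MvPolynomial.coeff_coe, MvPolynomial.coeff_coe]
      simp only [g, MvPolynomial.coeff_sum, MvPolynomial.coeff_monomial]
      have hpq : Finsupp.sumFinsuppEquivProdFinsupp (Finsupp.sumElim p q) = (p, q) :=
        Finsupp.sumFinsuppEquivProdFinsupp.apply_symm_apply (p, q)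
      rw [Finset.sum_eq_single (Finsupp.sumElim p q)]
      · rw [hpq, if_pos rfl]
      · intro k hk hne
        rw [if_neg]
        intro h
        rw [Finset.mem_filter] at hk
        refine hne (Finsupp.sumFinsuppEquivProdFinsupp.injective ?_)
        rw [hpq]
        exact Prod.ext hk.2 h
      · intro h
        rw [hpq, if_pos rfl]
        by_contra h0
        exact h (Finset.mem_filter.2 ⟨MvPolynomial.mem_support_iff.2 h0, by rw [hpq]⟩)
    have hf' : f = ∑ p ∈ f.support.image (fun k => (Finsupp.sumFinsuppEquivProdFinsupp k).1),
        MvPolynomial.monomial (Finsupp.sumElim p 0) 1 * MvPolynomial.rename Sum.inr (g p) := by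
      conv_lhs => rw [f.as_sum]
      simp only [g, map_sum, MvPolynomial.rename_monomial, Finset.mul_sum,
        MvPolynomial.monomial_mul, one_mul, mapDomain_inr, sumElim_add_sumElim, add_zero, zero_add]
      rw [← Finset.sum_fiberwise_of_maps_to (g := fun k => (Finsupp.sumFinsuppEquivProdFinsupp k).1)
        (fun k hk => Finset.mem_image_of_mem
          (fun k => (Finsupp.sumFinsuppEquivProdFinsupp k).1) hk)]
      refine Finset.sum_congr rfl fun p _ => Finset.sum_congr rfl fun k hk => ?_
      rw [Finset.mem_filter] at hk
      rw [← hk.2]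
      congr 2
      exact (Finsupp.sumFinsuppEquivProdFinsupp.symm_apply_apply k).symm
    rw [hf']
    refine sum_mem fun p _ => Ideal.mul_mem_left _ _ (Ideal.mem_map_of_mem _ ?_)
    rw [isSeriesRing_polynomial.mem_annihilator_span_iff]
    rw [MvPolynomial.coeToMvPowerSeries.ringHom_apply, hg]
    exact hf p
  · rw [Ideal.map_le_iff_le_comap]
    intro g hg
    rw [isSeriesRing_polynomial.mem_annihilator_span_iff] at hg
    rw [Ideal.mem_comap, isSeriesRing_polynomial.mem_annihilator_span_iff,
      mem_annihilator_span_coneTerm_iff]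
    intro p
    change seriesSlice p ((MvPolynomial.rename Sum.inr g : MvPolynomial (Fin d ⊕ Fin e) K) :
      MvPowerSeries (Fin d ⊕ Fin e) K) ∈ _
    rw [coe_rename_inr, seriesSlice_inclS]
    split_ifs
    · exact hg
    · exact zero_mem _

/-! ### The regular sequence -/

section Regular

variable {R : Type u} [CommRing R] [Module R (DP (Fin d ⊕ Fin e) K)]
  {ι : R →+* MvPowerSeries (Fin d ⊕ Fin e) K} {A : Type u} [CommRing A] {π : R →+* A}
  {𝔠 : Ideal (MvPowerSeries (Fin e) K)} {x : Fin d → R}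

/-- Modulo the first `j` variables only those slices survive whose exponents vanish at these places.
This makes ideal membership in `A`, and with it regularity, visible on slices. -/
theorem IsSeriesRing.mem_span_image_iff (hι : IsSeriesRing ι) (hπ : Function.Surjective π)
    (hker : ∀ f, π f = 0 ↔ ∀ p, seriesSlice p (ι f) ∈ 𝔠)
    (hx : ∀ i, ι (x i) = MvPowerSeries.X (Sum.inl i)) (j : ℕ) (f : R) :
    π f ∈ Ideal.span ((fun i => π (x i)) '' {i | i.val < j}) ↔
      ∀ p : Fin d →₀ ℕ, (∀ i : Fin d, i.val < j → p i = 0) → seriesSlice p (ι f) ∈ 𝔠 := by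
  classical
  constructor
  · intro h p hp
    -- The multiplier `g` and the arbitrary lift `f` make the claim stable under the closure steps
    -- of the span.
    have key : ∀ a ∈ Ideal.span ((fun i => π (x i)) '' {i | i.val < j}), ∀ g f : R, π f = π g * a →
        seriesSlice p (ι f) ∈ 𝔠 := by
      intro a ha
      induction ha using Submodule.span_induction with
      | mem a ha =>
        obtain ⟨i, hi, rfl⟩ := ha
        intro g f hf
        have h0 : π (f - x i * g) = 0 := by rw [map_sub, map_mul, hf, mul_comm, sub_self]
        have h1 := (hker _).1 h0 p
        have h2 : seriesSlice p (ι (x i * g)) = 0 := by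
          rw [map_mul, hx, seriesSlice_X_mul, if_neg]
          rw [hp i hi]
          exact Nat.not_succ_le_zero 0
        have h3 : ι f = ι (f - x i * g) + ι (x i * g) := by rw [← map_add, sub_add_cancel]
        rw [h3, seriesSlice_add, h2, add_zero]
        exact h1
      | zero =>
        intro g f hf
        rw [mul_zero] at hf
        exact (hker f).1 hf p
      | add a b _ _ ha hb =>
        intro g f hf
        obtain ⟨a, rfl⟩ := hπ a
        have h3 : ι f = ι (g * a) + ι (f - g * a) := by rw [← map_add, add_sub_cancel]
        rw [h3, seriesSlice_add]
        refine add_mem (ha g (g * a) (map_mul π _ _)) (hb g _ ?_)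
        rw [map_sub, hf, map_mul, mul_add, add_sub_cancel_left]
      | smul c a _ ha =>
        intro g f hf
        obtain ⟨c, rfl⟩ := hπ c
        refine ha (g * c) f ?_
        rw [hf, smul_eq_mul, map_mul, mul_assoc]
    exact key _ h 1 f (by rw [map_one, one_mul])
  · induction j generalizing f with
    | zero =>
      intro h
      rw [(hker f).2 fun p => h p fun i hi => absurd hi (Nat.not_lt_zero _)]
      exact zero_mem _
    | succ j ih =>
      intro h
      have hmono : Ideal.span ((fun i => π (x i)) '' {i | i.val < j}) ≤
          Ideal.span ((fun i => π (x i)) '' {i | i.val < j + 1}) :=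
        Ideal.span_mono (Set.image_mono fun i (hi : i.val < j) => Nat.lt_succ_of_lt hi)
      by_cases hj : j < d
      -- Here `g` is the part of `f` that is free of `x_j`, so `f - g` is divisible by `x_j`.
      · obtain ⟨g, hg⟩ := hι.exists_restrict {k | k (Sum.inl ⟨j, hj⟩) = 0} f
        obtain ⟨c, hc⟩ := hι.exists_eq_X_mul (Sum.inl ⟨j, hj⟩) (f - g) (by
          intro k hk
          rw [map_sub, map_sub, (hg k).1 hk, sub_self])
        rw [← hx, ← map_mul] at hc
        have hfg : f = g + x ⟨j, hj⟩ * c := by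
          rw [← hι.injective hc, add_sub_cancel]
        rw [hfg, map_add, map_mul]
        refine add_mem (hmono (ih g fun p hp => ?_)) (Ideal.mul_mem_right _ _
          (Ideal.subset_span ⟨⟨j, hj⟩, Nat.lt_succ_self j, rfl⟩))
        by_cases hpj : p ⟨j, hj⟩ = 0
        · have : seriesSlice p (ι g) = seriesSlice p (ι f) := by
            ext q
            rw [coeff_seriesSlice, coeff_seriesSlice]
            exact (hg _).1 (by simpa using hpj)
          rw [this]
          refine h p fun i hi => ?_
          rcases Nat.lt_succ_iff_lt_or_eq.1 hi with hi | hi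
          · exact hp i hi
          · have : i = ⟨j, hj⟩ := Fin.ext hi
            rw [this, hpj]
        · have : seriesSlice p (ι g) = 0 := by
            ext q
            rw [coeff_seriesSlice]
            exact (hg _).2 (by simpa using hpj)
          rw [this]
          exact zero_mem _
      -- For `j ≥ d` there is no variable `x_j`, and neither side changes.
      · refine hmono (ih f fun p hp => h p fun i _ => hp i ?_)
        have := i.2
        omega

theorem IsSeriesRing.mem_span_range_iff (hι : IsSeriesRing ι) (hπ : Function.Surjective π)
    (hker : ∀ f, π f = 0 ↔ ∀ p, seriesSlice p (ι f) ∈ 𝔠)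
    (hx : ∀ i, ι (x i) = MvPowerSeries.X (Sum.inl i)) (f : R) :
    π f ∈ Ideal.span (Set.range fun i => π (x i)) ↔ seriesSlice 0 (ι f) ∈ 𝔠 := by
  have h := hι.mem_span_image_iff hπ hker hx d f
  have h1 : {i : Fin d | i.val < d} = Set.univ := Set.eq_univ_of_forall fun i => i.2
  rw [h1, Set.image_univ] at h
  rw [h]
  constructor
  · intro h
    exact h 0 fun _ _ => rfl
  · intro h p hp
    have : p = 0 := Finsupp.ext fun i => hp i i.2
    rwa [this]

theorem ofList_take_ofFn {A : Type*} [CommRing A] (y : Fin d → A) (j : ℕ) :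
    Ideal.ofList ((List.ofFn y).take j) = Ideal.span (y '' {i | i.val < j}) := by
  unfold Ideal.ofList
  congr 1
  ext a
  simp only [Set.mem_ofPred_eq, Set.mem_image, List.mem_take_iff_getElem, List.getElem_ofFn,
    List.length_ofFn]
  constructor
  · rintro ⟨i, hi, rfl⟩
    exact ⟨⟨i, by omega⟩, by simp; omega, rfl⟩
  · rintro ⟨i, hi, rfl⟩
    exact ⟨i, by omega, rfl⟩

/-- Multiplication by `x_j` shifts slices by the `j`-th unit vector and does not touch the earlier
places, so it can be undone modulo the earlier variables. The quotient is nonzero because the slice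
of `1` at zero is `1`, which is not in `𝔠`. -/
theorem IsSeriesRing.isRegular (hι : IsSeriesRing ι) (hπ : Function.Surjective π)
    (hker : ∀ f, π f = 0 ↔ ∀ p, seriesSlice p (ι f) ∈ 𝔠) (h𝔠 : 𝔠 ≠ ⊤)
    (hx : ∀ i, ι (x i) = MvPowerSeries.X (Sum.inl i)) :
    RingTheory.Sequence.IsRegular A (List.ofFn fun i => π (x i)) := by
  classical
  constructor
  · rw [RingTheory.Sequence.isWeaklyRegular_iff]
    intro j hj
    rw [List.length_ofFn] at hj
    rw [isSMulRegular_quotient_iff_mem_of_smul_mem, smul_eq_mul, Ideal.mul_top, ofList_take_ofFn,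
      List.getElem_ofFn]
    intro a ha
    obtain ⟨f, rfl⟩ := hπ a
    rw [smul_eq_mul, ← map_mul, hι.mem_span_image_iff hπ hker hx] at ha
    rw [hι.mem_span_image_iff hπ hker hx]
    intro p hp
    have h1 := ha (p + Finsupp.single ⟨j, hj⟩ 1) fun i hi => by
      have hij : ¬ (⟨j, hj⟩ : Fin d) = i := by
        rintro rfl
        exact lt_irrefl _ hi
      rw [Finsupp.add_apply, hp i hi, Finsupp.single_apply, if_neg hij, add_zero]
    rwa [map_mul, hx, seriesSlice_X_mul, if_pos (by simp), add_tsub_cancel_right] at h1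
  · intro h
    rw [smul_eq_mul, Ideal.mul_top] at h
    have h1 : (1 : A) ∈ Ideal.ofList (List.ofFn fun i => π (x i)) := h ▸ Submodule.mem_top
    rw [← map_one π, ← List.take_length (l := List.ofFn fun i => π (x i)), List.length_ofFn,
      ofList_take_ofFn, hι.mem_span_image_iff hπ hker hx] at h1
    have h2 := h1 0 fun _ _ => rfl
    have h3 : seriesSlice (0 : Fin d →₀ ℕ) (1 : MvPowerSeries (Fin d ⊕ Fin e) K) = 1 := by
      rw [← map_one (inclS d), seriesSlice_inclS, if_pos rfl]
    rw [map_one, h3] at h2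
    exact h𝔠 ((Ideal.eq_top_iff_one _).2 h2)

end Regular

/-! ### Change of coordinates -/

section Coordinates

variable {σ : Type} [Fintype σ] {K : Type u} [Field K]

instance (s : ℕ) : Module.Finite K (degLT σ K s) := by
  have hfin : {k : σ →₀ ℕ | k.degree ≤ s}.Finite := Finsupp.finite_of_degree_le s
  have := hfin.fintype
  let l : degLT σ K s →ₗ[K] ({k : σ →₀ ℕ | k.degree ≤ s} → K) :=
    LinearMap.pi fun k => (lcoeff k.1).comp (Submodule.subtype _)
  refine Module.Finite.of_injective l ((injective_iff_map_eq_zero l).2 fun F hF => ?_)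
  refine Subtype.ext (DP.ext fun k => ?_)
  by_cases hk : k.degree ≤ s
  · exact congrFun hF ⟨k, hk⟩
  · exact F.2 k (by omega)

variable (y : σ → MvPowerSeries σ K)

/-- The monomials in the elements `y`. -/
abbrev monomialIn {R : Type*} [CommSemiring R] (y : σ → R) (k : σ →₀ ℕ) : R :=
  k.prod fun i a => y i ^ a

theorem monomialIn_add_single {R : Type*} [CommSemiring R] (y : σ → R) (k : σ →₀ ℕ) (s : σ) :
    monomialIn y (k + Finsupp.single s 1) = monomialIn y k * y s := by
  classical
  rw [monomialIn, Finsupp.prod_add_index' (by simp) (by intros; rw [pow_add])]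
  simp

variable {y}

theorem monomialIn_mem_pow (hy : Ideal.span (Set.range y) = maxIdealS σ K) (k : σ →₀ ℕ) :
    monomialIn y k ∈ maxIdealS σ K ^ k.degree := by
  rw [monomialIn, Finsupp.prod_fintype _ _ (by simp), Finsupp.degree_eq_sum,
    ← Finset.prod_pow_eq_pow_sum]
  exact Ideal.prod_mem_prod fun s _ =>
    Ideal.pow_mem_pow (hy ▸ Ideal.subset_span ⟨s, rfl⟩) _

theorem coeff_zero_monomialIn_smul_eq_zero (hy : Ideal.span (Set.range y) = maxIdealS σ K)
    {k : σ →₀ ℕ} {s : ℕ} (hk : s ≤ k.degree) {F : DP σ K} (hF : F ∈ degLT σ K s) :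
    coeff 0 (monomialIn y k • F) = 0 := by
  rw [smul_eq_zero_of_mem_pow (monomialIn_mem_pow hy k) (degLT_mono hk hF), coeff_zero]

/-- The monomial in `y` with exponent `k` lies in the `|k|`-th power of the maximal ideal, so its
pairing with `F` vanishes as soon as `|k|` exceeds the degree of `F`. -/
theorem exists_coeff_eq_coeff_zero_smul (hy : Ideal.span (Set.range y) = maxIdealS σ K)
    (F : DP σ K) : ∃ G : DP σ K, ∀ k, coeff k G = coeff 0 (monomialIn y k • F) := by
  refine ⟨Finsupp.onFinset (Finsupp.finite_of_degree_le F.degree).toFinset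
    (fun k => coeff 0 (monomialIn y k • F)) fun k hk => ?_, fun k => rfl⟩
  rw [Set.Finite.mem_toFinset]
  by_contra h
  exact hk (coeff_zero_monomialIn_smul_eq_zero hy (Nat.lt_of_not_le h) (mem_degLT_succ_degree F))

/-- The adjoint of the substitution of `y` for the variables, that is, the map that sends `F` to
the element with coefficients `⟨y^k, F⟩`. -/
def dualSubst (hy : Ideal.span (Set.range y) = maxIdealS σ K) : DP σ K →ₗ[K] DP σ K where
  toFun F := (exists_coeff_eq_coeff_zero_smul hy F).choose
  map_add' F G := by
    ext k
    rw [coeff_add, (exists_coeff_eq_coeff_zero_smul hy (F + G)).choose_spec,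
      (exists_coeff_eq_coeff_zero_smul hy F).choose_spec,
      (exists_coeff_eq_coeff_zero_smul hy G).choose_spec, smul_add, coeff_add]
  map_smul' c F := by
    ext k
    rw [RingHom.id_apply, coeff_smul, (exists_coeff_eq_coeff_zero_smul hy (c • F)).choose_spec,
      (exists_coeff_eq_coeff_zero_smul hy F).choose_spec, smul_comm, coeff_smul]

variable (hy : Ideal.span (Set.range y) = maxIdealS σ K)

theorem coeff_dualSubst (k : σ →₀ ℕ) (F : DP σ K) :
    coeff k (dualSubst hy F) = coeff 0 (monomialIn y k • F) :=
  (exists_coeff_eq_coeff_zero_smul hy F).choose_spec k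

theorem dualSubst_smul (s : σ) (F : DP σ K) :
    dualSubst hy (y s • F) = (MvPowerSeries.X s : MvPowerSeries σ K) • dualSubst hy F := by
  ext k
  rw [coeff_X_smul, coeff_dualSubst, coeff_dualSubst, monomialIn_add_single, mul_smul]

theorem dualSubst_mem_degLT {s : ℕ} {F : DP σ K} (hF : F ∈ degLT σ K s) :
    dualSubst hy F ∈ degLT σ K s := by
  intro k hk
  rw [coeff_dualSubst, coeff_zero_monomialIn_smul_eq_zero hy hk hF]

/-- The kernel is closed under the `y s`, hence under all series. Its elements have zero constant
coefficient, because the empty monomial in `y` is `1`; so do all their contractions by monomials,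
which are their coefficients. -/
theorem dualSubst_injective : Function.Injective (dualSubst hy) := by
  rw [injective_iff_map_eq_zero]
  intro F hF
  ext k
  have h1 : ∀ G ∈ LinearMap.ker (dualSubst hy), coeff 0 G = 0 := by
    intro G hG
    have h2 := coeff_dualSubst hy 0 G
    rw [LinearMap.mem_ker.1 hG, monomialIn, Finsupp.prod_zero_index, one_smul] at h2
    exact h2.symm
  rw [coeff_eq_coeff_zero_smul]
  refine h1 _ (smul_mem_of_forall_generator hy (fun s G hG => ?_) _ hF)
  rw [LinearMap.mem_ker] at hG ⊢
  rw [dualSubst_smul, hG, smul_zero]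

theorem exists_dualSubst_eq {s : ℕ} {F : DP σ K} (hF : F ∈ degLT σ K s) :
    ∃ G ∈ degLT σ K s, dualSubst hy G = F := by
  -- The pieces of the degree filtration are finite-dimensional, so there injectivity implies
  -- surjectivity.
  let l : degLT σ K s →ₗ[K] degLT σ K s :=
    (dualSubst hy).restrict fun _ => dualSubst_mem_degLT hy
  have hl : Function.Injective l := fun a b h =>
    Subtype.ext (dualSubst_injective hy (congrArg Subtype.val h))
  obtain ⟨G, hG⟩ := LinearMap.surjective_of_injective hl ⟨F, hF⟩
  exact ⟨G, G.2, congrArg Subtype.val hG⟩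

theorem dualSubst_bijective : Function.Bijective (dualSubst hy) :=
  ⟨dualSubst_injective hy, fun F =>
    let ⟨G, _, hG⟩ := exists_dualSubst_eq hy (mem_degLT_succ_degree F)
    ⟨G, hG⟩⟩

/-- The linear automorphism of the divided power module that sends the monomials to the elements
dual to the monomials in `y`. -/
def coordChange : DP σ K ≃ₗ[K] DP σ K :=
  (LinearEquiv.ofBijective (dualSubst hy) (dualSubst_bijective hy)).symm

theorem dualSubst_coordChange (F : DP σ K) : dualSubst hy (coordChange hy F) = F :=
  LinearEquiv.apply_symm_apply
    (LinearEquiv.ofBijective (dualSubst hy) (dualSubst_bijective hy)) F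

theorem coordChange_eq_iff {F G : DP σ K} : coordChange hy F = G ↔ F = dualSubst hy G := by
  constructor
  · rintro rfl
    rw [dualSubst_coordChange]
  · rintro rfl
    exact dualSubst_injective hy (dualSubst_coordChange hy _)

theorem coordChange_X_smul (s : σ) (F : DP σ K) :
    coordChange hy ((MvPowerSeries.X s : MvPowerSeries σ K) • F) = y s • coordChange hy F := by
  rw [coordChange_eq_iff, dualSubst_smul, dualSubst_coordChange]

theorem coordChange_mem_degLT {s : ℕ} {F : DP σ K} :
    coordChange hy F ∈ degLT σ K s ↔ F ∈ degLT σ K s := by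
  constructor
  · intro h
    rw [← dualSubst_coordChange hy F]
    exact dualSubst_mem_degLT hy h
  · intro h
    obtain ⟨G, hG, hGF⟩ := exists_dualSubst_eq hy h
    rwa [(coordChange_eq_iff hy).2 hGF.symm]

theorem _root_.LevelAlgebra.DP.IndepTop.coordChange {τ b : ℕ} {F : Fin τ → DP σ K}
    (hF : IndepTop b F) : IndepTop b fun j => coordChange hy (F j) := by
  refine ⟨fun j => (coordChange_mem_degLT hy).2 (hF.1 j), fun c hc => hF.2 c ?_⟩
  simp only [← map_smul, ← map_sum] at hc
  exact (coordChange_mem_degLT hy).1 hc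

theorem coordChange_X (hX : Ideal.span (Set.range MvPowerSeries.X) = maxIdealS σ K)
    (F : DP σ K) : coordChange hX F = F := by
  rw [coordChange_eq_iff]
  ext k
  rw [coeff_dualSubst, coeff_eq_coeff_zero_smul]
  congr 2
  rw [monomialIn, MvPowerSeries.monomial_one_eq]

/-- `coordChange hy` is not linear over the series, but it intertwines the variables with the `y s`;
both generate the maximal ideal, and closure under either system is closure under all series. -/
theorem coordChange_mem_span_iff {A : Set (DP σ K)} {F : DP σ K} :
    coordChange hy F ∈ Submodule.span (MvPowerSeries σ K) (coordChange hy '' A) ↔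
      F ∈ Submodule.span (MvPowerSeries σ K) A := by
  constructor
  · intro h
    let N : Submodule K (DP σ K) :=
      ((Submodule.span (MvPowerSeries σ K) A).restrictScalars K).comap (dualSubst hy)
    have hN : ∀ G ∈ Submodule.span (MvPowerSeries σ K) (coordChange hy '' A), G ∈ N := by
      intro G hG
      induction hG using Submodule.span_induction with
      | mem x hx =>
        obtain ⟨G, hG, rfl⟩ := hx
        change dualSubst hy (coordChange hy G) ∈ Submodule.span (MvPowerSeries σ K) A
        rw [dualSubst_coordChange]
        exact Submodule.subset_span hG
      | zero => exact zero_mem _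
      | add x y _ _ hx hy => exact add_mem hx hy
      | smul a x _ hx =>
        refine smul_mem_of_forall_generator (N := N) hy (fun s G hG => ?_) a hx
        change dualSubst hy (y s • G) ∈ Submodule.span (MvPowerSeries σ K) A
        rw [dualSubst_smul]
        exact Submodule.smul_mem _ _ hG
    have := hN _ h
    rwa [← dualSubst_coordChange hy F]
  · intro h
    let N : Submodule K (DP σ K) :=
      ((Submodule.span (MvPowerSeries σ K) (coordChange hy '' A)).restrictScalars K).comap
        (coordChange hy).toLinearMap
    suffices hN : F ∈ N from hN
    induction h using Submodule.span_induction with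
    | mem x hx => exact Submodule.subset_span ⟨x, hx, rfl⟩
    | zero => exact zero_mem _
    | add x y _ _ hx hy => exact add_mem hx hy
    | smul a x _ hx =>
      refine smul_mem_of_forall_X (N := N) (fun s G hG => ?_) a hx
      change coordChange hy (_ • G) ∈ Submodule.span (MvPowerSeries σ K) (coordChange hy '' A)
      rw [coordChange_X_smul]
      exact Submodule.smul_mem _ _ hG

/-- `dualSubst` records the pairings with the monomials in `z`, and it sends the image of `X^l`
under `coordChange` back to `X^l`. -/
theorem isDualMonomials_coordChange {R : Type u} [CommRing R] [Module R (DP σ K)]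
    {ι : R →+* MvPowerSeries σ K} (hι : IsSeriesRing ι) {z : σ → R}
    (hz : Ideal.span (Set.range fun s => ι (z s)) = maxIdealS σ K) :
    IsDualMonomials z fun k => coordChange hz (mono k 1) := by
  classical
  intro k l
  have h1 : ι (k.prod fun i a => z i ^ a) = monomialIn (fun s => ι (z s)) k := by
    rw [monomialIn, map_finsuppProd]
    simp only [map_pow]
  rw [hι.smul_eq, h1, ← coeff_dualSubst hz, dualSubst_coordChange, coeff_mono]
  simp only [eq_comm]

end Coordinates

/-! ### Coordinate changes that fix the last variables, and admissibility of the cone -/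

section ConeCoordinates

variable {d e τ b : ℕ} {K : Type u} [Field K] {y : Fin d ⊕ Fin e → MvPowerSeries (Fin d ⊕ Fin e) K}
  (hy : Ideal.span (Set.range y) = maxIdealS (Fin d ⊕ Fin e) K)

/-- The series involves only variables that `y` leaves unchanged. Induction on the degree of `F`
leads from these variables to all series in them. -/
theorem coordChange_inclS_smul (hyr : ∀ t, y (Sum.inr t) = MvPowerSeries.X (Sum.inr t))
    (g : MvPowerSeries (Fin e) K) (F : DP (Fin d ⊕ Fin e) K) :
    coordChange hy (inclS d g • F) = inclS d g • coordChange hy F := by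
  have key : ∀ (s : ℕ) (g : MvPowerSeries (Fin e) K) (F : DP (Fin d ⊕ Fin e) K),
      F ∈ degLT _ K s → coordChange hy (inclS d g • F) = inclS d g • coordChange hy F := by
    intro s
    induction s with
    | zero =>
      intro g F hF
      rw [eq_zero_of_mem_degLT_zero hF, smul_zero, map_zero, smul_zero]
    | succ s ih =>
      intro g F hF
      have hmem : g - MvPowerSeries.C (MvPowerSeries.constantCoeff g) ∈
          Ideal.span (Set.range MvPowerSeries.X) := by
        change _ ∈ maxIdealS (Fin e) K
        rw [mem_maxIdealS_iff]
        simp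
      obtain ⟨c, hc⟩ := (Ideal.mem_span_range_iff_exists_fun).1 hmem
      have hg : g = MvPowerSeries.C (MvPowerSeries.constantCoeff g) +
          ∑ i, c i * MvPowerSeries.X i := by
        rw [hc]; ring
      have hg' : inclS d g = MvPowerSeries.C (MvPowerSeries.constantCoeff g) +
          ∑ i, inclS d (c i) * MvPowerSeries.X (Sum.inr i) := by
        conv_lhs => rw [hg]
        simp only [map_add, map_sum, map_mul, MvPowerSeries.rename_C, MvPowerSeries.rename_X]
      simp only [hg', add_smul, C_smul, Finset.sum_smul, map_add, map_sum, map_smul, mul_smul]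
      congr 1
      refine Finset.sum_congr rfl fun i _ => ?_
      rw [ih _ _ (smul_mem_degLT_of_constantCoeff_eq_zero (by simp) hF), coordChange_X_smul, hyr]
  exact key _ g F (mem_degLT_succ_degree F)

/-- The cone is the set of elements that are killed by the annihilator of the `H^j`. -/
theorem mem_span_coneTerm_iff_forall_smul_eq_zero {H : Fin τ → DP (Fin e) K}
    {F : DP (Fin d ⊕ Fin e) K} :
    F ∈ Submodule.span (MvPowerSeries (Fin d ⊕ Fin e) K)
        {F | ∃ (n : Fin d → ℕ) (j : Fin τ), (∀ i, 0 < n i) ∧ F = coneTerm n (H j)} ↔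
      ∀ g ∈ (Submodule.span (MvPowerSeries (Fin e) K) (Set.range H)).annihilator,
        inclS d g • F = 0 := by
  rw [mem_span_coneTerm_iff]
  constructor
  · intro h g hg
    refine ext_slice fun p => ?_
    rw [slice_inclS_smul, map_zero]
    exact Submodule.mem_annihilator.1 hg _ (h p)
  · intro h p
    refine mem_of_forall_annihilator_smul_eq_zero fun g hg => ?_
    rw [← slice_inclS_smul, h g hg, map_zero]

/-- The cone is what the annihilator of the `H^j` kills, and `coordChange` commutes with that
annihilator. This is why one and the same `W` is admissible with respect to all general sequences.
-/
theorem coordChange_mem_span_coneTerm_iff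
    (hyr : ∀ t, y (Sum.inr t) = MvPowerSeries.X (Sum.inr t)) {H : Fin τ → DP (Fin e) K}
    {F : DP (Fin d ⊕ Fin e) K} :
    coordChange hy F ∈ Submodule.span (MvPowerSeries (Fin d ⊕ Fin e) K)
        {F | ∃ (n : Fin d → ℕ) (j : Fin τ), (∀ i, 0 < n i) ∧ F = coneTerm n (H j)} ↔
      F ∈ Submodule.span (MvPowerSeries (Fin d ⊕ Fin e) K)
        {F | ∃ (n : Fin d → ℕ) (j : Fin τ), (∀ i, 0 < n i) ∧ F = coneTerm n (H j)} := by
  simp only [mem_span_coneTerm_iff_forall_smul_eq_zero, ← coordChange_inclS_smul hy hyr,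
    LinearEquiv.map_eq_zero_iff]

/-! ### Admissibility -/

/-- The exponent of the monomial `X_1^{n_1-1} ⋯ X_d^{n_d-1}`. -/
abbrev predExp (n : Fin d → ℕ) : Fin d →₀ ℕ := Finsupp.equivFunOnFinite.symm fun i => n i - 1

theorem isPos_sub_single_iff {n : Fin d → ℕ} (hn : IsPos n) (i : Fin d) :
    IsPos (n - Pi.single i 1) ↔ 1 ≤ predExp n i := by
  classical
  constructor
  · intro h
    have := h i
    simp at this
    simp
    omega
  · intro h t
    have := hn t
    by_cases hti : t = i
    · subst hti
      simp at h ⊢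
      omega
    · simpa [Pi.single_apply, hti] using this

theorem predExp_sub_single (n : Fin d → ℕ) (i : Fin d) :
    predExp (n - Pi.single i 1) = predExp n - Finsupp.single i 1 := by
  classical
  ext t
  by_cases hti : t = i
  · subst hti
    simp
  · simp [hti]

/-- Contraction never raises an exponent, so the bound on the exponent of `X_i` passes from `A` to
its span. Slices supported on `q ≤ p` with `q_i < p_i` are supported on `q ≤ p - e_i`. -/
theorem mem_span_embed_sub_single {H : Fin τ → DP (Fin e) K} {p : Fin d →₀ ℕ} {i : Fin d}
    {F : DP (Fin d ⊕ Fin e) K} {A : Set (DP (Fin d ⊕ Fin e) K)}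
    (hA : ∀ G ∈ A, ∀ k, coeff k G ≠ 0 → k (Sum.inl i) + 1 ≤ p i)
    (h : F ∈ Submodule.span (MvPowerSeries (Fin d ⊕ Fin e) K) (Set.range fun j => embed p (H j)))
    (h' : F ∈ Submodule.span (MvPowerSeries (Fin d ⊕ Fin e) K) A) :
    F ∈ Submodule.span (MvPowerSeries (Fin d ⊕ Fin e) K)
      (Set.range fun j => embed (p - Finsupp.single i 1) (H j)) := by
  classical
  have hF : ∀ k, coeff k F ≠ 0 → k (Sum.inl i) + 1 ≤ p i := by
    -- In the contrapositive form the bound says that coefficients vanish, which is stable under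
    -- sums.
    simp only [ne_eq, not_imp_comm (b := _ + 1 ≤ _)] at hA ⊢
    clear h
    induction h' using Submodule.span_induction with
    | mem x hx => exact hA x hx
    | zero => exact fun _ _ => rfl
    | add x y _ _ hx hy => intro k hk; rw [coeff_add, hx k hk, hy k hk, add_zero]
    | smul a x _ hx =>
      intro k hk
      rw [coeff_series_smul]
      refine Finset.sum_eq_zero fun l _ => ?_
      split_ifs with hkl
      · rw [hx l fun hl => hk ((Nat.succ_le_succ (hkl _)).trans hl), mul_zero]
      · rfl
  rw [mem_span_embed_iff] at h ⊢
  intro q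
  refine ⟨(h q).1, fun hq => ?_⟩
  by_cases hqp : q ≤ p
  · ext r
    by_contra h0
    have h1 := hF _ h0
    refine hq fun t => ?_
    have h2 := hqp t
    by_cases hti : t = i
    · subst hti
      simp at h1 ⊢
      omega
    · simpa [hti, Ne.symm hti] using h2
  · exact (h q).2 hqp

variable {R : Type u} [CommRing R] [Module R (DP (Fin d ⊕ Fin e) K)]
  {ι : R →+* MvPowerSeries (Fin d ⊕ Fin e) K}

/-- The conditions hold for the cone terms and the variables, and `coordChange` transports them: it
keeps degrees, independence of leading forms, and `W`. The local system, the systems for general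
sequences and the graded system are all instances. -/
theorem isAdmissibleSystem_coordChange (hι : IsSeriesRing ι) {H : Fin τ → DP (Fin e) K}
    (hH : IndepTop b H) {z : Fin d ⊕ Fin e → R}
    (hz : Ideal.span (Set.range fun s => ι (z s)) = maxIdealS (Fin d ⊕ Fin e) K)
    (hzr : ∀ t, ι (z (Sum.inr t)) = MvPowerSeries.X (Sum.inr t)) {𝔐 : Ideal R} {P : Set R}
    (h𝔐 : Ideal.span (Set.range z) = 𝔐) (hP : ∀ s, z s ∈ P)
    {W : Submodule R (DP (Fin d ⊕ Fin e) K)}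
    (hW : W = Submodule.span R
      {F | ∃ (n : Fin d → ℕ) (j : Fin τ), (∀ i, 0 < n i) ∧ F = coneTerm n (H j)}) :
    IsAdmissibleSystem 𝔐 P (fun i => z (Sum.inl i))
      (fun n j => coordChange hz (coneTerm n (H j))) W where
  generates := by
    have himage : {F | ∃ (n : Fin d → ℕ) (j : Fin τ), IsPos n ∧
        F = coordChange hz (coneTerm n (H j))} = coordChange hz ''
        {F | ∃ (n : Fin d → ℕ) (j : Fin τ), (∀ i, 0 < n i) ∧ F = coneTerm n (H j)} := by
      ext F
      constructor
      · rintro ⟨n, j, hn, rfl⟩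
        exact ⟨_, ⟨n, j, hn, rfl⟩, rfl⟩
      · rintro ⟨_, ⟨n, j, hn, rfl⟩, rfl⟩
        exact ⟨n, j, hn, rfl⟩
    ext F
    obtain ⟨F, rfl⟩ := (coordChange hz).surjective F
    rw [generated, himage, hW, hι.mem_span_iff, hι.mem_span_iff,
      coordChange_mem_span_coneTerm_iff hz hzr, coordChange_mem_span_iff]
  conditions := by
    classical
    refine ⟨Function.Embedding.inl, z, fun k => coordChange hz (mono k 1),
      fun n => (predExp n).degree + b, fun i => rfl, hP, h𝔐, isDualMonomials_coordChange hι hz,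
      fun n _ => indepTop_iff.1 ((hH.embed (predExp n)).coordChange hz), ?_, ?_⟩
    · intro n hn i j
      rw [hι.smul_eq, ← coordChange_X_smul hz, coneTerm_eq_embed, X_inl_smul_embed]
      simp only [isPos_sub_single_iff hn]
      split_ifs
      · rw [coneTerm_eq_embed, ← predExp_sub_single]
      · rw [map_zero]
    · intro n i hn hni F hF
      obtain ⟨F, rfl⟩ := (coordChange hz).surjective F
      have hrange (n : Fin d → ℕ) : (Set.range fun j => coordChange hz (coneTerm n (H j))) =
          coordChange hz '' Set.range fun j => embed (predExp n) (H j) :=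
        Set.range_comp (coordChange hz) fun j => embed (predExp n) (H j)
      have himage : {F | ∃ k : Fin d ⊕ Fin e →₀ ℕ,
          k ((Function.Embedding.inl : Fin d ↪ Fin d ⊕ Fin e) i) + 2 ≤ n i ∧
          k.degree ≤ (predExp n).degree + b ∧ F = coordChange hz (mono k 1)} = coordChange hz ''
          {F | ∃ k : Fin d ⊕ Fin e →₀ ℕ, k (Sum.inl i) + 2 ≤ n i ∧
            k.degree ≤ (predExp n).degree + b ∧ F = mono k 1} := by
        ext F
        constructor
        · rintro ⟨k, hk, hk', rfl⟩
          exact ⟨_, ⟨k, hk, hk', rfl⟩, rfl⟩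
        · rintro ⟨_, ⟨k, hk, hk', rfl⟩, rfl⟩
          exact ⟨k, hk, hk', rfl⟩
      rw [Submodule.mem_inf, piece, boundedPart, hrange, himage, hι.mem_span_iff,
        hι.mem_span_iff, coordChange_mem_span_iff, coordChange_mem_span_iff] at hF
      rw [piece, hrange, hι.mem_span_iff, coordChange_mem_span_iff, predExp_sub_single]
      refine mem_span_embed_sub_single ?_ hF.1 hF.2
      -- The bound `k_i ≤ n_i - 2` reads `k_i + 1 ≤ n_i - 1`, and `n_i - 1` is the exponent of `X_i`
      -- in the cone term.
      rintro _ ⟨k, hk, -, rfl⟩ l hl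
      rw [coeff_mono] at hl
      have : k = l := by by_contra h; simp [h] at hl
      subst this
      simp
      omega

end ConeCoordinates

/-! ### Ext modules -/

section Ext

open Abelian

variable {A : Type u} [CommRing A]

/-- The action of `x` on `Ext` can be computed on the first argument, where it is zero. -/
theorem smul_ext_eq_zero {N : ModuleCat.{u} A} {x : A} (hx : ∀ n : N, x • n = 0)
    {M : ModuleCat.{u} A} {i : ℕ} (α : Ext N M i) : x • α = 0 := by
  have h1 : x • 𝟙 N = 0 := by
    ext n
    exact hx n
  have h2 : x • α = (Ext.mk₀ (x • 𝟙 N)).comp α (zero_add i) := by simp [Ext.mk₀_smul]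
  rw [h2, h1]
  simp

/-- The connecting homomorphism is an isomorphism if the middle term has no `Ext` and the map from
the first term to the middle term induces zero. -/
theorem nonempty_ext_equiv_of_shortExact (N : ModuleCat.{u} A) {S : ShortComplex (ModuleCat.{u} A)}
    (hS : S.ShortExact) {i : ℕ} (h₂ : Subsingleton (Ext N S.X₂ i))
    (h₁ : ∀ α : Ext N S.X₁ (i + 1), α.comp (Ext.mk₀ S.f) (add_zero _) = 0) :
    Nonempty (Ext N S.X₃ i ≃ₗ[A] Ext N S.X₁ (i + 1)) := by
  refine ⟨LinearEquiv.ofBijective (Ext.postcompOfLinear hS.extClass A N (rfl : i + 1 = i + 1))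
    ⟨?_, fun α => ?_⟩⟩
  · rw [injective_iff_map_eq_zero]
    intro α hα
    obtain ⟨β, rfl⟩ := Ext.covariant_sequence_exact₃ N hS α rfl hα
    rw [Subsingleton.elim β 0, Ext.zero_comp]
  · obtain ⟨β, hβ⟩ := Ext.covariant_sequence_exact₁ N hS α (h₁ α) rfl
    exact ⟨β, hβ⟩

theorem comp_smulShortComplex_f_eq_zero {N : ModuleCat.{u} A} {x : A} (hx : ∀ n : N, x • n = 0)
    {M : ModuleCat.{u} A} {i : ℕ} (α : Ext N (M.smulShortComplex x).X₁ i) :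
    α.comp (Ext.mk₀ (M.smulShortComplex x).f) (add_zero _) = 0 := by
  rw [ModuleCat.smulShortComplex_f_eq_smul_id]
  exact (Ext.smul_eq_comp_mk₀ (Y := M) α x).symm.trans (smul_ext_eq_zero hx α)

/-- `Ext` into a module from a module that is killed by a regular sequence. -/
theorem ext_of_isWeaklyRegular (N : ModuleCat.{u} A) (rs : List A) (M : ModuleCat.{u} A)
    (hreg : RingTheory.Sequence.IsWeaklyRegular M rs) (hN : ∀ r ∈ rs, ∀ n : N, r • n = 0) :
    (∀ i < rs.length, Subsingleton (Ext N M i)) ∧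
      Nonempty (Ext N M rs.length ≃ₗ[A] (N →ₗ[A] M ⧸ (Ideal.ofList rs • ⊤ : Submodule A M))) := by
  induction rs generalizing M with
  | nil =>
    refine ⟨fun i hi => absurd hi (Nat.not_lt_zero _), ⟨?_⟩⟩
    have e₁ : Ext N M 0 ≃ₗ[A] (N →ₗ[A] M) :=
      (Ext.linearEquiv₀ (R := A)).trans (ModuleCat.homLinearEquiv (S := A))
    exact e₁.trans (LinearEquiv.congrRight
      (Submodule.quotEquivOfEqBot _ (by rw [Ideal.ofList_nil, Submodule.bot_smul])).symm)
  | cons r rs ih =>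
    rw [RingTheory.Sequence.isWeaklyRegular_cons_iff] at hreg
    have hr := hN r List.mem_cons_self
    obtain ⟨ih1, ⟨ih2⟩⟩ := ih (ModuleCat.of A (QuotSMulTop r M)) hreg.2
      fun r' hr' => hN r' (List.mem_cons_of_mem _ hr')
    have hS := hreg.1.smulShortComplex_shortExact
    have hvan : ∀ i < (r :: rs).length, Subsingleton (Ext N M i) := by
      intro i hi
      cases i with
      | zero =>
        refine ((Ext.linearEquiv₀ (R := A)).trans
          (ModuleCat.homLinearEquiv (S := A))).toEquiv.subsingleton_congr.2 ⟨fun f g => ?_⟩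
        ext n
        refine hreg.1 ?_
        change r • f n = r • g n
        rw [← map_smul, ← map_smul, hr, map_zero, map_zero]
      | succ i =>
        refine ⟨fun α β => ?_⟩
        have key : ∀ α : Ext N M (i + 1), α = 0 := by
          intro α
          obtain ⟨γ, hγ⟩ := Ext.covariant_sequence_exact₁ N hS (n₁ := i + 1) α
            (comp_smulShortComplex_f_eq_zero hr α) rfl
          have hsub : Subsingleton (Ext N (M.smulShortComplex r).X₃ i) :=
            ih1 i (by simpa using hi)
          rw [← hγ, Subsingleton.elim γ 0]
          exact Ext.zero_comp _ _ hS.extClass _ _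
        rw [key α, key β]
    refine ⟨hvan, ?_⟩
    -- Below the length of the sequence `Ext` into `M` vanishes, and `r` induces zero in the next
    -- degree; so the connecting map of `0 → M → M → M/rM → 0` is bijective here and removes `r`
    -- from the sequence.
    obtain ⟨δ⟩ := nonempty_ext_equiv_of_shortExact N hS (i := rs.length)
      (hvan rs.length (by simp)) (comp_smulShortComplex_f_eq_zero hr)
    refine ⟨LinearEquiv.trans (M₂ := Ext N (M.smulShortComplex r).X₃ rs.length) δ.symm
      (ih2.trans (LinearEquiv.congrRight ?_))⟩
    exact (Submodule.quotOfListConsSMulTopEquivQuotSMulTopInner M r rs).symm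

/-- On `Ext N L i` the element `x` acts as zero through `N` and invertibly through `L`. -/
theorem subsingleton_ext_of_bijective {N : ModuleCat.{u} A} {x : A} (hx : ∀ n : N, x • n = 0)
    {L : ModuleCat.{u} A} (hL : Function.Bijective fun l : L => x • l) (i : ℕ) :
    Subsingleton (Ext N L i) := by
  have hiso : IsIso (x • 𝟙 L) :=
    (LinearEquiv.ofBijective (LinearMap.lsmul A L x) hL).toModuleIso.isIso_hom
  have key : ∀ α : Ext N L i, α = 0 := by
    intro α
    have h1 : (α.comp (Ext.mk₀ (x • 𝟙 L)) (add_zero i)).comp (Ext.mk₀ (inv (x • 𝟙 L)))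
        (add_zero i) = α := by
      rw [Ext.comp_assoc_of_second_deg_zero, Ext.mk₀_comp_mk₀, IsIso.hom_inv_id, Ext.comp_mk₀_id]
    rw [← h1, ← Ext.smul_eq_comp_mk₀, smul_ext_eq_zero hx, Ext.zero_comp]
  exact ⟨fun α β => by rw [key α, key β]⟩

/-- The `A`-homomorphisms from `A/𝔪` to a module with a socle with basis `u_1, …, u_τ`. -/
theorem nonempty_hom_equiv_of_socle {τ : ℕ} (𝔪 : Ideal A) {Q : Type u} [AddCommGroup Q]
    [Module A Q] (u : Fin τ → Q) (h₁ : ∀ a ∈ 𝔪, ∀ j, a • u j = 0)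
    (h₂ : ∀ c : Fin τ → A, ∑ j, c j • u j = 0 → ∀ j, c j ∈ 𝔪)
    (h₃ : ∀ q : Q, (∀ a ∈ 𝔪, a • q = 0) → ∃ c : Fin τ → A, q = ∑ j, c j • u j) :
    Nonempty ((A ⧸ 𝔪 →ₗ[A] Q) ≃ₗ[A] (Fin τ → A ⧸ 𝔪)) := by
  let v (j : Fin τ) : A ⧸ 𝔪 →ₗ[A] Q :=
    Submodule.liftQ 𝔪 (LinearMap.toSpanSingleton A Q (u j)) fun a ha => h₁ a ha j
  have hv (j : Fin τ) (a : A) : v j (Ideal.Quotient.mk 𝔪 a) = a • u j := rfl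
  let Φ : (Fin τ → A ⧸ 𝔪) →ₗ[A] (A ⧸ 𝔪 →ₗ[A] Q) :=
    { toFun := fun c => ∑ j, (v j).comp (LinearMap.mulLeft A (c j))
      map_add' := fun c c' => by
        ext
        simp [LinearMap.sum_apply, Finset.sum_add_distrib]
      map_smul' := fun a c => by
        ext
        simp [Finset.smul_sum] }
  have hΦ (c : Fin τ → A) : Φ (fun j => Ideal.Quotient.mk 𝔪 (c j)) 1 = ∑ j, c j • u j := by
    simp [Φ, LinearMap.sum_apply, hv]
  refine ⟨(LinearEquiv.ofBijective Φ ⟨?_, fun g => ?_⟩).symm⟩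
  · rw [injective_iff_map_eq_zero]
    intro c hc
    obtain ⟨c, rfl⟩ : ∃ c' : Fin τ → A, (fun j => Ideal.Quotient.mk 𝔪 (c' j)) = c :=
      ⟨fun j => (Ideal.Quotient.mk_surjective (c j)).choose,
        funext fun j => (Ideal.Quotient.mk_surjective (c j)).choose_spec⟩
    have h := h₂ c (by rw [← hΦ, hc, LinearMap.zero_apply])
    exact funext fun j => Ideal.Quotient.eq_zero_iff_mem.2 (h j)
  · have hmk (a : A) : Ideal.Quotient.mk 𝔪 a = a • (1 : A ⧸ 𝔪) := by
      rw [Algebra.smul_def, mul_one]; rfl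
    obtain ⟨c, hc⟩ := h₃ (g 1) fun a ha => by
      rw [← map_smul, ← hmk, Ideal.Quotient.eq_zero_iff_mem.2 ha, map_zero]
    refine ⟨fun j => Ideal.Quotient.mk 𝔪 (c j), LinearMap.ext fun q => ?_⟩
    obtain ⟨a, rfl⟩ := Ideal.Quotient.mk_surjective q
    rw [hmk, map_smul, map_smul, hΦ, hc]

/-- A module over a Noetherian `K`-algebra that is dual to the algebra with respect to the
`𝔪`-adic topology is injective. -/
theorem injective_of_continuous_dual {K : Type u} [Field K] [Algebra K A] [IsNoetherianRing A]
    (𝔪 : Ideal A) {M : Type u} [AddCommGroup M] [Module A M] [Module K M] [IsScalarTower K A M]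
    (ev : M →ₗ[K] K) (h₁ : ∀ w, (∀ a : A, ev (a • w) = 0) → w = 0)
    (h₂ : ∀ w : M, ∃ n, ∀ a ∈ 𝔪 ^ n, a • w = 0)
    (h₃ : ∀ (l : A →ₗ[K] K) (n : ℕ), (∀ a ∈ 𝔪 ^ n, l a = 0) → ∃ w, ∀ a, l a = ev (a • w)) :
    Module.Injective A M := by
  refine Module.Baer.injective fun I g => ?_
  -- As `I` is finitely generated, one power of `𝔪` kills all values of `g`.
  obtain ⟨n, hn⟩ : ∃ n, ∀ x : I, ∀ a ∈ 𝔪 ^ n, a • g x = 0 := by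
    obtain ⟨s, hs⟩ := Module.Finite.fg_top (R := A) (M := I)
    choose n hn using fun x : I => h₂ (g x)
    refine ⟨s.sup n, fun x a ha => ?_⟩
    have hx : x ∈ Submodule.span A (s : Set I) := hs ▸ Submodule.mem_top
    induction hx using Submodule.span_induction with
    | mem x hx => exact hn x a (Ideal.pow_le_pow_right (Finset.le_sup hx) ha)
    | zero => rw [map_zero, smul_zero]
    | add x y _ _ hx hy => rw [map_add, smul_add, hx, hy, add_zero]
    | smul c x _ hx => rw [map_smul, smul_comm, hx, smul_zero]
  -- By Artin–Rees the intersection of `𝔪^(n+k)` with `I` lies in `𝔪^n I`, where `g` vanishes. Hence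
  -- `ev ∘ g` factors through the image of `I` in `A/𝔪^(n+k)` and extends to a functional on this
  -- quotient, which is represented by some `w`.
  obtain ⟨k, hk⟩ := Ideal.exists_pow_inf_eq_pow_smul 𝔪 (I : Submodule A A)
  have hvan : ∀ x : I, (x : A) ∈ 𝔪 ^ (n + k) → g x = 0 := by
    intro x hx
    have h1 : (x : A) ∈ (𝔪 ^ n • (I : Submodule A A)) := by
      have h2 : (x : A) ∈ 𝔪 ^ (n + k) • (⊤ : Submodule A A) ⊓ I :=
        ⟨by rwa [smul_eq_mul, Ideal.mul_top], x.2⟩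
      rw [hk _ (Nat.le_add_left k n), Nat.add_sub_cancel] at h2
      exact smul_mono_right (𝔪 ^ n) (inf_le_right : _ ⊓ (I : Submodule A A) ≤ I) h2
    have h2 : ∀ y (_ : y ∈ 𝔪 ^ n • (I : Submodule A A)), ∀ hy : y ∈ I, g ⟨y, hy⟩ = 0 := by
      intro y hy
      induction hy using Submodule.smul_induction_on' with
      | smul a ha b hb =>
        intro hy
        rw [show (⟨a • b, hy⟩ : I) = a • ⟨b, hb⟩ from rfl, map_smul, hn _ a ha]
      | add a ha b hb h h' =>
        intro hy
        have ha' : a ∈ I := Submodule.smul_le_right ha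
        have hb' : b ∈ I := Submodule.smul_le_right hb
        rw [show (⟨a + b, hy⟩ : I) = ⟨a, ha'⟩ + ⟨b, hb'⟩ from rfl, map_add, h, h', add_zero]
    exact h2 x h1 x.2
  let i : I →ₗ[K] A ⧸ 𝔪 ^ (n + k) :=
    ((Ideal.Quotient.mkₐ K (𝔪 ^ (n + k))).toLinearMap).comp
      ((Submodule.subtype (I : Submodule A A)).restrictScalars K)
  let l₀ : I →ₗ[K] K := ev.comp (g.restrictScalars K)
  have hl₀ : l₀ ∈ LinearMap.range i.dualMap := by
    rw [LinearMap.range_dualMap_eq_dualAnnihilator_ker, Submodule.mem_dualAnnihilator]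
    intro x hx
    have hx' : (x : A) ∈ 𝔪 ^ (n + k) := Ideal.Quotient.eq_zero_iff_mem.1 hx
    change ev (g x) = 0
    rw [hvan x hx', map_zero]
  obtain ⟨l₁, hl₁⟩ := hl₀
  obtain ⟨w, hw⟩ := h₃ (l₁.comp (Ideal.Quotient.mkₐ K (𝔪 ^ (n + k))).toLinearMap) (n + k)
    fun a ha => by
      change l₁ (Ideal.Quotient.mk _ a) = 0
      rw [Ideal.Quotient.eq_zero_iff_mem.2 ha, map_zero]
  refine ⟨LinearMap.toSpanSingleton A M w, fun x hx => ?_⟩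
  rw [LinearMap.toSpanSingleton_apply, ← sub_eq_zero]
  -- Since `ev` detects zero, `x • w = g x` may be tested after multiplication by every `a` and
  -- application of `ev`.
  refine h₁ _ fun a => ?_
  have h4 : l₁ (Ideal.Quotient.mk _ (a * x)) = ev (g ⟨a * x, I.mul_mem_left a hx⟩) :=
    LinearMap.congr_fun hl₁ ⟨a * x, I.mul_mem_left a hx⟩
  have h5 : l₁ (Ideal.Quotient.mk _ (a * x)) = ev ((a * x) • w) := hw (a * x)
  have h6 : g ⟨a * x, I.mul_mem_left a hx⟩ = a • g ⟨x, hx⟩ := by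
    rw [← map_smul]; rfl
  rw [smul_sub, map_sub, ← mul_smul, ← h5, h4, h6, sub_self]

end Ext

/-! ### Socles of the quotients by annihilators -/

section Socle

variable {σ : Type} {K : Type u} [Field K] {τ b : ℕ} {G : Fin τ → DP σ K}

theorem series_smul_mono_zero (f : MvPowerSeries σ K) (c : K) :
    f • (mono 0 c : DP σ K) = mono 0 (MvPowerSeries.constantCoeff f * c) := by
  classical
  have h : (mono 0 c : DP σ K) ∈ degLT σ K 1 := by
    intro k hk
    rw [coeff_mono, if_neg]
    rintro rfl
    simp at hk
  rw [eq_mono_of_mem_degLT_one (smul_mem_degLT f h), smul_eq_of_mem_degLT_one f h, coeff_smul,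
    coeff_mono, if_pos rfl]

theorem mono_zero_eq_zero_iff {c : K} : (mono 0 c : DP σ K) = 0 ↔ c = 0 :=
  Finsupp.single_eq_zero

theorem mem_degLT_one_of_forall_X_smul_eq_zero {F : DP σ K}
    (h : ∀ s, (MvPowerSeries.X s : MvPowerSeries σ K) • F = 0) : F ∈ degLT σ K 1 := by
  classical
  intro k hk
  have hk0 : k ≠ 0 := by
    rintro rfl
    simp at hk
  obtain ⟨s, hs⟩ := Finsupp.ne_iff.1 hk0
  have h1 : k = (k - Finsupp.single s 1) + Finsupp.single s 1 :=
    (tsub_add_cancel_of_le (Finsupp.single_le_iff.2 (Nat.one_le_iff_ne_zero.2 hs))).symm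
  rw [h1, ← coeff_X_smul, h, coeff_zero]

/-- A family of series `g_i` that is dual to a family with independent leading forms spans the
socle modulo the annihilator. -/
theorem exists_smul_eq_of_socle {g : Fin τ → MvPowerSeries σ K}
    (hg : ∀ i j, g i • G j = mono 0 (if i = j then 1 else 0)) {f : MvPowerSeries σ K}
    (hf : ∀ s j, (MvPowerSeries.X s * f) • G j = 0) :
    ∃ c : Fin τ → K, ∀ j, f • G j = (∑ i, MvPowerSeries.C (c i) * g i) • G j := by
  classical
  refine ⟨fun i => coeff 0 (f • G i), fun j => ?_⟩
  have h1 : f • G j ∈ degLT σ K 1 := mem_degLT_one_of_forall_X_smul_eq_zero fun s => by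
    rw [← mul_smul, hf]
  rw [Finset.sum_smul, Finset.sum_eq_single j]
  · rw [mul_smul, hg, if_pos rfl, series_smul_mono_zero, mul_one, MvPowerSeries.constantCoeff_C]
    exact eq_mono_of_mem_degLT_one h1
  · intro i _ hij
    rw [mul_smul, hg, if_neg hij, mono_zero, smul_zero]
  · simp

theorem constantCoeff_eq_zero_of_sum_smul_eq_zero {g : Fin τ → MvPowerSeries σ K}
    (hg : ∀ i j, g i • G j = mono 0 (if i = j then 1 else 0)) {f : Fin τ → MvPowerSeries σ K}
    {j : Fin τ} (hf : (∑ i, f i * g i) • G j = 0) : MvPowerSeries.constantCoeff (f j) = 0 := by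
  classical
  rw [Finset.sum_smul, Finset.sum_eq_single j] at hf
  · rwa [mul_smul, hg, if_pos rfl, series_smul_mono_zero, mul_one, mono_zero_eq_zero_iff] at hf
  · intro i _ hij
    rw [mul_smul, hg, if_neg hij, mono_zero, smul_zero]
  · simp

variable [Fintype σ]

/-! ### Homomorphisms from the residue field, and the type -/

section Hom

variable {R : Type u} [CommRing R] [Module R (DP σ K)] {ι : R →+* MvPowerSeries σ K} {A : Type u}
  [CommRing A] {π : R →+* A}

/-- The classes of the dual forms are a basis of the socle of `A/J`; since `J` is what kills all `G
j`, every identity modulo `J` is tested on the `G j`. -/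
theorem nonempty_hom_equiv_of_indepTop (hι : IsSeriesRing ι) (hG : IndepTop b G)
    (hπ : Function.Surjective π) {𝔪 J : Ideal A}
    (h𝔪 : ∀ f, π f ∈ 𝔪 ↔ MvPowerSeries.constantCoeff (ι f) = 0)
    (hJ : ∀ f, π f ∈ J ↔ ∀ j, ι f • G j = 0) :
    Nonempty ((A ⧸ 𝔪 →ₗ[A] A ⧸ J) ≃ₗ[A] (Fin τ → A ⧸ 𝔪)) := by
  classical
  obtain ⟨g', -, hg⟩ := hG.exists_dual
  choose g hg' using fun i => hι.exists_polynomial (g' i)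
  simp only [← hg'] at hg
  have hmk (f : R) : Ideal.Quotient.mk J (π f) = 0 ↔ ∀ j, ι f • G j = 0 := by
    rw [Ideal.Quotient.eq_zero_iff_mem, hJ]
  have hsmul (f h : R) : π f • Ideal.Quotient.mk J (π h) = Ideal.Quotient.mk J (π (f * h)) := by
    rw [map_mul, map_mul, Algebra.smul_def]; rfl
  refine nonempty_hom_equiv_of_socle 𝔪 (fun j => Ideal.Quotient.mk J (π (g j))) ?_ ?_ ?_
  · intro a ha i
    obtain ⟨f, rfl⟩ := hπ a
    rw [hsmul, hmk]
    intro j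
    rw [map_mul, mul_smul, hg, series_smul_mono_zero, (h𝔪 f).1 ha, zero_mul, mono_zero]
  · intro c hc j
    choose f hf using fun i => hπ (c i)
    simp only [← hf, hsmul, ← map_sum] at hc
    rw [hmk] at hc
    rw [← hf, h𝔪]
    refine constantCoeff_eq_zero_of_sum_smul_eq_zero (f := fun i => ι (f i)) hg (j := j) ?_
    rw [← hc j, map_sum]
    simp only [map_mul]
  · intro q hq
    obtain ⟨a, rfl⟩ := Ideal.Quotient.mk_surjective q
    obtain ⟨f, rfl⟩ := hπ a
    obtain ⟨c, hc⟩ := exists_smul_eq_of_socle hg (f := ι f) fun s j => by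
      obtain ⟨x, hx⟩ := hι.exists_polynomial (MvPolynomial.X s)
      rw [MvPolynomial.coe_X] at hx
      rw [← hx, ← map_mul]
      refine (hmk (x * f)).1 ?_ j
      rw [← hsmul]
      refine hq _ ((h𝔪 x).2 ?_)
      rw [hx]
      simp
    choose c' hc' using fun i => hι.exists_polynomial (MvPolynomial.C (c i))
    simp only [MvPolynomial.coe_C] at hc'
    refine ⟨fun i => π (c' i), ?_⟩
    simp only [hsmul, ← map_sum]
    rw [← sub_eq_zero, ← map_sub, ← map_sub, hmk]
    intro j
    rw [map_sub, sub_smul, hc j, map_sum]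
    simp only [map_mul, hc', sub_self]

/-- The type of an algebra with a regular sequence modulo which it is the quotient by the
annihilator of elements with independent leading forms. -/
theorem hasType_of_isRegular (hι : IsSeriesRing ι) (hG : IndepTop b G)
    (hπ : Function.Surjective π) {𝔪 : Ideal A}
    (h𝔪 : ∀ f, π f ∈ 𝔪 ↔ MvPowerSeries.constantCoeff (ι f) = 0) {rs : List A}
    (hreg : RingTheory.Sequence.IsRegular A rs) (hrs : ∀ r ∈ rs, r ∈ 𝔪)
    (hJ : ∀ f, π f ∈ Ideal.ofList rs ↔ ∀ j, ι f • G j = 0) : HasType A 𝔪 rs.length τ := by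
  obtain ⟨e₁⟩ := (ext_of_isWeaklyRegular (ModuleCat.of A (A ⧸ 𝔪)) rs (ModuleCat.of A A)
    hreg.toIsWeaklyRegular fun r hr n => by
      obtain ⟨a, rfl⟩ := Ideal.Quotient.mk_surjective n
      change Ideal.Quotient.mk 𝔪 (r * a) = 0
      exact Ideal.Quotient.eq_zero_iff_mem.2 (Ideal.mul_mem_right _ _ (hrs r hr))).2
  obtain ⟨e₂⟩ := nonempty_hom_equiv_of_indepTop (J := Ideal.ofList rs • (⊤ : Ideal A)) hι hG hπ
    h𝔪 (by simpa only [smul_eq_mul, Ideal.mul_top] using hJ)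
  exact ⟨e₁.trans e₂⟩

end Hom

theorem maxIdealS_eq_ker :
    maxIdealS σ K = RingHom.ker (MvPowerSeries.constantCoeff (σ := σ) (R := K)) := by
  ext f
  rw [mem_maxIdealS_iff, RingHom.mem_ker]

instance : (maxIdealS σ K).IsMaximal := by
  rw [maxIdealS_eq_ker]
  exact RingHom.ker_isMaximal_of_surjective _ fun c => ⟨MvPowerSeries.C c, by simp⟩

theorem coe_mem_maxIdealS_pow {p : MvPolynomial σ K} (hp : p.IsHomogeneous b) :
    (p : MvPowerSeries σ K) ∈ maxIdealS σ K ^ b := by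
  rw [p.as_sum]
  have h1 : ((∑ k ∈ p.support, MvPolynomial.monomial k (MvPolynomial.coeff k p) :
      MvPolynomial σ K) : MvPowerSeries σ K) = ∑ k ∈ p.support,
        MvPowerSeries.C (MvPolynomial.coeff k p) * monomialIn MvPowerSeries.X k := by
    rw [← MvPolynomial.coeToMvPowerSeries.ringHom_apply, map_sum]
    refine Finset.sum_congr rfl fun k _ => ?_
    rw [MvPolynomial.coeToMvPowerSeries.ringHom_apply, MvPolynomial.coe_monomial, monomialIn,
      ← MvPowerSeries.monomial_one_eq, ← MvPowerSeries.smul_eq_C_mul, ← map_smul, smul_eq_mul,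
      mul_one]
  rw [h1]
  refine sum_mem fun k hk => Ideal.mul_mem_left _ _ ?_
  have h2 : k.degree = b := by
    rw [Finsupp.degree_eq_weight_one]
    exact hp (MvPolynomial.mem_support_iff.1 hk)
  exact h2 ▸ monomialIn_mem_pow rfl k

section ArtinianLevel

variable {B : Type u} [CommRing B] {π : MvPowerSeries σ K →+* B}

/-- The quotient by the annihilator of elements with independent leading forms of the same degree
is Artinian level. -/
theorem isArtinianLevel_of_indepTop (hτ : 0 < τ) (hG : IndepTop b G)
    (hπ : Function.Surjective π) (hker : ∀ f, π f = 0 ↔ ∀ j, f • G j = 0) :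
    IsArtinianLevel B ((maxIdealS σ K).map π) := by
  classical
  obtain ⟨g, hgb, hg⟩ := hG.exists_dual
  have hpow (n : ℕ) (x : B) : x ∈ (maxIdealS σ K).map π ^ n ↔ ∃ f ∈ maxIdealS σ K ^ n, π f = x := by
    rw [← Ideal.map_pow, Ideal.mem_map_iff_of_surjective π hπ]
  -- The socle degree is `b`: products of `b + 1` elements of the maximal ideal kill all elements of
  -- degree at most `b`, whereas a dual form of degree `b` does not kill its `G j`.
  have hb1 : (maxIdealS σ K).map π ^ (b + 1) = ⊥ := by
    rw [eq_bot_iff]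
    intro x hx
    obtain ⟨f, hf, rfl⟩ := (hpow _ _).1 hx
    rw [Ideal.mem_bot, hker]
    exact fun j => smul_eq_zero_of_mem_pow hf (hG.1 j)
  have hb : (maxIdealS σ K).map π ^ b ≠ ⊥ := by
    intro h
    have h1 : π (g ⟨0, hτ⟩) ∈ (maxIdealS σ K).map π ^ b :=
      (hpow _ _).2 ⟨_, coe_mem_maxIdealS_pow (hgb _), rfl⟩
    rw [h, Ideal.mem_bot, hker] at h1
    have h2 := h1 ⟨0, hτ⟩
    rw [hg, if_pos rfl, mono_zero_eq_zero_iff] at h2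
    exact one_ne_zero h2
  refine ⟨?_, b, hb, hb1, le_antisymm ?_ ?_⟩
  · rw [isArtinianRing_iff_isNoetherianRing_krullDimLE_zero]
    refine ⟨isNoetherianRing_of_surjective _ _ π hπ, Ring.KrullDimLE.mk₀ fun P hP => ?_⟩
    have hle : (maxIdealS σ K).map π ≤ P := by
      refine (hP.pow_le_iff (Nat.succ_ne_zero b)).1 ?_
      rw [hb1]
      exact bot_le
    rcases Ideal.map_eq_top_or_isMaximal_of_surjective π hπ (I := maxIdealS σ K) inferInstance with
      h | h
    · exact absurd (top_le_iff.1 (h ▸ hle)) hP.ne_top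
    · rwa [← h.eq_of_le hP.ne_top hle]
  · intro x hx
    obtain ⟨f, rfl⟩ := hπ x
    obtain ⟨c, hc⟩ := exists_smul_eq_of_socle hg (f := f) fun s j => by
      refine (hker _).1 ?_ j
      rw [map_mul, mul_comm]
      exact Submodule.mem_annihilator.1 hx _
        (Ideal.mem_map_of_mem π (Ideal.subset_span ⟨s, rfl⟩))
    refine (hpow _ _).2 ⟨∑ i, MvPowerSeries.C (c i) * (g i : MvPowerSeries σ K), sum_mem fun i _ =>
      Ideal.mul_mem_left _ _ (coe_mem_maxIdealS_pow (hgb i)), ?_⟩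
    rw [← sub_eq_zero, ← map_sub, hker]
    intro j
    rw [sub_smul, hc j, sub_self]
  · intro x hx
    rw [Submodule.mem_annihilator]
    intro n hn
    have : x * n ∈ (maxIdealS σ K).map π ^ (b + 1) := by
      rw [pow_succ]
      exact Ideal.mul_mem_mul hx hn
    rwa [hb1] at this

end ArtinianLevel

end Socle

/-! ### The quotient of the cone algebra by a system of parameters -/

section Cone

variable {d e τ b : ℕ} {K : Type u} [Field K] {H : Fin τ → DP (Fin e) K}

theorem mem_annihilator_span_range_iff {σ : Type} {G : Fin τ → DP σ K} {f : MvPowerSeries σ K} :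
    f ∈ (Submodule.span (MvPowerSeries σ K) (Set.range G)).annihilator ↔ ∀ j, f • G j = 0 := by
  simp [Submodule.mem_annihilator_span]

theorem annihilator_span_range_ne_top (hτ : 0 < τ) (hH : IndepTop b H) :
    (Submodule.span (MvPowerSeries (Fin e) K) (Set.range H)).annihilator ≠ ⊤ := by
  obtain ⟨g, -, hg⟩ := hH.exists_dual
  intro h
  have h1 : (1 : MvPowerSeries (Fin e) K) ∈
      (Submodule.span (MvPowerSeries (Fin e) K) (Set.range H)).annihilator := h ▸ Submodule.mem_top
  have h2 := mem_annihilator_span_range_iff.1 h1 ⟨0, hτ⟩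
  have h3 := hg ⟨0, hτ⟩ ⟨0, hτ⟩
  rw [one_smul] at h2
  rw [h2, smul_zero, if_pos rfl] at h3
  exact one_ne_zero (mono_zero_eq_zero_iff.1 h3.symm)

theorem annihilator_span_range_le (hτ : 0 < τ) (hH : IndepTop b H) :
    (Submodule.span (MvPowerSeries (Fin e) K) (Set.range H)).annihilator ≤
      maxIdealS (Fin e) K := by
  intro g hg
  rw [mem_maxIdealS_iff]
  by_contra h
  refine annihilator_span_range_ne_top hτ hH (Ideal.eq_top_of_isUnit_mem _ hg ?_)
  exact MvPowerSeries.isUnit_iff_constantCoeff.2 (isUnit_iff_ne_zero.2 h)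

theorem maxIdealS_pow_le_annihilator (hH : IndepTop b H) :
    maxIdealS (Fin e) K ^ (b + 1) ≤
      (Submodule.span (MvPowerSeries (Fin e) K) (Set.range H)).annihilator := fun _ hf =>
  mem_annihilator_span_range_iff.2 fun j => smul_eq_zero_of_mem_pow hf (hH.1 j)

/-- On an element without the first variables a series acts through its slice at zero. So an
annihilator over the small ring becomes one over the large ring, where the socle computation is
available. -/
theorem seriesSlice_zero_mem_annihilator_iff {f : MvPowerSeries (Fin d ⊕ Fin e) K} :
    seriesSlice 0 f ∈ (Submodule.span (MvPowerSeries (Fin e) K) (Set.range H)).annihilator ↔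
      ∀ j, f • embed (0 : Fin d →₀ ℕ) (H j) = 0 := by
  classical
  rw [mem_annihilator_span_range_iff]
  refine forall_congr' fun j => ?_
  have h (p : Fin d →₀ ℕ) : slice p (f • embed 0 (H j)) =
      if p = 0 then seriesSlice 0 f • H j else 0 := by
    rw [slice_smul_embed, tsub_eq_zero_of_le zero_le]
    simp only [nonpos_iff_eq_zero]
  constructor
  · intro h0
    refine ext_slice fun p => ?_
    rw [h, h0, ite_self, map_zero]
  · intro h0
    have := h 0
    rw [h0, map_zero, if_pos rfl] at this
    exact this.symm

theorem DP.IndepTop.embed_zero (hH : IndepTop b H) :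
    IndepTop b fun j => DP.embed (0 : Fin d →₀ ℕ) (H j) := by
  have := hH.embed (0 : Fin d →₀ ℕ)
  rwa [map_zero, zero_add] at this

/-! ### Ideals -/

/-- In the expansion of a product of `n + 1` factors from `J + L`, every term has a factor in `J` or
all factors in `L`. -/
theorem sup_pow_succ_le {R : Type*} [CommRing R] (J L : Ideal R) (n : ℕ) :
    (J ⊔ L) ^ (n + 1) ≤ J * (J ⊔ L) ^ n ⊔ L ^ (n + 1) := by
  induction n with
  | zero => simp
  | succ n ih =>
    calc (J ⊔ L) ^ (n + 1 + 1) = J * (J ⊔ L) ^ (n + 1) ⊔ L * (J ⊔ L) ^ (n + 1) := by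
          rw [pow_succ' _ (n + 1), Ideal.sup_mul]
      _ ≤ J * (J ⊔ L) ^ (n + 1) ⊔ L * (J * (J ⊔ L) ^ n ⊔ L ^ (n + 1)) :=
          sup_le_sup_left (Ideal.mul_mono_right ih) _
      _ ≤ J * (J ⊔ L) ^ (n + 1) ⊔ L ^ (n + 1 + 1) := by
          rw [Ideal.mul_sup, ← pow_succ' L]
          refine sup_le le_sup_left (sup_le (le_sup_of_le_left ?_) le_sup_right)
          rw [← mul_assoc, mul_comm L J, mul_assoc, pow_succ' (J ⊔ L)]
          exact Ideal.mul_mono_right (Ideal.mul_mono_left le_sup_right)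

theorem mem_of_matrix_mul_mem {R : Type*} [CommRing R] {M : Matrix (Fin d) (Fin d) R}
    (hM : IsUnit M.det) {z : Fin d → R} {𝔞 : Ideal R} (h : ∀ i, ∑ j, M i j * z j ∈ 𝔞) (i : Fin d) :
    z i ∈ 𝔞 := by
  have h1 : M⁻¹.mulVec (M.mulVec z) = z := by
    rw [Matrix.mulVec_mulVec, Matrix.nonsing_inv_mul _ hM, Matrix.one_mulVec]
  rw [← h1]
  change ∑ j, M⁻¹ i j * ∑ l, M j l * z l ∈ 𝔞
  exact sum_mem fun j _ => Ideal.mul_mem_left _ _ (h j)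

/-! ### Coordinates -/

section Coordinates

variable {y : Fin d ⊕ Fin e → MvPowerSeries (Fin d ⊕ Fin e) K}
  (hy : Ideal.span (Set.range y) = maxIdealS (Fin d ⊕ Fin e) K)
  (hyr : ∀ t, y (Sum.inr t) = MvPowerSeries.X (Sum.inr t))

include hy hyr in
theorem maxIdealS_eq_sup : maxIdealS (Fin d ⊕ Fin e) K =
    Ideal.span (Set.range fun i => y (Sum.inl i)) ⊔ (maxIdealS (Fin e) K).map (inclS d) := by
  have h : Set.range y = (Set.range fun i => y (Sum.inl i)) ∪ Set.range fun t => y (Sum.inr t) := by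
    ext f
    simp
  rw [← hy, h, Ideal.span_union]
  congr 1
  rw [maxIdealS, Ideal.map_span, ← Set.range_comp]
  congr 2
  ext t : 1
  simp [hyr]

include hy hyr in
-- The maximal ideal is the ideal of the first `d` generators plus that of the last variables, and
-- the `(b + 1)`-st power of the latter kills the `H^j`. Modulo the annihilator this is the
-- reduction equation with exponent `b`.
theorem maxIdealS_pow_succ_le (hH : IndepTop b H) :
    maxIdealS (Fin d ⊕ Fin e) K ^ (b + 1) ≤
      Ideal.span (Set.range fun i => y (Sum.inl i)) * maxIdealS (Fin d ⊕ Fin e) K ^ b ⊔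
        (Submodule.span (MvPowerSeries (Fin e) K) (Set.range H)).annihilator.map (inclS d) := by
  have h := sup_pow_succ_le (Ideal.span (Set.range fun i => y (Sum.inl i)))
    ((maxIdealS (Fin e) K).map (inclS d)) b
  rw [← maxIdealS_eq_sup hy hyr, ← Ideal.map_pow] at h
  exact h.trans (sup_le_sup_left (Ideal.map_mono (maxIdealS_pow_le_annihilator hH)) _)

include hy hyr in
/-- The elements of the power series ring are sums of power series in the last variables and
elements of the ideal of the first elements of the system of generators, up to a power of the
maximal ideal. -/
theorem exists_sub_inclS_mem (n : ℕ) (f : MvPowerSeries (Fin d ⊕ Fin e) K) :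
    ∃ g : MvPowerSeries (Fin e) K, f - inclS d g ∈
      Ideal.span (Set.range fun i => y (Sum.inl i)) ⊔ maxIdealS (Fin d ⊕ Fin e) K ^ n := by
  induction n generalizing f with
  | zero =>
    refine ⟨0, ?_⟩
    rw [pow_zero, Ideal.one_eq_top, sup_top_eq]
    exact Submodule.mem_top
  | succ n ih =>
    have hmem : f - MvPowerSeries.C (MvPowerSeries.constantCoeff f) ∈
        Ideal.span (Set.range y) := by
      rw [hy, mem_maxIdealS_iff]
      simp
    obtain ⟨c, hc⟩ := (Ideal.mem_span_range_iff_exists_fun).1 hmem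
    -- Only the coefficients of the last variables need to be approximated; the other terms lie in
    -- the ideal. The factor `x_t` gains one power of the maximal ideal.
    choose g hg using fun t => ih (c (Sum.inr t))
    refine ⟨MvPowerSeries.C (MvPowerSeries.constantCoeff f) + ∑ t, g t * MvPowerSeries.X t, ?_⟩
    have h1 : f - inclS d (MvPowerSeries.C (MvPowerSeries.constantCoeff f) +
        ∑ t, g t * MvPowerSeries.X t) = ∑ i, c (Sum.inl i) * y (Sum.inl i) +
          ∑ t, (c (Sum.inr t) - inclS d (g t)) * MvPowerSeries.X (Sum.inr t) := by
      simp only [map_add, map_sum, map_mul, MvPowerSeries.rename_C, MvPowerSeries.rename_X,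
        sub_mul, Finset.sum_sub_distrib]
      rw [← sub_sub, ← hc, Fintype.sum_sum_type]
      simp only [hyr]
      ring
    rw [h1]
    refine add_mem (Ideal.mem_sup_left (sum_mem fun i _ => Ideal.mul_mem_left _ _
      (Ideal.subset_span ⟨i, rfl⟩))) (sum_mem fun t _ => ?_)
    have h2 := Ideal.mul_mem_mul (hg t) (show MvPowerSeries.X (Sum.inr t) ∈
      maxIdealS (Fin d ⊕ Fin e) K from Ideal.subset_span ⟨_, rfl⟩)
    rw [Ideal.sup_mul, ← pow_succ] at h2
    have h3 : Ideal.span (Set.range fun i => y (Sum.inl i)) * maxIdealS (Fin d ⊕ Fin e) K ⊔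
        maxIdealS (Fin d ⊕ Fin e) K ^ (n + 1) ≤ Ideal.span (Set.range fun i => y (Sum.inl i)) ⊔
          maxIdealS (Fin d ⊕ Fin e) K ^ (n + 1) := sup_le_sup Ideal.mul_le_left le_rfl
    exact h3 h2

include hyr in
theorem smul_coordChange_embed_zero (g : MvPowerSeries (Fin e) K) (G : DP (Fin e) K) :
    inclS d g • coordChange hy (embed 0 G) = coordChange hy (embed 0 (g • G)) := by
  rw [← coordChange_inclS_smul hy hyr, inclS_smul_embed]

theorem generator_smul_coordChange_embed_zero (i : Fin d) (G : DP (Fin e) K) :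
    y (Sum.inl i) • coordChange hy (embed 0 G) = 0 := by
  classical
  rw [← coordChange_X_smul, X_inl_smul_embed, if_neg (by simp), map_zero]

include hyr in
/-- The sum of the annihilator of the cone and the ideal of the first elements of a system of
generators is an annihilator. -/
theorem mem_sup_iff_forall_smul_coordChange_eq_zero (hH : IndepTop b H)
    (f : MvPowerSeries (Fin d ⊕ Fin e) K) :
    f ∈ Ideal.span (Set.range fun i => y (Sum.inl i)) ⊔
        (Submodule.span (MvPowerSeries (Fin e) K) (Set.range H)).annihilator.map (inclS d) ↔
      ∀ j, f • coordChange hy (embed 0 (H j)) = 0 := by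
  have hle : ∀ f ∈ Ideal.span (Set.range fun i => y (Sum.inl i)) ⊔
      (Submodule.span (MvPowerSeries (Fin e) K) (Set.range H)).annihilator.map (inclS d),
      ∀ j, f • coordChange hy (embed 0 (H j)) = 0 := by
    suffices h : Ideal.span (Set.range fun i => y (Sum.inl i)) ⊔
        (Submodule.span (MvPowerSeries (Fin e) K) (Set.range H)).annihilator.map (inclS d) ≤
        (Submodule.span (MvPowerSeries (Fin d ⊕ Fin e) K)
          (Set.range fun j => coordChange hy (embed 0 (H j)))).annihilator from
      fun f hf => mem_annihilator_span_range_iff.1 (h hf)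
    refine sup_le (Ideal.span_le.2 ?_) (Ideal.map_le_iff_le_comap.2 fun g hg => ?_)
    · rintro _ ⟨i, rfl⟩
      exact mem_annihilator_span_range_iff.2 fun j => generator_smul_coordChange_embed_zero hy i _
    · refine mem_annihilator_span_range_iff.2 fun j => ?_
      rw [smul_coordChange_embed_zero hy hyr, mem_annihilator_span_range_iff.1 hg,
        DP.embed_zero, map_zero]
  refine ⟨hle f, fun hf => ?_⟩
  obtain ⟨g, hg⟩ := exists_sub_inclS_mem hy hyr (b + 1) f
  -- The ideal absorbs the error in the `(b + 1)`-st power, so `f` and `g` agree modulo it; then `g`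
  -- kills the `H^j` because `f` kills their images.
  have hg' := sup_le le_sup_left ((maxIdealS_pow_succ_le hy hyr hH).trans
    (sup_le_sup Ideal.mul_le_left le_rfl)) hg
  have h1 : inclS d g ∈
      (Submodule.span (MvPowerSeries (Fin e) K) (Set.range H)).annihilator.map (inclS d) := by
    refine Ideal.mem_map_of_mem _ (mem_annihilator_span_range_iff.2 fun j => ?_)
    have h2 := hle _ hg' j
    rw [sub_smul, hf, zero_sub, neg_eq_zero, smul_coordChange_embed_zero hy hyr,
      LinearEquiv.map_eq_zero_iff] at h2
    have h3 := slice_embed (0 : Fin d →₀ ℕ) 0 (g • H j)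
    rwa [h2, map_zero, if_pos rfl, eq_comm] at h3
  have := add_mem hg' (Ideal.mem_sup_right h1)
  rwa [sub_add_cancel] at this

/-! ### Minimal reductions -/

/-- The divided power of a linear form in the first variables. -/
theorem exists_dividedPower (c : Fin d → K) : ∃ L : ℕ → DP (Fin d ⊕ Fin e) K,
    (∀ k, L k ∈ degLT _ K (k + 1)) ∧ L 0 ≠ 0 ∧
    (∀ k i, (MvPowerSeries.X (Sum.inl i) : MvPowerSeries (Fin d ⊕ Fin e) K) • L (k + 1) =
      c i • L k) ∧
    ∀ k t, (MvPowerSeries.X (Sum.inr t) : MvPowerSeries (Fin d ⊕ Fin e) K) • L k = 0 := by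
  classical
  -- The divided power of `∑ c_i X_i` has the coefficients `∏ c_i^(m_i)` without multinomial
  -- factors, which works in every characteristic.
  let a (k : ℕ) (m : Fin d ⊕ Fin e →₀ ℕ) : K :=
    if m.degree = k ∧ ∀ t, m (Sum.inr t) = 0 then ∏ i, c i ^ m (Sum.inl i) else 0
  have hex (k : ℕ) : ∃ L : DP (Fin d ⊕ Fin e) K, ∀ m, coeff m L = a k m := by
    refine ⟨Finsupp.onFinset (Finsupp.finite_of_degree_le k).toFinset (a k) fun m hm => ?_,
      fun m => rfl⟩
    rw [Set.Finite.mem_toFinset]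
    by_contra h
    refine hm (if_neg fun h' => h h'.1.le)
  choose L hL using hex
  refine ⟨L, fun k m hm => ?_, fun h => ?_, fun k i => ?_, fun k t => ?_⟩
  · rw [hL]
    exact if_neg fun h => by omega
  · have := hL 0 0
    rw [h, coeff_zero] at this
    simp [a] at this
  · ext m
    rw [coeff_X_smul, coeff_smul, hL, hL]
    have hdeg : (m + Finsupp.single (Sum.inl i) 1).degree = k + 1 ↔ m.degree = k := by
      rw [map_add, Finsupp.degree_single, add_left_inj]
    have hr : (∀ t : Fin e, (m + Finsupp.single (Sum.inl i) 1 : Fin d ⊕ Fin e →₀ ℕ) (Sum.inr t) = 0) ↔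
        ∀ t : Fin e, m (Sum.inr t) = 0 := by simp
    simp only [a, hdeg, hr]
    split_ifs with h
    · have h2 (t : Fin d) : c t ^ (m + Finsupp.single (Sum.inl i) 1 : Fin d ⊕ Fin e →₀ ℕ) (Sum.inl t) =
          c t ^ m (Sum.inl t) * if t = i then c t else 1 := by
        rw [Finsupp.add_apply, pow_add]
        congr 1
        by_cases hti : t = i
        · subst hti; simp
        · simp [hti]
      simp only [h2, Finset.prod_mul_distrib, Finset.prod_ite_eq', Finset.mem_univ, if_true]
      ring
    · rw [mul_zero]
  · ext m
    rw [coeff_X_smul, hL, coeff_zero]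
    refine if_neg fun h => ?_
    have := h.2 t
    simp at this

include hy hyr in
/-- A reduction that is contained in the ideal of the first elements of a system of generators is
equal to that ideal. -/
theorem generator_mem_of_reduction {I J' : Ideal (MvPowerSeries (Fin d ⊕ Fin e) K)}
    (hI : I ≤ (maxIdealS (Fin e) K).map (inclS d)) (hIJ : I ≤ J')
    (hJ' : J' ≤ Ideal.span (Set.range fun i => y (Sum.inl i)) ⊔ I) {k : ℕ}
    (hk : maxIdealS (Fin d ⊕ Fin e) K ^ (k + 1) ≤
      J' * maxIdealS (Fin d ⊕ Fin e) K ^ k ⊔ I) (i : Fin d) : y (Sum.inl i) ∈ J' := by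
  classical
  -- `V` is the space of linear parts, with respect to the first `d` generators, of elements of
  -- `J'`.
  let V : Submodule K (Fin d → K) :=
    { carrier := {v | ∃ r : Fin d → MvPowerSeries (Fin d ⊕ Fin e) K,
        (∀ i, MvPowerSeries.constantCoeff (r i) = v i) ∧ ∑ i, r i * y (Sum.inl i) ∈ J'}
      add_mem' := by
        rintro v v' ⟨r, hr, hr'⟩ ⟨s, hs, hs'⟩
        refine ⟨r + s, fun i => by simp [hr, hs], ?_⟩
        simp only [Pi.add_apply, add_mul, Finset.sum_add_distrib]
        exact add_mem hr' hs'
      zero_mem' := ⟨0, fun i => by simp, by simp⟩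
      smul_mem' := by
        rintro c v ⟨r, hr, hr'⟩
        refine ⟨fun i => MvPowerSeries.C c * r i, fun i => by simp [hr], ?_⟩
        simp only [mul_assoc, ← Finset.mul_sum]
        exact Ideal.mul_mem_left _ _ hr' }
  by_cases hV : V = ⊤
  -- If all unit vectors are linear parts, the matrix of coefficients is the identity modulo the
  -- maximal ideal, hence invertible.
  · have hex (i : Fin d) : (Pi.single i 1 : Fin d → K) ∈ V := hV ▸ Submodule.mem_top
    choose r hr hr' using hex
    refine mem_of_matrix_mul_mem (M := Matrix.of r) ?_ (z := fun i => y (Sum.inl i)) hr' i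
    rw [MvPowerSeries.isUnit_iff_constantCoeff, RingHom.map_det]
    have : (MvPowerSeries.constantCoeff (σ := Fin d ⊕ Fin e) (R := K)).mapMatrix (Matrix.of r) =
        1 := by
      ext i j
      simp [hr, Matrix.one_apply, Pi.single_apply, eq_comm]
    rw [this, Matrix.det_one]
    exact isUnit_one
  · exfalso
    -- Otherwise a nonzero `l` vanishes on `V`. With `L n` the divided powers of the linear form
    -- with coefficients `l(e_i)`, the `i`-th generator takes the transported `L (n + 1)` to
    -- `l(e_i)` times the transported `L n`.
    obtain ⟨l, hl0, hl⟩ := Submodule.exists_le_ker_of_lt_top V (lt_top_iff_ne_top.2 hV)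
    obtain ⟨L, hLdeg, hL0, hLl, hLr⟩ := exists_dividedPower (e := e) fun i => l (Pi.single i 1)
    have hsum (v : Fin d → K) : ∑ i, v i * l (Pi.single i 1) = l v := by
      conv_rhs => rw [pi_eq_sum_univ' v, map_sum]
      simp only [map_smul, smul_eq_mul]
    have hkill : ∀ f ∈ I, ∀ n, f • coordChange hy (L n) = 0 := by
      intro f hf n
      have h1 : (maxIdealS (Fin e) K).map (inclS d) ≤ (Submodule.span
          (MvPowerSeries (Fin d ⊕ Fin e) K) {coordChange hy (L n)}).annihilator := by
        rw [maxIdealS, Ideal.map_span, Ideal.span_le]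
        rintro _ ⟨_, ⟨t, rfl⟩, rfl⟩
        rw [SetLike.mem_coe, Submodule.mem_annihilator_span_singleton, MvPowerSeries.rename_X,
          ← hyr, ← coordChange_X_smul, hLr, map_zero]
      exact (Submodule.mem_annihilator_span_singleton _ _).1 (h1 (hI hf))
    have hstep (n : ℕ) (i : Fin d) : y (Sum.inl i) • coordChange hy (L (n + 1)) =
        l (Pi.single i 1) • coordChange hy (L n) := by
      rw [← coordChange_X_smul, hLl, map_smul]
    -- Because `l` vanishes on the linear parts, elements of `J'` lower the degree bound `k + 1` by
    -- at least two. So `J' 𝔪^k`, and with it `𝔪^(k+1)`, kills this divided power; but a generator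
    -- with `l(e_i) ≠ 0`, raised to the power `k + 1`, takes it to a nonzero multiple of the
    -- transported `L 0`.
    have hdrop : ∀ f ∈ J', f • coordChange hy (L (k + 1)) ∈ degLT _ K k := by
      intro f hf
      obtain ⟨a, ha, c, hc, hac⟩ := Submodule.mem_sup.1 (hJ' hf)
      obtain ⟨r, hr⟩ := (Ideal.mem_span_range_iff_exists_fun).1 ha
      have hv : (fun i => MvPowerSeries.constantCoeff (r i)) ∈ V := by
        refine ⟨r, fun i => rfl, ?_⟩
        rw [hr, eq_sub_of_add_eq hac]
        exact sub_mem hf (hIJ hc)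
      have h1 : f • coordChange hy (L (k + 1)) =
          (∑ i, l (Pi.single i 1) • r i) • coordChange hy (L k) := by
        rw [← hac, add_smul, hkill c hc, add_zero, ← hr, Finset.sum_smul, Finset.sum_smul]
        refine Finset.sum_congr rfl fun i _ => ?_
        rw [mul_smul, hstep, smul_comm, smul_assoc]
      rw [h1]
      refine smul_mem_degLT_of_constantCoeff_eq_zero ?_
        ((coordChange_mem_degLT hy).2 (hLdeg k))
      rw [map_sum, ← LinearMap.mem_ker.1 (hl hv), ← hsum]
      refine Finset.sum_congr rfl fun i _ => ?_
      rw [MvPowerSeries.smul_eq_C_mul, map_mul, MvPowerSeries.constantCoeff_C, mul_comm]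
    have hzero : ∀ f ∈ maxIdealS (Fin d ⊕ Fin e) K ^ (k + 1),
        f • coordChange hy (L (k + 1)) = 0 := by
      intro f hf
      obtain ⟨a, ha, c, hc, rfl⟩ := Submodule.mem_sup.1 (hk hf)
      rw [add_smul, hkill c hc, add_zero]
      clear hf
      induction ha using Submodule.mul_induction_on' with
      | mem_mul_mem a ha b hb =>
        rw [mul_comm, mul_smul]
        exact smul_eq_zero_of_mem_pow hb (hdrop a ha)
      | add a _ b _ h1 h2 => rw [add_smul, h1, h2, add_zero]
    have hl1 : ∃ i, l (Pi.single i 1) ≠ 0 := by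
      by_contra! h
      refine hl0 (LinearMap.ext fun v => ?_)
      rw [← hsum]
      simp [h]
    obtain ⟨i, hi⟩ := hl1
    have hpow (n : ℕ) : y (Sum.inl i) ^ n • coordChange hy (L n) =
        l (Pi.single i 1) ^ n • coordChange hy (L 0) := by
      induction n with
      | zero => simp
      | succ n ih => rw [pow_succ, mul_smul, hstep, smul_comm, ih, ← mul_smul, ← pow_succ']
    have hyi : y (Sum.inl i) ∈ maxIdealS (Fin d ⊕ Fin e) K := by
      rw [← hy]
      exact Ideal.subset_span ⟨_, rfl⟩
    have h1 := hzero _ (Ideal.pow_mem_pow hyi (k + 1))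
    rw [hpow] at h1
    rcases smul_eq_zero.1 h1 with h | h
    · exact hi (eq_zero_of_pow_eq_zero h)
    · exact hL0 ((LinearEquiv.map_eq_zero_iff _).1 h)

end Coordinates

end Cone

/-! ### General elements -/

/-- Over an infinite field the product of two nonzero polynomials has a point where it does not
vanish, which gives density; the zero `v` of `p` makes the open set proper. -/
theorem isProperDenseOpen_of_polynomial {ι : Type} {K : Type u} [Field K] [Infinite K]
    {p : MvPolynomial ι K} (hp : p ≠ 0) {v : ι → K} (hv : MvPolynomial.eval v p = 0) :
    IsProperDenseOpen {x | MvPolynomial.eval x p ≠ 0} := by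
  refine ⟨fun h => ?_, ⟨Ideal.span {p}, ?_⟩, ?_⟩
  · have h1 : v ∈ {x | MvPolynomial.eval x p ≠ 0} := h ▸ Set.mem_univ v
    exact h1 hv
  · ext x
    constructor
    · exact fun h => ⟨p, Ideal.mem_span_singleton_self p, h⟩
    · rintro ⟨q, hq, hqx⟩ h
      obtain ⟨r, rfl⟩ := Ideal.mem_span_singleton.1 hq
      rw [map_mul, h, zero_mul] at hqx
      exact hqx rfl
  · rintro V ⟨I, rfl⟩ ⟨x, q, hq, hqx⟩
    have hq0 : q ≠ 0 := by
      rintro rfl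
      exact hqx (map_zero _)
    by_contra h
    refine mul_ne_zero hp hq0 (MvPolynomial.funext fun y => ?_)
    rw [map_zero, map_mul]
    by_contra hy
    exact h ⟨y, left_ne_zero_of_mul hy, q, hq, right_ne_zero_of_mul hy⟩

/-! ### Sequences whose coefficients at the first variables form an invertible matrix -/

section Block

variable {d e : ℕ} {K : Type u} [Field K]

/-- The matrix of the coefficients of the first `d` variables. -/
def leftBlock {R : Type*} (v : Fin d × (Fin d ⊕ Fin e) → R) : Matrix (Fin d) (Fin d) R :=
  Matrix.of fun i j => v (i, Sum.inl j)

theorem isGeneral_X [Infinite K] (hd : 0 < d)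
    {Q : (Fin d → MvPowerSeries (Fin d ⊕ Fin e) K) → Prop}
    (hQ : ∀ a : Fin d → Fin d ⊕ Fin e → MvPowerSeries (Fin d ⊕ Fin e) K,
      (leftBlock (residues a)).det ≠ 0 → Q (linearCombs a)) :
    IsGeneral Q fun i => MvPowerSeries.X (Sum.inl i) := by
  classical
  have heval (v : Fin d × (Fin d ⊕ Fin e) → K) :
      MvPolynomial.eval v (leftBlock (d := d) (e := e) MvPolynomial.X).det =
        (leftBlock v).det := by
    rw [RingHom.map_det]
    congr 1
    ext i j
    simp [leftBlock]
  have hone : (leftBlock (residues fun (i : Fin d) (t : Fin d ⊕ Fin e) =>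
      (Pi.single (Sum.inl i) 1 : _ → MvPowerSeries (Fin d ⊕ Fin e) K) t)).det ≠ 0 := by
    have h : leftBlock (residues fun (i : Fin d) (t : Fin d ⊕ Fin e) =>
        (Pi.single (Sum.inl i) 1 : _ → MvPowerSeries (Fin d ⊕ Fin e) K) t) = 1 := by
      ext i j
      simp [leftBlock, residues, Matrix.one_apply, Pi.single_apply, apply_ite, eq_comm]
    rw [h, Matrix.det_one]
    exact one_ne_zero
  refine ⟨{v | MvPolynomial.eval v (leftBlock (d := d) (e := e) MvPolynomial.X).det ≠ 0},
    isProperDenseOpen_of_polynomial (v := 0) (fun h => ?_) ?_,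
    ⟨fun i => Pi.single (Sum.inl i) 1, ?_, ?_⟩, fun a ha => hQ a ?_⟩
  · have := heval (residues fun (i : Fin d) (t : Fin d ⊕ Fin e) =>
      (Pi.single (Sum.inl i) 1 : _ → MvPowerSeries (Fin d ⊕ Fin e) K) t)
    rw [h, map_zero] at this
    exact hone this.symm
  -- Properness needs `d > 0`: the empty determinant is `1` and vanishes nowhere.
  · have : Nonempty (Fin d) := ⟨⟨0, hd⟩⟩
    rw [heval]
    exact Matrix.det_zero
  · change MvPolynomial.eval _ _ ≠ 0
    rwa [heval]
  · funext i
    simp [linearCombs, Pi.single_apply]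
  · rwa [← heval]

variable {a : Fin d → Fin d ⊕ Fin e → MvPowerSeries (Fin d ⊕ Fin e) K}

/-- Modulo the last variables the sequence is a matrix times `x_1, …, x_d`, and this matrix is
invertible over the series because its determinant has a nonzero constant term. -/
theorem span_range_linearCombs (ha : (leftBlock (residues a)).det ≠ 0) :
    Ideal.span (Set.range (Sum.elim (linearCombs a) fun t => MvPowerSeries.X (Sum.inr t))) =
      maxIdealS (Fin d ⊕ Fin e) K := by
  apply le_antisymm
  · rw [Ideal.span_le]
    rintro _ ⟨s | t, rfl⟩
    · change ∑ t, a s t * MvPowerSeries.X t ∈ maxIdealS (Fin d ⊕ Fin e) K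
      exact sum_mem fun t _ => Ideal.mul_mem_left (maxIdealS _ K) (a s t)
        (Ideal.subset_span (Set.mem_range_self t))
    · exact Ideal.subset_span ⟨_, rfl⟩
  · have hr (t : Fin e) : MvPowerSeries.X (Sum.inr t) ∈ Ideal.span
        (Set.range (Sum.elim (linearCombs a) fun t => MvPowerSeries.X (Sum.inr t))) :=
      Ideal.subset_span ⟨Sum.inr t, rfl⟩
    rw [maxIdealS, Ideal.span_le]
    rintro _ ⟨s | t, rfl⟩
    · refine mem_of_matrix_mul_mem (M := Matrix.of fun i j => a i (Sum.inl j)) ?_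
        (z := fun i => MvPowerSeries.X (Sum.inl i)) (fun i => ?_) s
      · rw [MvPowerSeries.isUnit_iff_constantCoeff, RingHom.map_det, isUnit_iff_ne_zero]
        exact ha
      · have h : ∑ j, a i (Sum.inl j) * MvPowerSeries.X (Sum.inl j) =
            linearCombs a i - ∑ t, a i (Sum.inr t) * MvPowerSeries.X (Sum.inr t) := by
          rw [linearCombs, Fintype.sum_sum_type, add_sub_cancel_right]
        change ∑ j, a i (Sum.inl j) * MvPowerSeries.X (Sum.inl j) ∈ _
        rw [h]
        exact sub_mem (Ideal.subset_span ⟨Sum.inl i, rfl⟩)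
          (sum_mem fun t _ => Ideal.mul_mem_left _ _ (hr t))
    · exact hr t

end Block

/-! ### The local case -/

section Local

variable {d e τ b : ℕ} {K : Type u} [Field K] {H : Fin τ → DP (Fin e) K}

theorem isLocalAdmissibleWrt_X [Infinite K] (hd : 0 < d) (hH : IndepTop b H)
    {W : Submodule (MvPowerSeries (Fin d ⊕ Fin e) K) (DP (Fin d ⊕ Fin e) K)}
    (hW : W = Submodule.span (MvPowerSeries (Fin d ⊕ Fin e) K)
      {F | ∃ (n : Fin d → ℕ) (j : Fin τ), (∀ i, 0 < n i) ∧ F = coneTerm n (H j)}) :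
    IsLocalAdmissibleWrt (fun i => MvPowerSeries.X (Sum.inl i))
      (fun n j => coneTerm n (H j)) W := by
  have hmem {y : Fin d ⊕ Fin e → MvPowerSeries (Fin d ⊕ Fin e) K}
      (hy : Ideal.span (Set.range y) = maxIdealS (Fin d ⊕ Fin e) K) (s : Fin d ⊕ Fin e) :
      y s ∈ (maxIdealS (Fin d ⊕ Fin e) K : Set (MvPowerSeries (Fin d ⊕ Fin e) K)) := by
    rw [← hy]
    exact Ideal.subset_span ⟨s, rfl⟩
  constructor
  · have h := isAdmissibleSystem_coordChange isSeriesRing_id hH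
      (z := (MvPowerSeries.X : Fin d ⊕ Fin e → MvPowerSeries (Fin d ⊕ Fin e) K)) rfl
      (fun t => rfl) rfl (hmem rfl) hW
    -- For the variables themselves the change of coordinates is the identity, and the transported
    -- system is the cone system.
    have h1 (n : Fin d → ℕ) (j : Fin τ) := coordChange_X rfl (coneTerm n (H j))
    simp only [RingHom.id_apply, h1] at h
    exact h
  · refine isGeneral_X hd fun a ha => ⟨_, isAdmissibleSystem_coordChange isSeriesRing_id hH
      (z := Sum.elim (linearCombs a) fun t => MvPowerSeries.X (Sum.inr t))
      (span_range_linearCombs ha) (fun t => rfl) (span_range_linearCombs ha)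
      (hmem (span_range_linearCombs ha)) hW⟩

theorem ofList_ofFn {A : Type*} [CommRing A] (y : Fin d → A) :
    Ideal.ofList (List.ofFn y) = Ideal.span (Set.range y) := by
  unfold Ideal.ofList
  congr 1
  ext r
  exact List.mem_ofFn' _ _

/-- The first `d` variables form a regular sequence, and modulo them `A` is the quotient by the
annihilator of `τ` elements with independent leading forms. The argument covers the local and the
graded ring at once. -/
theorem IsSeriesRing.hasType {R A : Type u} [CommRing R] [Module R (DP (Fin d ⊕ Fin e) K)]
    [CommRing A] {ι : R →+* MvPowerSeries (Fin d ⊕ Fin e) K} (hι : IsSeriesRing ι) {π : R →+* A}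
    (hτ : 0 < τ) (hH : IndepTop b H) (hπ : Function.Surjective π)
    (hker : ∀ f, π f = 0 ↔ ∀ p, seriesSlice p (ι f) ∈
      (Submodule.span (MvPowerSeries (Fin e) K) (Set.range H)).annihilator) {x : Fin d → R}
    (hx : ∀ i, ι (x i) = MvPowerSeries.X (Sum.inl i)) {𝔪 : Ideal A}
    (h𝔪 : ∀ f, π f ∈ 𝔪 ↔ MvPowerSeries.constantCoeff (ι f) = 0) : HasType A 𝔪 d τ := by
  have hmem : ∀ r ∈ List.ofFn fun i => π (x i), r ∈ 𝔪 := by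
    intro r hr
    obtain ⟨i, rfl⟩ := (List.mem_ofFn' _ _).1 hr
    rw [h𝔪, hx, MvPowerSeries.constantCoeff_X]
  have h := hasType_of_isRegular hι (hH.embed_zero (d := d)) hπ h𝔪
    (hι.isRegular hπ hker (annihilator_span_range_ne_top hτ hH) hx) hmem fun f => by
      rw [← seriesSlice_zero_mem_annihilator_iff, ← hι.mem_span_range_iff hπ hker hx, ofList_ofFn]
  rwa [List.length_ofFn] at h

section Quotient

variable {I : Ideal (MvPowerSeries (Fin d ⊕ Fin e) K)}
  (hI : I = (Submodule.span (MvPowerSeries (Fin e) K) (Set.range H)).annihilator.map (inclS d))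
  {y : Fin d ⊕ Fin e → MvPowerSeries (Fin d ⊕ Fin e) K}
  (hy : Ideal.span (Set.range y) = maxIdealS (Fin d ⊕ Fin e) K)
  (hyr : ∀ t, y (Sum.inr t) = MvPowerSeries.X (Sum.inr t))

include hI in
theorem mk_eq_zero_iff_seriesSlice_mem (f : MvPowerSeries (Fin d ⊕ Fin e) K) :
    Ideal.Quotient.mk I f = 0 ↔ ∀ p, seriesSlice p (RingHom.id _ f) ∈
      (Submodule.span (MvPowerSeries (Fin e) K) (Set.range H)).annihilator := by
  rw [Ideal.Quotient.eq_zero_iff_mem, hI, ← annihilator_span_coneTerm_eq_map,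
    mem_annihilator_span_coneTerm_iff]
  rfl

include hI in
theorem map_annihilator_le_maxIdealS (hτ : 0 < τ) (hH : IndepTop b H) :
    I ≤ maxIdealS (Fin d ⊕ Fin e) K := by
  rw [hI, maxIdealS_eq_sup (d := d) (y := MvPowerSeries.X) rfl fun t => rfl]
  exact (Ideal.map_mono (annihilator_span_range_le hτ hH)).trans le_sup_right

omit hI in
theorem span_range_mk (i : Ideal (MvPowerSeries (Fin d ⊕ Fin e) K)) :
    Ideal.span (Set.range fun s => Ideal.Quotient.mk i (y (Sum.inl s))) =
      (Ideal.span (Set.range fun s => y (Sum.inl s))).map (Ideal.Quotient.mk i) := by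
  rw [Ideal.map_span, ← Set.range_comp]
  rfl

include hI hy hyr in
theorem isArtinianLevel_quotient (hτ : 0 < τ) (hH : IndepTop b H) :
    IsArtinianLevel
      ((MvPowerSeries (Fin d ⊕ Fin e) K ⧸ I) ⧸
        Ideal.span (Set.range fun i => Ideal.Quotient.mk I (y (Sum.inl i))))
      (((maxIdealS (Fin d ⊕ Fin e) K).map (Ideal.Quotient.mk I)).map (Ideal.Quotient.mk _)) := by
  rw [Ideal.map_map]
  refine isArtinianLevel_of_indepTop hτ (hH.embed_zero.coordChange hy)
    (Ideal.Quotient.mk_surjective.comp Ideal.Quotient.mk_surjective) fun f => ?_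
  rw [← mem_sup_iff_forall_smul_coordChange_eq_zero hy hyr hH, RingHom.comp_apply,
    Ideal.Quotient.eq_zero_iff_mem, ← hI, ← Ideal.mem_quotient_iff_mem_sup, span_range_mk]

include hI hy hyr in
-- The exponent `b` works in the reduction equation. A smaller reduction is pulled back to the power
-- series ring, where it must contain all generators by `generator_mem_of_reduction`.
theorem minimal_isReduction (hτ : 0 < τ) (hH : IndepTop b H) :
    Minimal (IsReduction ((maxIdealS (Fin d ⊕ Fin e) K).map (Ideal.Quotient.mk I)))
      (Ideal.span (Set.range fun i => Ideal.Quotient.mk I (y (Sum.inl i)))) := by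
  have hsurj : Function.Surjective (Ideal.Quotient.mk I) := Ideal.Quotient.mk_surjective
  have hJ𝔪 : Ideal.span (Set.range fun i => y (Sum.inl i)) ≤ maxIdealS (Fin d ⊕ Fin e) K := by
    rw [← hy]
    exact Ideal.span_mono (Set.range_subset_iff.2 fun i => ⟨_, rfl⟩)
  rw [span_range_mk]
  refine ⟨⟨Ideal.map_mono hJ𝔪, b, le_antisymm ?_ ?_⟩, fun J' ⟨_, k, hk⟩ hJ'J => ?_⟩
  · have h := Ideal.map_mono (f := Ideal.Quotient.mk I) (maxIdealS_pow_succ_le hy hyr hH)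
    rwa [Ideal.map_sup, ← hI, Ideal.map_quotient_self, sup_bot_eq, Ideal.map_mul, Ideal.map_pow,
      Ideal.map_pow] at h
  · rw [pow_succ']
    exact Ideal.mul_mono_left (Ideal.map_mono hJ𝔪)
  · rw [Ideal.map_le_iff_le_comap, Ideal.span_le]
    rintro _ ⟨i, rfl⟩
    have hcomap : (J'.comap (Ideal.Quotient.mk I)).map (Ideal.Quotient.mk I) = J' :=
      Ideal.map_comap_of_surjective _ hsurj _
    refine generator_mem_of_reduction hy hyr
      (hI.le.trans (Ideal.map_mono (annihilator_span_range_le hτ hH))) ?_ (fun f hf => ?_) (k := k)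
      (fun f hf => ?_) i
    · intro f hf
      rw [Ideal.mem_comap, Ideal.Quotient.eq_zero_iff_mem.2 hf]
      exact zero_mem _
    · exact Ideal.mem_quotient_iff_mem_sup.1 (hJ'J hf)
    · rw [← Ideal.mem_quotient_iff_mem_sup, Ideal.map_mul, hcomap, Ideal.map_pow, ← hk,
        ← Ideal.map_pow]
      exact Ideal.mem_map_of_mem _ hf

include hI in
theorem isCohenMacaulayOfDim_quotient (hτ : 0 < τ) (hH : IndepTop b H) :
    IsCohenMacaulayOfDim (MvPowerSeries (Fin d ⊕ Fin e) K ⧸ I)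
      ((maxIdealS (Fin d ⊕ Fin e) K).map (Ideal.Quotient.mk I)) d := by
  have hI𝔪 := map_annihilator_le_maxIdealS hI hτ hH
  have hsurj : Function.Surjective (Ideal.Quotient.mk I) := Ideal.Quotient.mk_surjective
  have hreg := isSeriesRing_id.isRegular hsurj (mk_eq_zero_iff_seriesSlice_mem hI)
    (annihilator_span_range_ne_top hτ hH) (x := fun i => MvPowerSeries.X (Sum.inl i)) fun i => rfl
  have hI1 : I ≠ ⊤ := fun h => (Ideal.IsMaximal.ne_top inferInstance) (top_le_iff.1 (h ▸ hI𝔪))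
  have : Nontrivial (MvPowerSeries (Fin d ⊕ Fin e) K ⧸ I) := Ideal.Quotient.nontrivial_iff.2 hI1
  have : IsLocalRing (MvPowerSeries (Fin d ⊕ Fin e) K ⧸ I) := .of_surjective' _ hsurj
  refine ⟨inferInstance, Ideal.IsMaximal.map_of_surjective_of_ker_le hsurj (by rwa [Ideal.mk_ker]),
    ?_, List.ofFn fun i => Ideal.Quotient.mk I (MvPowerSeries.X (Sum.inl i)), List.length_ofFn,
    ?_, hreg⟩
  -- In the Noetherian local ring each member of the regular sequence lowers the dimension by one,
  -- and a nonzero Artinian ring remains.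
  · have h := ringKrullDim_add_length_eq_ringKrullDim_of_isRegular _ hreg
    obtain ⟨hart, s, hs, -⟩ := isArtinianLevel_quotient hI
      (y := (MvPowerSeries.X : Fin d ⊕ Fin e → MvPowerSeries (Fin d ⊕ Fin e) K)) rfl
      (fun _ => rfl) hτ hH
    rw [← ofList_ofFn] at hart
    have : Nontrivial ((MvPowerSeries (Fin d ⊕ Fin e) K ⧸ I) ⧸ Ideal.ofList (List.ofFn fun i =>
        Ideal.Quotient.mk I (MvPowerSeries.X (Sum.inl i)))) := by
      rw [ofList_ofFn]
      refine not_subsingleton_iff_nontrivial.1 fun h1 => hs (Subsingleton.elim _ _)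
    rw [← h, List.length_ofFn, ringKrullDimZero_iff_ringKrullDim_eq_zero.1 inferInstance, zero_add]
  · intro r hr
    obtain ⟨i, rfl⟩ := (List.mem_ofFn' _ _).1 hr
    exact Ideal.mem_map_of_mem _ (Ideal.subset_span ⟨_, rfl⟩)

include hI in
theorem isLocalLevel_of_eq_map [Infinite K] (hd : 0 < d) (hτ : 0 < τ) (hH : IndepTop b H) :
    IsLocalLevel I d τ := by
  refine ⟨isCohenMacaulayOfDim_quotient hI hτ hH, ?_, _, isGeneral_X hd fun a ha => ?_⟩
  · refine isSeriesRing_id.hasType hτ hH Ideal.Quotient.mk_surjective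
      (mk_eq_zero_iff_seriesSlice_mem hI) (fun i => rfl) fun f => ?_
    rw [Ideal.mem_quotient_iff_mem (map_annihilator_le_maxIdealS hI hτ hH), mem_maxIdealS_iff]
    rfl
  · have h1 := minimal_isReduction hI (span_range_linearCombs ha) (fun _ => rfl) hτ hH
    have h2 := isArtinianLevel_quotient hI (span_range_linearCombs ha) (fun _ => rfl) hτ hH
    simp only [Sum.elim_inl] at h1 h2
    exact And.intro h1 h2

end Quotient

end Local

/-! ### Homogeneity -/

section Homogeneous

variable {σ : Type} {K : Type u} [Field K]

theorem mem_maxIdealP_iff {f : MvPolynomial σ K} :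
    f ∈ maxIdealP σ K ↔ MvPolynomial.constantCoeff f = 0 := by
  rw [maxIdealP]
  constructor
  · intro h
    have h1 : Ideal.span (Set.range MvPolynomial.X) ≤
        RingHom.ker (MvPolynomial.constantCoeff (σ := σ) (R := K)) := by
      rw [Ideal.span_le]
      rintro _ ⟨s, rfl⟩
      exact MvPolynomial.constantCoeff_X _ s
    exact h1 h
  · intro h
    rw [← Set.image_univ, MvPolynomial.mem_ideal_span_X_image]
    intro m hm
    have hm0 : m ≠ 0 := by
      rintro rfl
      exact MvPolynomial.mem_support_iff.1 hm h
    obtain ⟨i, hi⟩ := Finsupp.ne_iff.1 hm0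
    exact ⟨i, Set.mem_univ i, hi⟩

theorem isHomogeneous_iff {s : ℕ} {F : DP σ K} :
    DP.IsHomogeneous s F ↔ ∀ k, coeff k F ≠ 0 → k.degree = s :=
  forall_congr' fun _ => imp_congr_left mem_exponents

/-- On an element of degree `s` the component of `f` of degree `i` produces exactly the terms of
degree `s - i`. Hence annihilators of homogeneous elements are homogeneous. -/
theorem coeff_homogeneousComponent_smul {s : ℕ} {F : DP σ K} (hF : DP.IsHomogeneous s F)
    (f : MvPolynomial σ K) (i : ℕ) (k : σ →₀ ℕ) :
    coeff k (MvPolynomial.homogeneousComponent i f • F) =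
      if i + k.degree = s then coeff k (f • F) else 0 := by
  classical
  rw [polynomial_smul, polynomial_smul, coeff_series_smul, coeff_series_smul]
  have h (l : σ →₀ ℕ) (hl : l ∈ F.exponents) : (if k ≤ l then MvPowerSeries.coeff (l - k)
      (MvPolynomial.homogeneousComponent i f : MvPowerSeries σ K) * coeff l F else 0) =
      if i + k.degree = s then
        (if k ≤ l then MvPowerSeries.coeff (l - k) (f : MvPowerSeries σ K) * coeff l F else 0)
      else 0 := by
    by_cases hkl : k ≤ l
    · have h1 : (l - k).degree + k.degree = s := by
        rw [← map_add, tsub_add_cancel_of_le hkl]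
        exact hF l hl
      rw [if_pos hkl, if_pos hkl, MvPolynomial.coeff_coe, MvPolynomial.coeff_homogeneousComponent,
        MvPolynomial.coeff_coe]
      by_cases h2 : (l - k).degree = i
      · rw [if_pos h2, if_pos (h2 ▸ h1)]
      · rw [if_neg h2, if_neg (by omega), zero_mul]
    · rw [if_neg hkl, if_neg hkl, ite_self]
  rw [Finset.sum_congr rfl h]
  split_ifs
  · rfl
  · exact Finset.sum_const_zero

attribute [local instance] MvPolynomial.gradedAlgebra

theorem isHomogeneous_annihilator_span {A : Set (DP σ K)}
    (hA : ∀ F ∈ A, ∃ s, DP.IsHomogeneous s F) :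
    ((Submodule.span (MvPolynomial σ K) A).annihilator).IsHomogeneous
      (MvPolynomial.homogeneousSubmodule σ K) := by
  intro i f hf
  have h : (DirectSum.decompose (MvPolynomial.homogeneousSubmodule σ K) f i : MvPolynomial σ K) =
      MvPolynomial.homogeneousComponent i f := MvPolynomial.decomposition.decompose'_apply f i
  rw [h]
  rw [Submodule.mem_annihilator_span] at hf ⊢
  rintro ⟨F, hFA⟩
  obtain ⟨s, hs⟩ := hA F hFA
  ext k
  rw [coeff_homogeneousComponent_smul hs, hf ⟨F, hFA⟩, coeff_zero, ite_self]

end Homogeneous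

/-! ### The graded case: admissibility, dimension and type -/

section Graded

variable {d e τ b : ℕ} {K : Type u} [Field K] {H : Fin τ → DP (Fin e) K}

theorem isHomogeneous_coneTerm {G : DP (Fin e) K} (hG : DP.IsHomogeneous b G) (n : Fin d → ℕ) :
    ∃ s, DP.IsHomogeneous s (coneTerm n G) := by
  classical
  refine ⟨(Finsupp.equivFunOnFinite.symm fun i => n i - 1 : Fin d →₀ ℕ).degree + b,
    isHomogeneous_iff.2 fun k hk => ?_⟩
  obtain ⟨p, q, rfl⟩ := exists_sumElim k
  rw [coneTerm_eq_embed, coeff_embed] at hk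
  split_ifs at hk with h
  · rw [degree_sumElim, h, isHomogeneous_iff.1 hG q hk]
  · exact absurd rfl hk

theorem ringHom_X_eq (σ : Type) : (fun s => MvPolynomial.coeToMvPowerSeries.ringHom (R := K)
    (MvPolynomial.X s)) = (MvPowerSeries.X : σ → MvPowerSeries σ K) :=
  funext fun s => MvPolynomial.coe_X s

theorem coordChange_eq_self {σ : Type} [Fintype σ] {y : σ → MvPowerSeries σ K}
    (hy : Ideal.span (Set.range y) = maxIdealS σ K) (h : y = MvPowerSeries.X) (F : DP σ K) :
    coordChange hy F = F := by
  subst h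
  exact coordChange_X hy F

theorem isGradedAdmissibleWrt_X (hH : IndepTop b H) (hhom : ∀ j, (H j).IsHomogeneous b)
    {W : Submodule (MvPolynomial (Fin d ⊕ Fin e) K) (DP (Fin d ⊕ Fin e) K)}
    (hW : W = Submodule.span (MvPolynomial (Fin d ⊕ Fin e) K)
      {F | ∃ (n : Fin d → ℕ) (j : Fin τ), (∀ i, 0 < n i) ∧ F = coneTerm n (H j)}) :
    IsGradedAdmissibleWrt (fun i => MvPolynomial.X (Sum.inl i))
      (fun n j => coneTerm n (H j)) W := by
  refine ⟨?_, fun n _ j => isHomogeneous_coneTerm (hhom j) n,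
    fun i => MvPolynomial.isHomogeneous_X _ _, ?_⟩
  · have hX : Ideal.span (Set.range fun s => MvPolynomial.coeToMvPowerSeries.ringHom (R := K)
        (MvPolynomial.X s)) = maxIdealS (Fin d ⊕ Fin e) K := by rw [ringHom_X_eq, maxIdealS]
    have h := isAdmissibleSystem_coordChange isSeriesRing_polynomial hH
      (z := (MvPolynomial.X : Fin d ⊕ Fin e → MvPolynomial (Fin d ⊕ Fin e) K)) hX
      (fun t => MvPolynomial.coe_X _) (𝔐 := maxIdealP (Fin d ⊕ Fin e) K) rfl
      (P := {f : MvPolynomial (Fin d ⊕ Fin e) K | f.IsHomogeneous 1})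
      (fun s => MvPolynomial.isHomogeneous_X _ _) hW
    simpa only [coordChange_eq_self hX (ringHom_X_eq _)] using h
  -- Regularity on the polynomial ring itself is the case of the identity map and the zero ideal.
  · refine isSeriesRing_polynomial.isRegular (π := RingHom.id _) (𝔠 := ⊥) Function.surjective_id
      (fun f => ?_) bot_ne_top fun i => MvPolynomial.coe_X _
    constructor
    · rintro h p
      rw [RingHom.id_apply] at h
      rw [h, map_zero, Ideal.mem_bot]
      ext q
      rw [coeff_seriesSlice, map_zero, map_zero]
    · intro h
      refine isSeriesRing_polynomial.injective (series_ext_slice fun p => ?_)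
      change seriesSlice p (MvPolynomial.coeToMvPowerSeries.ringHom f) = _
      rw [Ideal.mem_bot.1 (h p), map_zero]
      ext q
      rw [coeff_seriesSlice, map_zero, map_zero]

section Quotient

variable {I : Ideal (MvPolynomial (Fin d ⊕ Fin e) K)}
  (hI : I = (Submodule.span (MvPolynomial (Fin e) K) (Set.range H)).annihilator.map
    (MvPolynomial.rename (R := K) (Sum.inr : Fin e → Fin d ⊕ Fin e)))

include hI in
theorem mk_eq_zero_iff_seriesSlice_coe_mem (f : MvPolynomial (Fin d ⊕ Fin e) K) :
    Ideal.Quotient.mk I f = 0 ↔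
      ∀ p, seriesSlice p (MvPolynomial.coeToMvPowerSeries.ringHom f) ∈
        (Submodule.span (MvPowerSeries (Fin e) K) (Set.range H)).annihilator := by
  rw [Ideal.Quotient.eq_zero_iff_mem, hI, ← annihilator_span_coneTerm_eq_map_polynomial,
    isSeriesRing_polynomial.mem_annihilator_span_iff, mem_annihilator_span_coneTerm_iff]

include hI in
theorem map_annihilator_le_maxIdealP (hτ : 0 < τ) (hH : IndepTop b H) :
    I ≤ maxIdealP (Fin d ⊕ Fin e) K := by
  intro f hf
  have h := annihilator_span_range_le hτ hH ((mk_eq_zero_iff_seriesSlice_coe_mem hI f).1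
    (Ideal.Quotient.eq_zero_iff_mem.2 hf) 0)
  rw [mem_maxIdealS_iff, ← MvPowerSeries.coeff_zero_eq_constantCoeff_apply, coeff_seriesSlice,
    sumElim_zero_zero] at h
  rwa [mem_maxIdealP_iff]

include hI in
theorem X_inr_pow_mem (hH : IndepTop b H) (t : Fin e) :
    (MvPolynomial.X (Sum.inr t) : MvPolynomial (Fin d ⊕ Fin e) K) ^ (b + 1) ∈ I := by
  have h : (MvPolynomial.X t : MvPolynomial (Fin e) K) ^ (b + 1) ∈
      (Submodule.span (MvPolynomial (Fin e) K) (Set.range H)).annihilator := by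
    rw [isSeriesRing_polynomial.mem_annihilator_span_iff, map_pow]
    refine maxIdealS_pow_le_annihilator hH (Ideal.pow_mem_pow ?_ _)
    exact Ideal.subset_span ⟨t, (MvPolynomial.coe_X t).symm⟩
  have h1 := Ideal.mem_map_of_mem
    (MvPolynomial.rename (R := K) (Sum.inr : Fin e → Fin d ⊕ Fin e)) h
  rwa [map_pow, MvPolynomial.rename_X, ← hI] at h1

include hI in
-- `φ` sets the last variables to zero. They are nilpotent modulo `I`, so `I` and the kernel of `φ`
-- have the same zero locus, and the dimension is that of a polynomial ring in `d` variables.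
theorem ringKrullDim_quotient_map (hτ : 0 < τ) (hH : IndepTop b H) :
    ringKrullDim (MvPolynomial (Fin d ⊕ Fin e) K ⧸ I) = d := by
  let φ : MvPolynomial (Fin d ⊕ Fin e) K →ₐ[K] MvPolynomial (Fin d) K :=
    MvPolynomial.aeval (Sum.elim MvPolynomial.X 0)
  have hφ : Function.Surjective φ := fun g => ⟨MvPolynomial.rename Sum.inl g, by
    rw [MvPolynomial.aeval_rename, Sum.elim_comp_inl, MvPolynomial.aeval_X_left_apply]⟩
  have hle : I ≤ RingHom.ker φ := by
    rw [hI, Ideal.map_le_iff_le_comap]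
    intro g hg
    rw [isSeriesRing_polynomial.mem_annihilator_span_iff] at hg
    have h0 := mem_maxIdealS_iff.1 (annihilator_span_range_le hτ hH hg)
    rw [Ideal.mem_comap, RingHom.mem_ker]
    change MvPolynomial.aeval (Sum.elim MvPolynomial.X 0) (MvPolynomial.rename Sum.inr g) = 0
    rw [MvPolynomial.aeval_rename, Sum.elim_comp_inr, MvPolynomial.aeval_zero]
    have h1 : MvPolynomial.constantCoeff g = 0 := h0
    rw [h1, map_zero]
  have hzero : PrimeSpectrum.zeroLocus (I : Set (MvPolynomial (Fin d ⊕ Fin e) K)) =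
      PrimeSpectrum.zeroLocus (RingHom.ker φ : Set (MvPolynomial (Fin d ⊕ Fin e) K)) := by
    apply le_antisymm
    · intro P hP f hf
      have h : (Ideal.Quotient.mkₐ K P.asIdeal) = ((Ideal.Quotient.mkₐ K P.asIdeal).comp
          (MvPolynomial.rename Sum.inl)).comp φ := by
        refine MvPolynomial.algHom_ext fun s => ?_
        rcases s with i | t
        · simp [φ]
        · have : (Ideal.Quotient.mkₐ K P.asIdeal) (MvPolynomial.X (Sum.inr t)) = 0 :=
            Ideal.Quotient.eq_zero_iff_mem.2
              (P.isPrime.mem_of_pow_mem _ (hP (X_inr_pow_mem hI hH t)))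
          rw [this]
          simp [φ]
      have h1 := DFunLike.congr_fun h f
      rw [AlgHom.comp_apply, show φ f = 0 from hf, map_zero] at h1
      exact Ideal.Quotient.eq_zero_iff_mem.1 h1
    · exact PrimeSpectrum.zeroLocus_anti_mono hle
  rw [ringKrullDim_quotient, hzero, ← ringKrullDim_quotient, ringKrullDim_eq_of_ringEquiv
    (Ideal.quotientKerAlgEquivOfSurjective hφ).toRingEquiv, MvPolynomial.ringKrullDim_of_isNoetherianRing,
    ringKrullDim_eq_zero_of_field, zero_add, Nat.card_fin]

include hI in
theorem isCohenMacaulayOfDim_quotient_polynomial (hτ : 0 < τ) (hH : IndepTop b H) :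
    IsCohenMacaulayOfDim (MvPolynomial (Fin d ⊕ Fin e) K ⧸ I)
      ((maxIdealP (Fin d ⊕ Fin e) K).map (Ideal.Quotient.mk I)) d := by
  have hsurj : Function.Surjective (Ideal.Quotient.mk I) := Ideal.Quotient.mk_surjective
  have hmax : (maxIdealP (Fin d ⊕ Fin e) K).IsMaximal := by
    have : maxIdealP (Fin d ⊕ Fin e) K =
        RingHom.ker (MvPolynomial.constantCoeff (σ := Fin d ⊕ Fin e) (R := K)) := by
      ext f
      exact mem_maxIdealP_iff
    rw [this]
    exact RingHom.ker_isMaximal_of_surjective _ fun c => ⟨MvPolynomial.C c, by simp⟩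
  refine ⟨inferInstance, Ideal.IsMaximal.map_of_surjective_of_ker_le hsurj ?_,
    ringKrullDim_quotient_map hI hτ hH,
    List.ofFn fun i => Ideal.Quotient.mk I (MvPolynomial.X (Sum.inl i)), List.length_ofFn,
    fun r hr => ?_, isSeriesRing_polynomial.isRegular hsurj
      (mk_eq_zero_iff_seriesSlice_coe_mem hI) (annihilator_span_range_ne_top hτ hH)
      (x := fun i => MvPolynomial.X (Sum.inl i))
      fun i => MvPolynomial.coe_X _⟩
  · rw [Ideal.mk_ker]
    exact map_annihilator_le_maxIdealP hI hτ hH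
  · obtain ⟨i, rfl⟩ := (List.mem_ofFn' _ _).1 hr
    exact Ideal.mem_map_of_mem _ (Ideal.subset_span ⟨_, rfl⟩)

include hI in
theorem hasType_quotient_polynomial (hτ : 0 < τ) (hH : IndepTop b H) :
    HasType (MvPolynomial (Fin d ⊕ Fin e) K ⧸ I)
      ((maxIdealP (Fin d ⊕ Fin e) K).map (Ideal.Quotient.mk I)) d τ := by
  refine isSeriesRing_polynomial.hasType hτ hH Ideal.Quotient.mk_surjective
    (x := fun i => MvPolynomial.X (Sum.inl i))
    (mk_eq_zero_iff_seriesSlice_coe_mem hI) (fun i => MvPolynomial.coe_X _) fun f => ?_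
  rw [Ideal.mem_quotient_iff_mem (map_annihilator_le_maxIdealP hI hτ hH), mem_maxIdealP_iff]
  rfl

end Quotient

end Graded

/-! ### Modules with one nonvanishing `Ext` module -/

section Concentrated

open Abelian

variable {A : Type u} [CommRing A]

/-- `Ext^i(N, M)` vanishes for `i ≠ k` and is isomorphic to `Q` for `i = k`. -/
def IsExtConcentrated (N M : ModuleCat.{u} A) (k : ℕ) (Q : Type u) [AddCommGroup Q] [Module A Q] :
    Prop :=
  (∀ i, i ≠ k → Subsingleton (Ext N M i)) ∧ Nonempty (Ext N M k ≃ₗ[A] Q)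

variable {N : ModuleCat.{u} A} {Q : Type u} [AddCommGroup Q] [Module A Q] {k : ℕ}

theorem nonempty_ext_equiv_of_iso {M M' : ModuleCat.{u} A} (e : M ≅ M') (i : ℕ) :
    Nonempty (Ext N M i ≃ₗ[A] Ext N M' i) := by
  have key {M M' : ModuleCat.{u} A} (e : M ≅ M') (α : Ext N M i) :
      (α.comp (Ext.mk₀ e.hom) (add_zero i)).comp (Ext.mk₀ e.inv) (add_zero i) = α := by
    rw [Ext.comp_assoc_of_second_deg_zero, Ext.mk₀_comp_mk₀, e.hom_inv_id, Ext.comp_mk₀_id]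
  refine ⟨LinearEquiv.ofBijective (Ext.postcompOfLinear (Ext.mk₀ e.hom) A N (add_zero i))
    ⟨fun α β h => ?_, fun β => ⟨β.comp (Ext.mk₀ e.inv) (add_zero i), key e.symm β⟩⟩⟩
  rw [← key e α, ← key e β]
  exact congrArg (fun γ => Ext.comp γ (Ext.mk₀ e.inv) (add_zero i)) h

theorem IsExtConcentrated.of_equiv {M M' : Type u} [AddCommGroup M] [Module A M]
    [AddCommGroup M'] [Module A M'] (h : IsExtConcentrated N (ModuleCat.of A M) k Q)
    (e : M ≃ₗ[A] M') : IsExtConcentrated N (ModuleCat.of A M') k Q := by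
  have he (i : ℕ) := nonempty_ext_equiv_of_iso (N := N) e.toModuleIso i
  refine ⟨fun i hi => ?_, ?_⟩
  · obtain ⟨e'⟩ := he i
    have := h.1 i hi
    exact e'.symm.toEquiv.subsingleton
  · obtain ⟨e'⟩ := he k
    exact h.2.map fun e'' => e'.symm.trans e''

/-- All `Ext` into the middle term vanishes, since `x` is zero on `N` and bijective there. So the
connecting maps are isomorphisms, and degree zero vanishes because a map into the first term is
determined by its composite with the inclusion. -/
theorem IsExtConcentrated.of_shortExact {S : ShortComplex (ModuleCat.{u} A)} (hS : S.ShortExact)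
    {x : A} (hx : ∀ n : N, x • n = 0) (hL : Function.Bijective fun l : S.X₂ => x • l)
    (h : IsExtConcentrated N S.X₃ k Q) : IsExtConcentrated N S.X₁ (k + 1) Q := by
  have h₂ (i : ℕ) : Subsingleton (Ext N S.X₂ i) := subsingleton_ext_of_bijective hx hL i
  have hδ (i : ℕ) := nonempty_ext_equiv_of_shortExact N hS (h₂ i)
    fun α => (h₂ (i + 1)).elim _ _
  refine ⟨fun i hi => ?_, ?_⟩
  · cases i with
    | zero =>
      have := hS.mono_f
      have key (α : Ext N S.X₁ 0) : α = 0 := by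
        obtain ⟨g, rfl⟩ := (Ext.linearEquiv₀ (R := A)).symm.surjective α
        have h0 : Ext.mk₀ (g ≫ S.f) = 0 := (h₂ 0).elim _ _
        have h1 : g ≫ S.f = 0 := by
          apply (Ext.linearEquiv₀ (R := A)).symm.injective
          rw [map_zero]
          exact h0
        rw [Limits.zero_of_comp_mono S.f h1, map_zero]
      exact ⟨fun α β => by rw [key α, key β]⟩
    | succ i =>
      obtain ⟨δ⟩ := hδ i
      have := h.1 i (by omega)
      exact δ.symm.toEquiv.subsingleton
  · obtain ⟨δ⟩ := hδ k
    exact h.2.map fun e => δ.symm.trans e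

theorem isExtConcentrated_zero_of_injective {M : Type u} [AddCommGroup M] [Module A M]
    [Module.Injective A M] (h : Nonempty ((N →ₗ[A] M) ≃ₗ[A] Q)) :
    IsExtConcentrated N (ModuleCat.of A M) 0 Q := by
  have := Module.injective_object_of_injective_module A M
  refine ⟨fun i hi => ?_, h.map fun e => ?_⟩
  · obtain ⟨i, rfl⟩ := Nat.exists_eq_succ_of_ne_zero hi
    exact Ext.subsingleton_of_injective _ _ _
  · exact ((Ext.linearEquiv₀ (R := A)).trans (ModuleCat.homLinearEquiv (S := A))).trans e

/-- The subquotient `U / (V ∩ U)` of a module. -/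
abbrev Subquotient {T : Type u} [AddCommGroup T] [Module A T] (U V : Submodule A T) : Type u :=
  U ⧸ V.submoduleOf U

/-- Dimension shift along `0 → U/V → U'/V → U'/V' → 0`, with quotients understood as subquotients:
`hmod` is exactness in the middle, while `hinj` and `hsurj` make `x` bijective on the middle term.
-/
theorem IsExtConcentrated.subquotient {T : Type u} [AddCommGroup T] [Module A T]
    {U U' V V' : Submodule A T} (hU : U ≤ U') (hV : V ≤ V') (hUV : U ≤ V')
    (hmod : V' ⊓ U' ≤ V ⊔ U) {x : A} (hx : ∀ n : N, x • n = 0)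
    (hinj : ∀ w ∈ U', x • w ∈ V → w ∈ V) (hsurj : ∀ w ∈ U', ∃ w' ∈ U', x • w' = w)
    (h : IsExtConcentrated N (ModuleCat.of A (Subquotient U' V')) k Q) :
    IsExtConcentrated N (ModuleCat.of A (Subquotient U V)) (k + 1) Q := by
  let f : Subquotient U V →ₗ[A] Subquotient U' V :=
    Submodule.mapQ _ _ (Submodule.inclusion hU) fun w hw => hw
  let g : Subquotient U' V →ₗ[A] Subquotient U' V' :=
    Submodule.mapQ _ _ LinearMap.id fun w hw => hV hw
  have hf (w : U) : f (Submodule.Quotient.mk w) =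
    Submodule.Quotient.mk (Submodule.inclusion hU w) := rfl
  have hg (w : U') : g (Submodule.Quotient.mk w) = Submodule.Quotient.mk w := rfl
  have hmk {U V : Submodule A T} (w : U) :
      (Submodule.Quotient.mk w : Subquotient U V) = 0 ↔ (w : T) ∈ V :=
    Submodule.Quotient.mk_eq_zero _
  have hexact : Function.Exact f g := by
    intro z
    obtain ⟨w, rfl⟩ := Submodule.Quotient.mk_surjective _ z
    rw [hg, hmk]
    constructor
    · intro hw
      obtain ⟨v, hv, u, hu, huv⟩ := Submodule.mem_sup.1 (hmod ⟨hw, w.2⟩)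
      refine ⟨Submodule.Quotient.mk ⟨u, hu⟩, ?_⟩
      rw [hf, ← sub_eq_zero, ← Submodule.Quotient.mk_sub, hmk]
      change u - w ∈ V
      rw [← huv, sub_add_cancel_right]
      exact neg_mem hv
    · rintro ⟨z, hz⟩
      obtain ⟨u, rfl⟩ := Submodule.Quotient.mk_surjective _ z
      rw [hf, ← sub_eq_zero, ← Submodule.Quotient.mk_sub, hmk] at hz
      have := sub_mem (hUV u.2) (hV hz)
      change (u : T) - (u - w) ∈ V' at this
      rwa [sub_sub_cancel] at this
  refine IsExtConcentrated.of_shortExact (S := ModuleCat.shortComplexOfCompEqZero f g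
    hexact.linearMap_comp_eq_zero) (ModuleCat.shortComplex_shortExact _ hexact ?_ ?_) hx
    ?_ h
  · rw [injective_iff_map_eq_zero]
    intro z hz
    obtain ⟨u, rfl⟩ := Submodule.Quotient.mk_surjective _ z
    exact (hmk u).2 ((hmk (Submodule.inclusion hU u)).1 ((hf u).symm.trans hz))
  · intro z
    obtain ⟨w, rfl⟩ := Submodule.Quotient.mk_surjective _ z
    exact ⟨Submodule.Quotient.mk w, rfl⟩
  · constructor
    · intro z z' hz
      rw [← sub_eq_zero]
      replace hz : x • (z - z') = 0 := by rw [smul_sub, sub_eq_zero]; exact hz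
      generalize z - z' = y at hz
      obtain ⟨w, rfl⟩ := Submodule.Quotient.mk_surjective _ y
      rw [← Submodule.Quotient.mk_smul] at hz
      exact (hmk _).2 (hinj w w.2 ((hmk _).1 hz))
    · intro z
      obtain ⟨w, rfl⟩ := Submodule.Quotient.mk_surjective _ z
      obtain ⟨w', hw', hxw⟩ := hsurj w w.2
      refine ⟨Submodule.Quotient.mk ⟨w', hw'⟩, ?_⟩
      change Submodule.Quotient.mk (x • (⟨w', hw'⟩ : U')) = _
      congr 1
      exact Subtype.ext hxw

end Concentrated

/-! ### Laurent tails -/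

section Laurent

variable {d e : ℕ} {K : Type u} [Field K] {E : Type u} [AddCommGroup E] [Module K E]
  [Module (MvPolynomial (Fin e) K) E] [IsScalarTower K (MvPolynomial (Fin e) K) E]

/-- The exponents of the first `d` variables. -/
def leftExp (m : Fin d ⊕ Fin e →₀ ℕ) : Fin d → ℤ := fun i => m (Sum.inl i)

/-- The exponents of the last `e` variables. -/
def rightExp (m : Fin d ⊕ Fin e →₀ ℕ) : Fin e →₀ ℕ := (Finsupp.sumFinsuppAddEquivProdFinsupp m).2

theorem leftExp_zero : leftExp (0 : Fin d ⊕ Fin e →₀ ℕ) = 0 := rfl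

theorem leftExp_add (m n : Fin d ⊕ Fin e →₀ ℕ) : leftExp (m + n) = leftExp m + leftExp n := by
  ext i
  simp [leftExp]

theorem leftExp_nonneg (m : Fin d ⊕ Fin e →₀ ℕ) : 0 ≤ leftExp m := fun _ => Int.natCast_nonneg _

theorem rightExp_zero : rightExp (0 : Fin d ⊕ Fin e →₀ ℕ) = 0 := by
  rw [rightExp, map_zero]
  rfl

theorem rightExp_add (m n : Fin d ⊕ Fin e →₀ ℕ) : rightExp (m + n) = rightExp m + rightExp n := by
  rw [rightExp, map_add]
  rfl

theorem leftExp_sumElim (p : Fin d →₀ ℕ) (q : Fin e →₀ ℕ) :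
    leftExp (Finsupp.sumElim p q) = fun i => (p i : ℤ) := by
  ext i
  simp [leftExp]

theorem rightExp_sumElim (p : Fin d →₀ ℕ) (q : Fin e →₀ ℕ) :
    rightExp (Finsupp.sumElim p q) = q := by
  ext i
  simp [rightExp]

variable (K E d) in
/-- The monomials act on the tails by a shift in the first variables. -/
def monomialShift :
    Multiplicative (Fin d ⊕ Fin e →₀ ℕ) →* Module.End K ((Fin d → ℤ) →₀ E) where
  toFun m := Finsupp.mapRange.linearMap
      (Algebra.lsmul K K E (MvPolynomial.monomial (rightExp m.toAdd) (1 : K))) ∘ₗ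
    (Finsupp.domLCongr (Equiv.subRight (leftExp m.toAdd))).toLinearMap
  map_one' := by
    refine LinearMap.ext fun w => Finsupp.ext fun q => ?_
    change MvPolynomial.monomial (rightExp (0 : Fin d ⊕ Fin e →₀ ℕ)) (1 : K) •
      w (q + leftExp (0 : Fin d ⊕ Fin e →₀ ℕ)) = w q
    rw [leftExp_zero, rightExp_zero, add_zero, ← MvPolynomial.one_def, one_smul]
  map_mul' m n := by
    refine LinearMap.ext fun w => Finsupp.ext fun q => ?_
    change MvPolynomial.monomial (rightExp (m.toAdd + n.toAdd)) (1 : K) •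
        w (q + leftExp (m.toAdd + n.toAdd)) =
      MvPolynomial.monomial (rightExp m.toAdd) (1 : K) •
        MvPolynomial.monomial (rightExp n.toAdd) (1 : K) •
          w (q + leftExp m.toAdd + leftExp n.toAdd)
    rw [leftExp_add, rightExp_add, ← add_assoc, ← mul_smul, MvPolynomial.monomial_mul, one_mul]

/-- The first variables lower exponents as in contraction, but nothing is cut off at zero, so they
act bijectively; the last variables act on the coefficients in `E`. -/
instance laurentModule : Module (MvPolynomial (Fin d ⊕ Fin e) K) ((Fin d → ℤ) →₀ E) :=
  Module.compHom _ (AddMonoidAlgebra.lift K (Module.End K ((Fin d → ℤ) →₀ E)) _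
    (monomialShift d K E)).toRingHom

theorem monomial_smul_apply (m : Fin d ⊕ Fin e →₀ ℕ) (c : K) (w : (Fin d → ℤ) →₀ E)
    (q : Fin d → ℤ) : (MvPolynomial.monomial m c • w) q =
      MvPolynomial.monomial (rightExp m) c • w (q + leftExp m) := by
  have h : MvPolynomial.monomial m c • w = c • monomialShift d K E (Multiplicative.ofAdd m) w :=
    DFunLike.congr_fun (AddMonoidAlgebra.lift_single (monomialShift d K E)
      (Multiplicative.ofAdd m) c) w
  rw [h]
  change c • (MvPolynomial.monomial (rightExp m) (1 : K) • w (q + leftExp m)) = _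
  rw [← smul_assoc, MvPolynomial.smul_monomial, smul_eq_mul, mul_one]

theorem smul_mem_of_monomial_smul_mem {w : (Fin d → ℤ) →₀ E} {N : AddSubgroup ((Fin d → ℤ) →₀ E)}
    (h : ∀ m c, (MvPolynomial.monomial m c : MvPolynomial (Fin d ⊕ Fin e) K) • w ∈ N)
    (f : MvPolynomial (Fin d ⊕ Fin e) K) : f • w ∈ N := by
  rw [f.as_sum, Finset.sum_smul]
  exact sum_mem fun m _ => h m _

theorem X_inl_smul_apply (i : Fin d) (w : (Fin d → ℤ) →₀ E) (q : Fin d → ℤ) :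
    ((MvPolynomial.X (Sum.inl i) : MvPolynomial (Fin d ⊕ Fin e) K) • w) q =
      w (q + Pi.single i 1) := by
  have h1 : leftExp (Finsupp.single (Sum.inl i) 1 : Fin d ⊕ Fin e →₀ ℕ) = Pi.single i 1 := by
    classical
    ext j
    simp [leftExp, Finsupp.single_apply, Pi.single_apply, eq_comm]
  have h2 : rightExp (Finsupp.single (Sum.inl i) 1 : Fin d ⊕ Fin e →₀ ℕ) = 0 := by
    ext j
    simp [rightExp]
  rw [MvPolynomial.X, monomial_smul_apply, h1, h2, ← MvPolynomial.one_def, one_smul]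

theorem rename_inr_smul_apply (g : MvPolynomial (Fin e) K) (w : (Fin d → ℤ) →₀ E)
    (q : Fin d → ℤ) :
    ((MvPolynomial.rename Sum.inr g : MvPolynomial (Fin d ⊕ Fin e) K) • w) q = g • w q := by
  induction g using MvPolynomial.induction_on' with
  | monomial m c =>
    rw [MvPolynomial.rename_monomial, mapDomain_inr, monomial_smul_apply, leftExp_sumElim,
      rightExp_sumElim]
    congr 2
    ext i
    simp
  | add g g' hg hg' => rw [map_add, add_smul, Finsupp.add_apply, hg, hg', add_smul]

/-! ### Ext of the subquotients -/

section Quotient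

variable (I : Ideal (MvPolynomial (Fin d ⊕ Fin e) K))
  [Module (MvPolynomial (Fin d ⊕ Fin e) K ⧸ I) ((Fin d → ℤ) →₀ E)]
  [IsScalarTower (MvPolynomial (Fin d ⊕ Fin e) K) (MvPolynomial (Fin d ⊕ Fin e) K ⧸ I)
    ((Fin d → ℤ) →₀ E)]

theorem quotient_mk_smul {M : Type*} [AddCommGroup M] [Module (MvPolynomial (Fin d ⊕ Fin e) K) M]
    [Module (MvPolynomial (Fin d ⊕ Fin e) K ⧸ I) M]
    [IsScalarTower (MvPolynomial (Fin d ⊕ Fin e) K) (MvPolynomial (Fin d ⊕ Fin e) K ⧸ I) M]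
    (f : MvPolynomial (Fin d ⊕ Fin e) K) (w : M) : Ideal.Quotient.mk I f • w = f • w :=
  algebraMap_smul (MvPolynomial (Fin d ⊕ Fin e) K ⧸ I) f w

variable (E) in
/-- The tails with exponents in a lower set. -/
def supportedOn (U : LowerSet (Fin d → ℤ)) :
    Submodule (MvPolynomial (Fin d ⊕ Fin e) K ⧸ I) ((Fin d → ℤ) →₀ E) where
  carrier := {w | ∀ q ∉ U, w q = 0}
  add_mem' hw hw' q hq := by rw [Finsupp.add_apply, hw q hq, hw' q hq, add_zero]
  zero_mem' q _ := rfl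
  smul_mem' a w hw := by
    obtain ⟨f, rfl⟩ := Ideal.Quotient.mk_surjective a
    rw [quotient_mk_smul]
    let N : AddSubgroup ((Fin d → ℤ) →₀ E) :=
      { carrier := {w | ∀ q ∉ U, w q = 0}
        add_mem' := fun hw hw' q hq => by rw [Finsupp.add_apply, hw q hq, hw' q hq, add_zero]
        zero_mem' := fun q _ => rfl
        neg_mem' := fun hw q hq => by rw [Finsupp.neg_apply, hw q hq, neg_zero] }
    refine smul_mem_of_monomial_smul_mem (N := N) (fun m c q hq => ?_) f
    rw [monomial_smul_apply, hw _ fun h => hq (U.lower (le_add_of_nonneg_right (leftExp_nonneg m)) h),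
      smul_zero]

theorem supportedOn_mono {U V : LowerSet (Fin d → ℤ)} (h : U ≤ V) :
    supportedOn E I U ≤ supportedOn E I V := fun _ hw q hq => hw q fun hqU => hq (h hqU)

theorem supportedOn_le_sup {U V V' : LowerSet (Fin d → ℤ)} (h : ∀ q ∈ V', q ∈ V ∨ q ∈ U) :
    supportedOn E I V' ≤ supportedOn E I V ⊔ supportedOn E I U := by
  classical
  intro w hw
  rw [← Finsupp.filter_add_filter_not w (· ∈ V)]
  refine add_mem (Submodule.mem_sup_left fun q hq => Finsupp.filter_apply_neg _ _ hq)
    (Submodule.mem_sup_right fun q hq => ?_)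
  by_cases hV : q ∈ V
  · exact Finsupp.filter_apply_neg (fun q => q ∉ V) _ (not_not.2 hV)
  · rw [Finsupp.filter_apply_pos (fun q => q ∉ V) _ hV]
    exact hw q fun h' => (h q h').elim hV hq

/-- The exponents that are negative from the place `j` on. -/
def negFrom (d j : ℕ) : LowerSet (Fin d → ℤ) where
  carrier := {q | ∀ i : Fin d, j ≤ i → q i < 0}
  lower' _ _ h hq i hi := (h i).trans_lt (hq i hi)

/-- The exponents that are negative at some place before `j`. -/
def negBefore (d j : ℕ) : LowerSet (Fin d → ℤ) where
  carrier := {q | ∃ i : Fin d, i < j ∧ q i < 0}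
  lower' _ _ h := fun ⟨i, hi, hq⟩ => ⟨i, hi, (h i).trans_lt hq⟩

theorem mem_negBefore {j : ℕ} {q : Fin d → ℤ} :
    q ∈ negBefore d j ↔ ∃ i : Fin d, i < j ∧ q i < 0 := Iff.rfl

variable {I} in
-- Tails negative after the place `j`, modulo those negative somewhere before `j`, have a free
-- exponent at `j`, so `x_j` acts on them by a bijective shift. Those with negative exponent at `j`
-- form the submodule of the sequence, and killing them gives the quotient for `j + 1`.
theorem isExtConcentrated_supportedOn_step {N : ModuleCat.{u} (MvPolynomial (Fin d ⊕ Fin e) K ⧸ I)}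
    {Q : Type u} [AddCommGroup Q] [Module (MvPolynomial (Fin d ⊕ Fin e) K ⧸ I) Q] {j k : ℕ}
    (hj : j < d)
    (hN : ∀ n : N, Ideal.Quotient.mk I (MvPolynomial.X (Sum.inl ⟨j, hj⟩)) • n = 0)
    (h : IsExtConcentrated N (ModuleCat.of _ (Subquotient (supportedOn E I (negFrom d (j + 1)))
      (supportedOn E I (negBefore d (j + 1))))) k Q) :
    IsExtConcentrated N (ModuleCat.of _ (Subquotient (supportedOn E I (negFrom d j))
      (supportedOn E I (negBefore d j)))) (k + 1) Q := by
  have hsingle (q : Fin d → ℤ) {i : Fin d} (hi : i ≠ ⟨j, hj⟩) (c : ℤ) :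
      (q + Pi.single (⟨j, hj⟩ : Fin d) c : Fin d → ℤ) i = q i := by
    rw [Pi.add_apply, Pi.single_eq_of_ne hi, add_zero]
  have hFrom (q : Fin d → ℤ) (c : ℤ) :
      q + Pi.single (⟨j, hj⟩ : Fin d) c ∈ negFrom d (j + 1) ↔ q ∈ negFrom d (j + 1) := by
    refine forall₂_congr fun i hi => ?_
    rw [hsingle]
    rintro rfl
    exact absurd hi (Nat.not_succ_le_self _)
  have hBefore (q : Fin d → ℤ) (c : ℤ) :
      q + Pi.single (⟨j, hj⟩ : Fin d) c ∈ negBefore d j ↔ q ∈ negBefore d j := by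
    refine exists_congr fun i => and_congr_right fun hi => ?_
    rw [hsingle]
    rintro rfl
    exact lt_irrefl _ hi
  refine IsExtConcentrated.subquotient (U' := supportedOn E I (negFrom d (j + 1)))
    (V' := supportedOn E I (negBefore d (j + 1)))
    (supportedOn_mono I fun q hq i hi => hq i ((Nat.le_succ j).trans hi))
    (supportedOn_mono I fun q ⟨i, hi, hq⟩ => ⟨i, hi.trans (Nat.lt_succ_self j), hq⟩)
    (supportedOn_mono I fun q hq => ⟨⟨j, hj⟩, Nat.lt_succ_self j, hq _ le_rfl⟩)
    ?_ hN (fun w _ hw => ?_) (fun w hw => ?_) h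
  · have hle : supportedOn E I (negBefore d (j + 1)) ⊓ supportedOn E I (negFrom d (j + 1)) ≤
        supportedOn E I (negBefore d (j + 1) ⊓ negFrom d (j + 1)) := by
      rintro w ⟨h1, h2⟩ q hq
      by_cases hq1 : q ∈ negBefore d (j + 1)
      · exact h2 q fun hq2 => hq ⟨hq1, hq2⟩
      · exact h1 q hq1
    refine hle.trans (supportedOn_le_sup I ?_)
    rintro q ⟨⟨i, hi, hqi⟩, hq⟩
    rcases Nat.lt_succ_iff_lt_or_eq.1 hi with hi' | hi'
    · exact Or.inl ⟨i, hi', hqi⟩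
    · refine Or.inr fun l hl => ?_
      rcases hl.lt_or_eq with hl' | hl'
      · exact hq l hl'
      · rwa [← Fin.ext (hi'.trans hl')]
  · intro q hq
    have h1 := hw (q - Pi.single (⟨j, hj⟩ : Fin d) 1) fun h' => hq (by
      rwa [sub_eq_add_neg, ← Pi.single_neg, hBefore] at h')
    rwa [quotient_mk_smul, X_inl_smul_apply, sub_add_cancel] at h1
  · refine ⟨Finsupp.equivMapDomain (Equiv.addRight (Pi.single (⟨j, hj⟩ : Fin d) 1)) w, fun q hq => ?_, ?_⟩
    · refine hw _ fun h' => hq ?_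
      have h1 : q + Pi.single (⟨j, hj⟩ : Fin d) (-1) ∈ negFrom d (j + 1) := by
        rw [Pi.single_neg]
        exact h'
      rwa [hFrom] at h1
    · rw [quotient_mk_smul]
      ext q
      rw [X_inl_smul_apply, Finsupp.equivMapDomain_apply]
      congr 1
      exact (Equiv.addRight (Pi.single (⟨j, hj⟩ : Fin d) (1 : ℤ))).symm_apply_apply q

variable {I} in
-- Descending from `j = d` to `j = 0` costs one degree of `Ext` per variable. At `j = 0` nothing is
-- divided out, since there is no place before `0`.
theorem isExtConcentrated_supportedOn {N : ModuleCat.{u} (MvPolynomial (Fin d ⊕ Fin e) K ⧸ I)}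
    {Q : Type u} [AddCommGroup Q] [Module (MvPolynomial (Fin d ⊕ Fin e) K ⧸ I) Q]
    (hN : ∀ (i : Fin d) (n : N), Ideal.Quotient.mk I (MvPolynomial.X (Sum.inl i)) • n = 0)
    (h : IsExtConcentrated N (ModuleCat.of _ (Subquotient (supportedOn E I (negFrom d d))
      (supportedOn E I (negBefore d d)))) 0 Q) :
    IsExtConcentrated N (ModuleCat.of _ (supportedOn E I (negFrom d 0))) d Q := by
  have key (k : ℕ) : ∀ j, j + k = d →
      IsExtConcentrated N (ModuleCat.of _ (Subquotient (supportedOn E I (negFrom d j))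
        (supportedOn E I (negBefore d j)))) k Q := by
    induction k with
    | zero =>
      rintro j rfl
      exact h
    | succ k ih =>
      intro j hjk
      exact isExtConcentrated_supportedOn_step (by omega) (hN _) (ih (j + 1) (by omega))
  refine (key d 0 (zero_add d)).of_equiv (Submodule.quotEquivOfEqBot _ ?_)
  rw [eq_bot_iff]
  rintro w hw
  refine (Submodule.mem_bot _).2 (Subtype.ext (Finsupp.ext fun q => ?_))
  exact hw q fun ⟨i, hi, _⟩ => Nat.not_lt_zero _ hi

end Quotient

end Laurent

section Duality

variable {d e τ b : ℕ} {K : Type u} [Field K] {H : Fin τ → DP (Fin e) K}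

/-! ### The cone as an injective module -/

theorem smul_eq_zero_of_forall_coeff_eq_zero {σ : Type} {f : MvPowerSeries σ K} {n : ℕ}
    (hf : ∀ k : σ →₀ ℕ, k.degree < n → MvPowerSeries.coeff k f = 0) {F : DP σ K}
    (hF : F ∈ degLT σ K n) : f • F = 0 := by
  classical
  ext k
  rw [coeff_series_smul, coeff_zero]
  refine Finset.sum_eq_zero fun l hl => ?_
  split_ifs with hkl
  · have h1 : (l - k).degree + k.degree = l.degree := by
      rw [← map_add, tsub_add_cancel_of_le hkl]
    have h2 : l.degree < n := by
      by_contra h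
      exact mem_exponents.1 hl (hF l (not_lt.1 h))
    rw [hf _ (by omega), zero_mul]
  · rfl

theorem exists_polynomial_coeff_eq {σ : Type} [Finite σ] (f : MvPowerSeries σ K) (n : ℕ) :
    ∃ p : MvPolynomial σ K, ∀ k : σ →₀ ℕ, k.degree < n →
      MvPowerSeries.coeff k (f - (p : MvPowerSeries σ K)) = 0 := by
  classical
  refine ⟨∑ k ∈ (Finsupp.finite_of_degree_le n).toFinset,
    MvPolynomial.monomial k (MvPowerSeries.coeff k f), fun k hk => ?_⟩
  rw [map_sub, MvPolynomial.coeff_coe, MvPolynomial.coeff_sum, Finset.sum_eq_single k]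
  · rw [MvPolynomial.coeff_monomial, if_pos rfl, sub_self]
  · intro l _ hl
    rw [MvPolynomial.coeff_monomial, if_neg hl]
  · intro h
    exact absurd ((Finsupp.finite_of_degree_le n).mem_toFinset.2 hk.le) h

/-- On elements of bounded degree a series acts like a truncation of it, so double annihilation
passes from series to polynomials. -/
theorem mem_span_range_of_forall_annihilator_smul_eq_zero {G : DP (Fin e) K}
    (h : ∀ g ∈ (Submodule.span (MvPolynomial (Fin e) K) (Set.range H)).annihilator, g • G = 0) :
    G ∈ Submodule.span (MvPolynomial (Fin e) K) (Set.range H) := by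
  rw [isSeriesRing_polynomial.mem_span_iff]
  refine mem_of_forall_annihilator_smul_eq_zero fun f hf => ?_
  let n := max (Finset.univ.sup fun j => (H j).degree + 1) (G.degree + 1)
  have hH (j : Fin τ) : H j ∈ degLT (Fin e) K n :=
    degLT_mono ((Finset.le_sup (f := fun j => (H j).degree + 1) (Finset.mem_univ j)).trans
      (le_max_left _ _)) (mem_degLT_succ_degree _)
  have hG : G ∈ degLT (Fin e) K n := degLT_mono (le_max_right _ _) (mem_degLT_succ_degree _)
  obtain ⟨p, hp⟩ := exists_polynomial_coeff_eq f n
  have hpH : p ∈ (Submodule.span (MvPolynomial (Fin e) K) (Set.range H)).annihilator := by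
    rw [isSeriesRing_polynomial.mem_annihilator_span_iff]
    refine mem_annihilator_span_range_iff.2 fun j => ?_
    have h1 := smul_eq_zero_of_forall_coeff_eq_zero hp (hH j)
    rwa [sub_smul, mem_annihilator_span_range_iff.1 hf, zero_sub, neg_eq_zero] at h1
  have h1 := smul_eq_zero_of_forall_coeff_eq_zero hp hG
  have h2 := h p hpH
  rw [polynomial_smul] at h2
  rwa [sub_smul, h2, sub_zero] at h1

variable (d H) in
/-- The submodule generated by the products of the monomials in the first variables and the
elements `H j`. -/
def coneModule : Submodule (MvPolynomial (Fin d ⊕ Fin e) K) (DP (Fin d ⊕ Fin e) K) :=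
  Submodule.span (MvPolynomial (Fin d ⊕ Fin e) K)
    {F | ∃ (n : Fin d → ℕ) (j : Fin τ), (∀ i, 0 < n i) ∧ F = coneTerm n (H j)}

theorem mem_coneModule_iff {F : DP (Fin d ⊕ Fin e) K} : F ∈ coneModule d H ↔
    ∀ p, slice p F ∈ Submodule.span (MvPolynomial (Fin e) K) (Set.range H) := by
  rw [coneModule, isSeriesRing_polynomial.mem_span_iff, mem_span_coneTerm_iff]
  exact forall_congr' fun p => isSeriesRing_polynomial.mem_span_iff.symm

theorem slice_rename_inr_smul (g : MvPolynomial (Fin e) K) (p : Fin d →₀ ℕ)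
    (F : DP (Fin d ⊕ Fin e) K) :
    slice p ((MvPolynomial.rename Sum.inr g : MvPolynomial (Fin d ⊕ Fin e) K) • F) =
      g • slice p F := by
  rw [polynomial_smul, coe_rename_inr, slice_inclS_smul, polynomial_smul]

variable {I : Ideal (MvPolynomial (Fin d ⊕ Fin e) K)}
  (hI : I = (Submodule.span (MvPolynomial (Fin e) K) (Set.range H)).annihilator.map
    (MvPolynomial.rename (R := K) (Sum.inr : Fin e → Fin d ⊕ Fin e)))
  [Module (MvPolynomial (Fin d ⊕ Fin e) K ⧸ I) (coneModule d H)]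
  [IsScalarTower (MvPolynomial (Fin d ⊕ Fin e) K) (MvPolynomial (Fin d ⊕ Fin e) K ⧸ I)
    (coneModule d H)]

theorem coe_mem_maxIdealS_pow_of_mem {σ : Type} [Fintype σ] {n : ℕ} {f : MvPolynomial σ K}
    (hf : f ∈ maxIdealP σ K ^ n) : (f : MvPowerSeries σ K) ∈ maxIdealS σ K ^ n := by
  have h : (maxIdealP σ K).map (MvPolynomial.coeToMvPowerSeries.ringHom) ≤ maxIdealS σ K := by
    rw [maxIdealP, Ideal.map_span, Ideal.span_le]
    rintro _ ⟨_, ⟨s, rfl⟩, rfl⟩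
    exact Ideal.subset_span ⟨s, (MvPolynomial.coe_X s).symm⟩
  have h1 := Ideal.mem_map_of_mem (MvPolynomial.coeToMvPowerSeries.ringHom) hf
  rw [Ideal.map_pow] at h1
  exact Ideal.pow_right_mono h n h1

theorem monomial_mem_maxIdealP_pow {σ : Type} {n : ℕ} {k : σ →₀ ℕ} (hk : n ≤ k.degree) (c : K) :
    MvPolynomial.monomial k c ∈ maxIdealP σ K ^ n := by
  classical
  refine (MvPolynomial.mem_pow_idealOfVars_iff' n _).2 fun l hl => ?_
  rw [MvPolynomial.coeff_monomial, if_neg]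
  rintro rfl
  exact absurd hk (not_le.2 hl)

include hI in
-- The pairing by the constant coefficient identifies the cone with the functionals on the quotient
-- algebra that vanish on a power of its maximal ideal: such a functional is nonzero on finitely
-- many monomials only, so its values are the coefficients of an element, and this lies in the cone
-- because the functional is defined modulo `I`.
theorem injective_coneModule : Module.Injective (MvPolynomial (Fin d ⊕ Fin e) K ⧸ I)
    (coneModule d H) := by
  have : IsScalarTower K (MvPolynomial (Fin d ⊕ Fin e) K ⧸ I) (coneModule d H) := ⟨by
    intro c a w
    obtain ⟨f, rfl⟩ := Ideal.Quotient.mk_surjective a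
    have h1 : c • Ideal.Quotient.mk I f = Ideal.Quotient.mk I (c • f) := rfl
    rw [h1, quotient_mk_smul, quotient_mk_smul, smul_assoc]⟩
  have hpow (n : ℕ) (a : MvPolynomial (Fin d ⊕ Fin e) K ⧸ I) :
      a ∈ (maxIdealP (Fin d ⊕ Fin e) K).map (Ideal.Quotient.mk I) ^ n ↔
        ∃ f ∈ maxIdealP (Fin d ⊕ Fin e) K ^ n, Ideal.Quotient.mk I f = a := by
    rw [← Ideal.map_pow, Ideal.mem_map_iff_of_surjective _ Ideal.Quotient.mk_surjective]
  have hev (k : Fin d ⊕ Fin e →₀ ℕ) (c : K) (F : DP (Fin d ⊕ Fin e) K) :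
      coeff 0 (MvPolynomial.monomial k c • F) = c * coeff k F := by
    rw [polynomial_smul, MvPolynomial.coe_monomial, coeff_monomial_smul, zero_add]
  let ev : coneModule d H →ₗ[K] K := (lcoeff 0).comp ((coneModule d H).subtype.restrictScalars K)
  refine injective_of_continuous_dual ((maxIdealP (Fin d ⊕ Fin e) K).map (Ideal.Quotient.mk I)) ev
    (fun w hw => ?_) (fun w => ⟨(w : DP (Fin d ⊕ Fin e) K).degree + 1, fun a ha => ?_⟩)
    (fun l n hl => ?_)
  · refine Subtype.ext (DP.ext fun k => ?_)
    have h := hw (Ideal.Quotient.mk I (MvPolynomial.monomial k 1))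
    rw [quotient_mk_smul] at h
    change coeff 0 (MvPolynomial.monomial k (1 : K) • (w : DP (Fin d ⊕ Fin e) K)) = 0 at h
    rwa [hev, one_mul] at h
  · obtain ⟨f, hf, rfl⟩ := (hpow _ a).1 ha
    rw [quotient_mk_smul]
    exact Subtype.ext (smul_eq_zero_of_mem_pow (coe_mem_maxIdealS_pow_of_mem hf)
      (mem_degLT_succ_degree _))
  · let F : DP (Fin d ⊕ Fin e) K := Finsupp.onFinset (Finsupp.finite_of_degree_le n).toFinset
      (fun k => l (Ideal.Quotient.mk I (MvPolynomial.monomial k 1))) fun k hk => by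
        rw [Set.Finite.mem_toFinset]
        by_contra h
        exact hk (hl _ ((hpow n _).2 ⟨_, monomial_mem_maxIdealP_pow (not_le.1 h).le _, rfl⟩))
    have hF (k : Fin d ⊕ Fin e →₀ ℕ) :
        coeff k F = l (Ideal.Quotient.mk I (MvPolynomial.monomial k 1)) := rfl
    have hlF (f : MvPolynomial (Fin d ⊕ Fin e) K) : coeff 0 (f • F) = l (Ideal.Quotient.mk I f) := by
      induction f using MvPolynomial.induction_on' with
      | monomial k c =>
        have h1 : Ideal.Quotient.mk I (MvPolynomial.monomial k c) =
            c • Ideal.Quotient.mk I (MvPolynomial.monomial k 1) := by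
          change _ = Ideal.Quotient.mk I (c • MvPolynomial.monomial k 1)
          rw [MvPolynomial.smul_monomial, smul_eq_mul, mul_one]
        rw [hev, hF, h1, map_smul, smul_eq_mul]
      | add f f' hf hf' => rw [add_smul, coeff_add, hf, hf', map_add, map_add]
    have hFW : F ∈ coneModule d H := by
      refine mem_coneModule_iff.2 fun p =>
        mem_span_range_of_forall_annihilator_smul_eq_zero fun g hg => ?_
      rw [← slice_rename_inr_smul]
      have h0 : (MvPolynomial.rename Sum.inr g : MvPolynomial (Fin d ⊕ Fin e) K) • F = 0 := by
        refine DP.ext fun k => ?_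
        have h1 := hlF (MvPolynomial.monomial k 1 * MvPolynomial.rename Sum.inr g)
        have h2 : MvPolynomial.rename Sum.inr g ∈ I := hI ▸ Ideal.mem_map_of_mem _ hg
        rwa [mul_smul, hev, one_mul, Ideal.Quotient.eq_zero_iff_mem.2 (Ideal.mul_mem_left _ _ h2),
          map_zero] at h1
      rw [h0, map_zero]
    refine ⟨⟨F, hFW⟩, fun a => ?_⟩
    obtain ⟨f, rfl⟩ := Ideal.Quotient.mk_surjective a
    rw [quotient_mk_smul]
    exact (hlF f).symm

include hI in
-- The socle of the cone consists of the constants: an element killed by all variables has degree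
-- zero, and `1` is in the cone because a dual form contracts some `H j` to it.
theorem nonempty_hom_coneModule_equiv (hτ : 0 < τ) (hH : IndepTop b H) :
    Nonempty (((MvPolynomial (Fin d ⊕ Fin e) K ⧸ I) ⧸
        (maxIdealP (Fin d ⊕ Fin e) K).map (Ideal.Quotient.mk I)
          →ₗ[MvPolynomial (Fin d ⊕ Fin e) K ⧸ I] coneModule d H)
      ≃ₗ[MvPolynomial (Fin d ⊕ Fin e) K ⧸ I] (MvPolynomial (Fin d ⊕ Fin e) K ⧸ I) ⧸
        (maxIdealP (Fin d ⊕ Fin e) K).map (Ideal.Quotient.mk I)) := by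
  classical
  have hmem (f : MvPolynomial (Fin d ⊕ Fin e) K) :
      Ideal.Quotient.mk I f ∈ (maxIdealP (Fin d ⊕ Fin e) K).map (Ideal.Quotient.mk I) ↔
        MvPolynomial.constantCoeff f = 0 := by
    rw [Ideal.mem_quotient_iff_mem (map_annihilator_le_maxIdealP hI hτ hH), mem_maxIdealP_iff]
  have hone : (mono 0 1 : DP (Fin e) K) ∈
      Submodule.span (MvPolynomial (Fin e) K) (Set.range H) := by
    obtain ⟨g, -, hg⟩ := hH.exists_dual
    have h := hg ⟨0, hτ⟩ ⟨0, hτ⟩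
    rw [if_pos rfl] at h
    rw [← h]
    exact Submodule.smul_mem _ (g ⟨0, hτ⟩) (Submodule.subset_span ⟨_, rfl⟩)
  have hu : (mono 0 1 : DP (Fin d ⊕ Fin e) K) ∈ coneModule d H := by
    refine mem_coneModule_iff.2 fun p => ?_
    have h : slice p (mono 0 1 : DP (Fin d ⊕ Fin e) K) = if p = 0 then mono 0 1 else 0 := by
      ext q
      rw [coeff_slice, coeff_mono, ← sumElim_zero_zero]
      simp only [sumElim_inj]
      split_ifs with h1 h2 h2
      · rw [coeff_mono, if_pos h1.2]
      · exact absurd h1.1.symm h2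
      · rw [coeff_mono, if_neg fun h3 => h1 ⟨h2.symm, h3⟩]
      · rfl
    rw [h]
    split_ifs
    · exact hone
    · exact zero_mem _
  have hsmul (f : MvPolynomial (Fin d ⊕ Fin e) K) (c : K) :
      f • (mono 0 c : DP (Fin d ⊕ Fin e) K) = mono 0 (MvPolynomial.constantCoeff f * c) :=
    series_smul_mono_zero _ _
  refine (nonempty_hom_equiv_of_socle
    ((maxIdealP (Fin d ⊕ Fin e) K).map (Ideal.Quotient.mk I))
    (fun _ : Fin 1 => (⟨mono 0 1, hu⟩ : coneModule d H)) ?_ ?_ ?_).map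
      fun E => E.trans (LinearEquiv.funUnique (Fin 1) _ _)
  · intro a ha j
    obtain ⟨f, rfl⟩ := Ideal.Quotient.mk_surjective a
    rw [quotient_mk_smul]
    refine Subtype.ext ?_
    change f • (mono 0 1 : DP (Fin d ⊕ Fin e) K) = 0
    rw [hsmul, (hmem f).1 ha, zero_mul, mono_zero]
  · intro c hc j
    rw [Fin.sum_univ_one, Subsingleton.elim (0 : Fin 1) j] at hc
    obtain ⟨f, hf⟩ := Ideal.Quotient.mk_surjective (c j)
    rw [← hf, quotient_mk_smul] at hc
    have h1 : f • (mono 0 1 : DP (Fin d ⊕ Fin e) K) = 0 := congrArg Subtype.val hc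
    rw [hsmul, mul_one, mono_zero_eq_zero_iff] at h1
    rw [← hf, hmem, h1]
  · intro w hw
    refine ⟨fun _ => Ideal.Quotient.mk I (MvPolynomial.C (coeff 0 (w : DP (Fin d ⊕ Fin e) K))), ?_⟩
    rw [Fin.sum_univ_one, quotient_mk_smul]
    refine Subtype.ext ?_
    change (w : DP (Fin d ⊕ Fin e) K) = MvPolynomial.C _ • (mono 0 1 : DP (Fin d ⊕ Fin e) K)
    rw [hsmul, MvPolynomial.constantCoeff_C, mul_one]
    refine eq_mono_of_mem_degLT_one (mem_degLT_one_of_forall_X_smul_eq_zero fun s => ?_)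
    have h1 := hw (Ideal.Quotient.mk I (MvPolynomial.X s))
      ((hmem _).2 (MvPolynomial.constantCoeff_X _ s))
    rw [quotient_mk_smul] at h1
    have h2 : (MvPolynomial.X s : MvPolynomial (Fin d ⊕ Fin e) K) • (w : DP (Fin d ⊕ Fin e) K) = 0 :=
      congrArg Subtype.val h1
    rwa [polynomial_smul, MvPolynomial.coe_X] at h2

end Duality

section Tails

variable {d e τ b : ℕ} {K : Type u} [Field K] {H : Fin τ → DP (Fin e) K}

/-! ### The projection of the tails to the cone -/

variable (H) in
/-- The submodule generated by the `H j` over the polynomial ring in the last variables. -/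
abbrev baseModule : Submodule (MvPolynomial (Fin e) K) (DP (Fin e) K) :=
  Submodule.span (MvPolynomial (Fin e) K) (Set.range H)

/-- A multi-index of natural numbers as a multi-index of integers. -/
def intExp (p : Fin d →₀ ℕ) : Fin d → ℤ := fun i => p i

theorem intExp_injective : Function.Injective (intExp : (Fin d →₀ ℕ) → Fin d → ℤ) := by
  intro p p' h
  ext i
  exact Int.ofNat_injective (congrFun h i)

theorem exists_intExp_eq_iff {q : Fin d → ℤ} : (∃ p, intExp p = q) ↔ q ∉ negBefore d d := by
  rw [mem_negBefore]
  push Not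
  constructor
  · rintro ⟨p, rfl⟩ i _
    exact Int.natCast_nonneg _
  · intro h
    refine ⟨Finsupp.equivFunOnFinite.symm fun i => (q i).toNat, funext fun i => ?_⟩
    exact Int.toNat_of_nonneg (h i i.2)

open Classical in
variable (d H) in
/-- The part of a tail with natural exponents, as an additive map. -/
def tailPart : ((Fin d → ℤ) →₀ baseModule H) →+ DP (Fin d ⊕ Fin e) K :=
  Finsupp.liftAddHom fun q =>
    if h : ∃ p, intExp p = q then
      (AddMonoidHom.mk' (embed h.choose) (embed_add _)).comp
        (baseModule H).subtype.toAddMonoidHom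
    else 0

theorem slice_tailPart (w : (Fin d → ℤ) →₀ baseModule H) (p : Fin d →₀ ℕ) :
    slice p (tailPart d H w) = w (intExp p) := by
  classical
  induction w using Finsupp.induction_linear with
  | zero => rw [map_zero, map_zero]; rfl
  | add w w' hw hw' => rw [map_add, map_add, hw, hw']; rfl
  | single q v =>
    rw [tailPart, Finsupp.liftAddHom_apply_single]
    split_ifs with h
    · change slice p (embed h.choose (v : DP (Fin e) K)) = _
      rw [slice_embed, Finsupp.single_apply]
      have h1 : p = h.choose ↔ q = intExp p := by
        conv_rhs => rw [← h.choose_spec]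
        rw [intExp_injective.eq_iff, eq_comm]
      simp only [h1]
      split_ifs <;> rfl
    · rw [Finsupp.single_apply, if_neg fun h' => h ⟨p, h'.symm⟩, AddMonoidHom.zero_apply, map_zero]
      rfl

theorem slice_monomial_smul (m : Fin d ⊕ Fin e →₀ ℕ) (c : K) (p : Fin d →₀ ℕ)
    (F : DP (Fin d ⊕ Fin e) K) : ∃ p', intExp p' = intExp p + leftExp m ∧
      slice p (MvPolynomial.monomial m c • F) =
        MvPolynomial.monomial (rightExp m) c • slice p' F := by
  obtain ⟨p', q', rfl⟩ := exists_sumElim m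
  refine ⟨p + p', ?_, DP.ext fun q => ?_⟩
  · rw [leftExp_sumElim]
    ext i
    simp [intExp]
  · rw [rightExp_sumElim, coeff_slice, polynomial_smul, polynomial_smul,
      MvPolynomial.coe_monomial, MvPolynomial.coe_monomial, coeff_monomial_smul,
      coeff_monomial_smul, coeff_slice, sumElim_add_sumElim]

theorem tailPart_smul (f : MvPolynomial (Fin d ⊕ Fin e) K) (w : (Fin d → ℤ) →₀ baseModule H) :
    tailPart d H (f • w) = f • tailPart d H w := by
  induction f using MvPolynomial.induction_on' with
  | monomial m c =>
    refine ext_slice fun p => ?_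
    obtain ⟨p', hp', hp⟩ := slice_monomial_smul m c p (tailPart d H w)
    rw [hp, slice_tailPart, slice_tailPart, monomial_smul_apply, hp']
    rfl
  | add f f' hf hf' => rw [add_smul, map_add, hf, hf', add_smul]

variable (d H) in
/-- The part of a tail with natural exponents. -/
def tailMap : ((Fin d → ℤ) →₀ baseModule H) →ₗ[MvPolynomial (Fin d ⊕ Fin e) K] coneModule d H where
  toFun w := ⟨tailPart d H w, mem_coneModule_iff.2 fun p => by
    rw [slice_tailPart]
    exact (w (intExp p)).2⟩
  map_add' w w' := Subtype.ext (map_add _ w w')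
  map_smul' f w := Subtype.ext (tailPart_smul f w)

theorem tailMap_eq_zero_iff {w : (Fin d → ℤ) →₀ baseModule H} :
    tailMap d H w = 0 ↔ ∀ q ∉ negBefore d d, w q = 0 := by
  constructor
  · intro h q hq
    obtain ⟨p, rfl⟩ := exists_intExp_eq_iff.2 hq
    refine Subtype.ext ?_
    rw [← slice_tailPart, show tailPart d H w = 0 from congrArg Subtype.val h, map_zero]
    rfl
  · intro h
    refine Subtype.ext (ext_slice fun p => ?_)
    change slice p (tailPart d H w) = slice p 0
    rw [slice_tailPart, h _ (exists_intExp_eq_iff.1 ⟨p, rfl⟩), map_zero]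
    rfl

theorem tailMap_surjective : Function.Surjective (tailMap d H) := by
  classical
  intro F
  obtain ⟨s, hs⟩ := exists_eq_sum_embed (F : DP (Fin d ⊕ Fin e) K)
  refine ⟨∑ p ∈ s, Finsupp.single (intExp p)
    ⟨slice p (F : DP (Fin d ⊕ Fin e) K), mem_coneModule_iff.1 F.2 p⟩,
    Subtype.ext (ext_slice fun p => ?_)⟩
  change slice p (tailPart d H _) = _
  rw [slice_tailPart]
  conv_rhs => rw [hs]
  rw [map_sum, Finsupp.finsetSum_apply, AddSubmonoidClass.coe_finsetSum]
  refine Finset.sum_congr rfl fun p' _ => ?_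
  rw [slice_embed, Finsupp.single_apply]
  by_cases h : p' = p
  · rw [if_pos (congrArg intExp h), if_pos h.symm]
  · rw [if_neg (intExp_injective.ne h), if_neg (Ne.symm h)]
    rfl

variable {I : Ideal (MvPolynomial (Fin d ⊕ Fin e) K)}
  (hI : I = (Submodule.span (MvPolynomial (Fin e) K) (Set.range H)).annihilator.map
    (MvPolynomial.rename (R := K) (Sum.inr : Fin e → Fin d ⊕ Fin e)))

include hI in
theorem isTorsionBySet_tails :
    Module.IsTorsionBySet (MvPolynomial (Fin d ⊕ Fin e) K) ((Fin d → ℤ) →₀ baseModule H) I := by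
  have h : I ≤ Module.annihilator (MvPolynomial (Fin d ⊕ Fin e) K)
      ((Fin d → ℤ) →₀ baseModule H) := by
    rw [hI, Ideal.map_le_iff_le_comap]
    intro g hg
    refine Module.mem_annihilator.2 fun w => Finsupp.ext fun q => Subtype.ext ?_
    change (((MvPolynomial.rename Sum.inr g : MvPolynomial (Fin d ⊕ Fin e) K) • w) q :
      DP (Fin e) K) = 0
    rw [rename_inr_smul_apply]
    exact Submodule.mem_annihilator.1 hg _ (w q).2
  exact fun w f => Module.mem_annihilator.1 (h f.2) w

include hI in
theorem isTorsionBySet_coneModule :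
    Module.IsTorsionBySet (MvPolynomial (Fin d ⊕ Fin e) K) (coneModule d H) I := by
  rintro w ⟨f, hf⟩
  rw [SetLike.mem_coe, hI, ← annihilator_span_coneTerm_eq_map_polynomial] at hf
  exact Subtype.ext (Submodule.mem_annihilator.1 hf _ w.2)

variable [Module (MvPolynomial (Fin d ⊕ Fin e) K ⧸ I) ((Fin d → ℤ) →₀ baseModule H)]
  [IsScalarTower (MvPolynomial (Fin d ⊕ Fin e) K) (MvPolynomial (Fin d ⊕ Fin e) K ⧸ I)
    ((Fin d → ℤ) →₀ baseModule H)]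

/-- At `j = d` the condition of `negFrom` is empty, and the tails with a negative exponent are the
kernel of the projection to the cone. -/
theorem nonempty_subquotient_equiv_coneModule
    [Module (MvPolynomial (Fin d ⊕ Fin e) K ⧸ I) (coneModule d H)]
    [IsScalarTower (MvPolynomial (Fin d ⊕ Fin e) K) (MvPolynomial (Fin d ⊕ Fin e) K ⧸ I)
      (coneModule d H)] :
    Nonempty (coneModule d H ≃ₗ[MvPolynomial (Fin d ⊕ Fin e) K ⧸ I]
      Subquotient (supportedOn (baseModule H) I (negFrom d d))
        (supportedOn (baseModule H) I (negBefore d d))) := by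
  let Ψ : ((Fin d → ℤ) →₀ baseModule H) →ₗ[MvPolynomial (Fin d ⊕ Fin e) K ⧸ I] coneModule d H :=
    LinearMap.extendScalarsOfSurjective
      (Ideal.Quotient.mk_surjective : Function.Surjective (algebraMap _ (_ ⧸ I))) (tailMap d H)
  let Ψ' := Ψ.comp (supportedOn (baseModule H) I (negFrom d d)).subtype
  have hΨ' (w) : Ψ' w = tailMap d H w := rfl
  have hker : LinearMap.ker Ψ' = (supportedOn (baseModule H) I (negBefore d d)).submoduleOf
      (supportedOn (baseModule H) I (negFrom d d)) := by
    ext w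
    rw [LinearMap.mem_ker, hΨ', tailMap_eq_zero_iff]
    rfl
  have hsurj : Function.Surjective Ψ' := by
    intro F
    obtain ⟨w, hw⟩ := tailMap_surjective F
    exact ⟨⟨w, fun q hq => absurd (fun i hi => absurd hi (not_le.2 i.2)) hq⟩, hw⟩
  exact ⟨((Submodule.quotEquivOfEq _ _ hker.symm).trans (Ψ'.quotKerEquivOfSurjective hsurj)).symm⟩

include hI in
-- Injectivity and the one-dimensional socle concentrate `Ext` into the cone in degree `0`; the `d`
-- dimension shifts then lead to the tails with negative exponents.
theorem isExtConcentrated_tails (hτ : 0 < τ) (hH : IndepTop b H) :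
    IsExtConcentrated (ModuleCat.of _ ((MvPolynomial (Fin d ⊕ Fin e) K ⧸ I) ⧸
        (maxIdealP (Fin d ⊕ Fin e) K).map (Ideal.Quotient.mk I)))
      (ModuleCat.of (MvPolynomial (Fin d ⊕ Fin e) K ⧸ I)
        (supportedOn (baseModule H) I (negFrom d 0))) d
      ((MvPolynomial (Fin d ⊕ Fin e) K ⧸ I) ⧸
        (maxIdealP (Fin d ⊕ Fin e) K).map (Ideal.Quotient.mk I)) := by
  let := (isTorsionBySet_coneModule hI).module
  have : IsScalarTower (MvPolynomial (Fin d ⊕ Fin e) K) (MvPolynomial (Fin d ⊕ Fin e) K ⧸ I)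
    (coneModule d H) := (isTorsionBySet_coneModule hI).isScalarTower
  have := injective_coneModule hI
  obtain ⟨E⟩ := nonempty_subquotient_equiv_coneModule (d := d) (H := H) (I := I)
  refine isExtConcentrated_supportedOn (fun i n => ?_)
    ((isExtConcentrated_zero_of_injective (nonempty_hom_coneModule_equiv hI hτ hH)).of_equiv E)
  obtain ⟨a, rfl⟩ := Ideal.Quotient.mk_surjective n
  have h : Ideal.Quotient.mk I (MvPolynomial.X (Sum.inl i)) ∈
      (maxIdealP (Fin d ⊕ Fin e) K).map (Ideal.Quotient.mk I) :=
    Ideal.mem_map_of_mem _ (Ideal.subset_span ⟨_, rfl⟩)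
  change Ideal.Quotient.mk _ (Ideal.Quotient.mk I (MvPolynomial.X (Sum.inl i)) * a) = 0
  exact Ideal.Quotient.eq_zero_iff_mem.2 (Ideal.mul_mem_right _ _ h)

end Tails

/-! ### The canonical module -/

section Canonical

variable {d e τ b : ℕ} {K : Type u} [Field K] {E : Type u} [AddCommGroup E] [Module K E]
  [Module (MvPolynomial (Fin e) K) E] [IsScalarTower K (MvPolynomial (Fin e) K) E]

theorem monomial_smul_single (m : Fin d ⊕ Fin e →₀ ℕ) (c : K) (q : Fin d → ℤ) (v : E) :
    (MvPolynomial.monomial m c • Finsupp.single q v : (Fin d → ℤ) →₀ E) =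
      Finsupp.single (q - leftExp m) (MvPolynomial.monomial (rightExp m) c • v) := by
  classical
  ext q' : 1
  rw [monomial_smul_apply, Finsupp.single_apply, Finsupp.single_apply]
  simp only [sub_eq_iff_eq_add]
  split_ifs
  · rfl
  · exact smul_zero _

theorem rename_inr_smul_single (g : MvPolynomial (Fin e) K) (q : Fin d → ℤ) (v : E) :
    ((MvPolynomial.rename Sum.inr g : MvPolynomial (Fin d ⊕ Fin e) K) • Finsupp.single q v :
      (Fin d → ℤ) →₀ E) = Finsupp.single q (g • v) := by
  classical
  ext q' : 1
  rw [rename_inr_smul_apply, Finsupp.single_apply, Finsupp.single_apply]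
  split_ifs
  · rfl
  · exact smul_zero _

theorem exists_quotient_module {I : Ideal (MvPolynomial (Fin d ⊕ Fin e) K)}
    (h : Module.IsTorsionBySet (MvPolynomial (Fin d ⊕ Fin e) K) ((Fin d → ℤ) →₀ E) I) :
    ∃ _ : Module (MvPolynomial (Fin d ⊕ Fin e) K ⧸ I) ((Fin d → ℤ) →₀ E),
      IsScalarTower (MvPolynomial (Fin d ⊕ Fin e) K) (MvPolynomial (Fin d ⊕ Fin e) K ⧸ I)
        ((Fin d → ℤ) →₀ E) :=
  ⟨h.module, h.isScalarTower⟩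

/-! ### The grading of the module of tails -/

variable {I : Ideal (MvPolynomial (Fin d ⊕ Fin e) K)}
  [Module (MvPolynomial (Fin d ⊕ Fin e) K ⧸ I) ((Fin d → ℤ) →₀ E)]
  [IsScalarTower (MvPolynomial (Fin d ⊕ Fin e) K) (MvPolynomial (Fin d ⊕ Fin e) K ⧸ I)
    ((Fin d → ℤ) →₀ E)] {θ : E →ₗ[MvPolynomial (Fin e) K] DP (Fin e) K} {v : Fin τ → E}

variable (E I) in
/-- The tails with negative exponents. -/
abbrev negTails : Submodule (MvPolynomial (Fin d ⊕ Fin e) K ⧸ I) ((Fin d → ℤ) →₀ E) :=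
  supportedOn E I (negFrom d 0)

variable (I θ) in
/-- The homogeneous tails of degree `c`, where the degree is the negative of the total exponent. -/
def negTailsDeg (c : ℤ) : AddSubgroup (negTails E I) where
  carrier := {w | ∀ q k, coeff k (θ ((w : (Fin d → ℤ) →₀ E) q)) ≠ 0 →
    -(∑ i, q i) - k.degree = c}
  zero_mem' q k h := absurd (congrArg (coeff k) (map_zero θ)) h
  add_mem' {w w'} hw hw' q k h := by
    by_cases h1 : coeff k (θ ((w : (Fin d → ℤ) →₀ E) q)) = 0
    · refine hw' q k fun h2 => h ?_
      rw [Submodule.coe_add, Finsupp.add_apply, map_add, coeff_add, h1, h2, add_zero]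
    · exact hw q k h1
  neg_mem' {w} hw q k h := by
    refine hw q k fun h1 => h ?_
    rw [Submodule.coe_neg, Finsupp.neg_apply, map_neg, ← neg_one_smul K, coeff_smul, h1, mul_zero]

theorem monomial_smul_mem_negTailsDeg {m : Fin d ⊕ Fin e →₀ ℕ} {c : K} {j : ℤ} {w : negTails E I}
    (hw : w ∈ negTailsDeg I θ j) :
    Ideal.Quotient.mk I (MvPolynomial.monomial m c) • w ∈ negTailsDeg I θ (m.degree + j) := by
  intro q k h
  rw [Submodule.coe_smul, quotient_mk_smul, monomial_smul_apply, map_smul, polynomial_smul,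
    MvPolynomial.coe_monomial, coeff_monomial_smul] at h
  have h2 := hw _ _ (right_ne_zero_of_mul h)
  obtain ⟨p', q', rfl⟩ := exists_sumElim m
  rw [rightExp_sumElim, leftExp_sumElim, map_add] at h2
  simp only [Pi.add_apply, Finset.sum_add_distrib] at h2
  rw [degree_sumElim, ← h2, Finsupp.degree_eq_sum p']
  push_cast
  ring

theorem smul_mem_negTailsDeg {i : ℕ} {j : ℤ} {f : MvPolynomial (Fin d ⊕ Fin e) K}
    {w : negTails E I} (hf : f.IsHomogeneous i) (hw : w ∈ negTailsDeg I θ j) :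
    Ideal.Quotient.mk I f • w ∈ negTailsDeg I θ (i + j) := by
  rw [f.as_sum, map_sum, Finset.sum_smul]
  refine sum_mem fun m hm => ?_
  have h := hf (MvPolynomial.mem_support_iff.1 hm)
  rw [← h]
  have h1 : Finsupp.weight 1 m = m.degree := by rw [Finsupp.degree_eq_weight_one]; rfl
  rw [h1]
  exact monomial_smul_mem_negTailsDeg hw

variable (I v) in
/-- The generators of the module of tails. -/
def negTailsGen (j : Fin τ) : negTails E I :=
  ⟨Finsupp.single (fun _ => -1) (v j), fun q hq => by
    classical
    rw [Finsupp.single_apply, if_neg]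
    rintro rfl
    exact hq fun _ _ => neg_one_lt_zero⟩

/-- The `d` exponents `-1` contribute `d` to the degree, and the form of degree `b` contributes
`-b`. -/
theorem negTailsGen_mem (hhom : ∀ j, (θ (v j)).IsHomogeneous b) (j : Fin τ) :
    negTailsGen I v j ∈ negTailsDeg I θ (d - b) := by
  classical
  intro q k h
  rw [negTailsGen, Finsupp.single_apply] at h
  split_ifs at h with hq
  · subst hq
    rw [isHomogeneous_iff.1 (hhom j) k h]
    simp
  · exact absurd (congrArg (coeff k) (map_zero θ)) h

theorem span_negTailsGen (hv : Submodule.span (MvPolynomial (Fin e) K) (Set.range v) = ⊤) :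
    Submodule.span (MvPolynomial (Fin d ⊕ Fin e) K ⧸ I) (Set.range (negTailsGen I v)) = ⊤ := by
  rw [eq_top_iff]
  rintro w -
  suffices h : (w : (Fin d → ℤ) →₀ E) ∈ (Submodule.span
      (MvPolynomial (Fin d ⊕ Fin e) K ⧸ I) (Set.range (negTailsGen I v))).map
        (negTails E I).subtype by
    obtain ⟨w', hw', h⟩ := h
    rwa [← Subtype.ext h]
  rw [← Finsupp.sum_single (w : (Fin d → ℤ) →₀ E)]
  refine sum_mem fun q hq => ?_
  have hq0 : ∀ i, q i < 0 := by
    by_contra h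
    exact Finsupp.mem_support_iff.1 hq (w.2 q fun h' => h fun i => h' i (Nat.zero_le _))
  have hwq : (w : (Fin d → ℤ) →₀ E) q ∈ Submodule.span (MvPolynomial (Fin e) K) (Set.range v) := by
    rw [hv]
    exact Submodule.mem_top
  obtain ⟨f, hf⟩ := (Submodule.mem_span_range_iff_exists_fun _).1 hwq
  -- As the variables lower exponents, `-1` is moved to `q_i < 0` by the power `-1 - q_i ≥ 0` of
  -- `x_i`.
  let m : Fin d ⊕ Fin e →₀ ℕ :=
    Finsupp.sumElim (Finsupp.equivFunOnFinite.symm fun i => (-1 - q i).toNat) 0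
  have hm : (fun _ => -1) - leftExp m = q := by
    funext i
    have h1 := hq0 i
    rw [leftExp_sumElim, Pi.sub_apply]
    change -1 - (((-1 - q i).toNat : ℕ) : ℤ) = q i
    rw [Int.toNat_of_nonneg (by omega)]
    ring
  have h : ∑ j, Ideal.Quotient.mk I (MvPolynomial.monomial m 1 *
      MvPolynomial.rename Sum.inr (f j)) • (negTailsGen I v j : (Fin d → ℤ) →₀ E) =
        Finsupp.single q ((w : (Fin d → ℤ) →₀ E) q) := by
    rw [← hf, ← Finsupp.singleAddHom_apply, map_sum]
    refine Finset.sum_congr rfl fun j _ => ?_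
    rw [quotient_mk_smul, mul_smul, negTailsGen, rename_inr_smul_single, monomial_smul_single, hm,
      rightExp_sumElim, ← MvPolynomial.one_def, one_smul, Finsupp.singleAddHom_apply]
  rw [← h]
  refine sum_mem fun j _ => Submodule.smul_mem _ _ ?_
  exact ⟨_, Submodule.subset_span ⟨j, rfl⟩, rfl⟩

/-- The coefficient `φ q k` sees only the component of degree `-∑ q_i - |k|`, which gives
independence; the homogeneous generators give spanning. -/
theorem isInternal_negTailsDeg (hθ : Function.Injective θ)
    (hv : Submodule.span (MvPolynomial (Fin e) K) (Set.range v) = ⊤)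
    (hhom : ∀ j, (θ (v j)).IsHomogeneous b) : DirectSum.IsInternal (negTailsDeg I θ) := by
  classical
  let φ (q : Fin d → ℤ) (k : Fin e →₀ ℕ) : negTails E I →+ K :=
    (lcoeff k).toAddMonoidHom.comp (θ.toAddMonoidHom.comp
      ((Finsupp.applyAddHom q).comp (negTails E I).subtype.toAddMonoidHom))
  have hcoe (q : Fin d → ℤ) (k : Fin e →₀ ℕ) (x : DirectSum ℤ fun c => negTailsDeg I θ c) :
      φ q k (DirectSum.coeAddMonoidHom (negTailsDeg I θ) x) =
        φ q k (x (-(∑ i, q i) - k.degree)) := by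
    induction x using DirectSum.induction_on with
    | zero => rw [map_zero]; rfl
    | of c w =>
      rw [DirectSum.coeAddMonoidHom_of]
      by_cases hc : -(∑ i, q i) - k.degree = c
      · subst hc
        rw [DirectSum.of_eq_same]
      · rw [DirectSum.of_eq_of_ne _ _ _ hc]
        by_contra h
        exact hc (w.2 q k fun h' => h (h'.trans (map_zero (φ q k)).symm))
    | add x y hx hy => rw [map_add, map_add, hx, hy, DirectSum.add_apply, AddSubgroup.coe_add, map_add]
  constructor
  · rw [injective_iff_map_eq_zero]
    intro x hx
    refine DFinsupp.ext fun c => Subtype.ext (Subtype.ext (Finsupp.ext fun q => hθ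
      (DP.ext fun k => ?_)))
    change φ q k (x c) = φ q k 0
    rw [map_zero]
    by_cases hc : -(∑ i, q i) - k.degree = c
    · rw [← hc, ← hcoe, hx, map_zero]
    · by_contra h
      exact hc ((x c).2 q k h)
  · rw [← AddMonoidHom.range_eq_top, eq_top_iff]
    rintro w -
    have hmem {c : ℤ} {w : negTails E I} (hw : w ∈ negTailsDeg I θ c) :
        w ∈ (DirectSum.coeAddMonoidHom (negTailsDeg I θ)).range :=
      ⟨DirectSum.of (fun c => negTailsDeg I θ c) c ⟨w, hw⟩, DirectSum.coeAddMonoidHom_of _ _ _⟩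
    have hw : w ∈ Submodule.span (MvPolynomial (Fin d ⊕ Fin e) K ⧸ I)
        (Set.range (negTailsGen I v)) := by
      rw [span_negTailsGen hv]
      exact Submodule.mem_top
    obtain ⟨c, rfl⟩ := (Submodule.mem_span_range_iff_exists_fun _).1 hw
    refine sum_mem fun j _ => ?_
    obtain ⟨f, hf⟩ := Ideal.Quotient.mk_surjective (c j)
    rw [← hf, f.as_sum, map_sum, Finset.sum_smul]
    exact sum_mem fun m _ => hmem (monomial_smul_mem_negTailsDeg (negTailsGen_mem hhom j))

/-- Without generator `j` the others lie in the submodule `N` of tails whose value at `(-1, …, -1)`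
is killed by the dual form `g j`, and generator `j` is not in `N`. -/
theorem minimal_negTailsGen (hθ : Function.Injective θ)
    (hv : Submodule.span (MvPolynomial (Fin e) K) (Set.range v) = ⊤)
    (hH : IndepTop b fun j => θ (v j)) :
    Minimal (fun T : Set (negTails E I) =>
      Submodule.span (MvPolynomial (Fin d ⊕ Fin e) K ⧸ I) T = ⊤)
      (Set.range (negTailsGen I v)) := by
  obtain ⟨g, -, hg⟩ := hH.exists_dual
  refine ⟨span_negTailsGen hv, fun T hT hle => ?_⟩
  rintro _ ⟨j, rfl⟩
  by_contra hj
  let N₀ : AddSubgroup ((Fin d → ℤ) →₀ E) :=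
    { carrier := {w | g j • w (fun _ => -1) = 0}
      zero_mem' := smul_zero _
      add_mem' := fun {w w'} hw hw' => by
        change g j • (w + w') (fun _ => -1) = 0
        rw [Finsupp.add_apply, smul_add, hw, hw', add_zero]
      neg_mem' := fun {w} hw => by
        change g j • (-w) (fun _ => -1) = 0
        rw [Finsupp.neg_apply, smul_neg, hw, neg_zero] }
  let N : Submodule (MvPolynomial (Fin d ⊕ Fin e) K ⧸ I) (negTails E I) :=
    { carrier := {w | (w : (Fin d → ℤ) →₀ E) ∈ N₀}
      zero_mem' := N₀.zero_mem
      add_mem' := fun hw hw' => N₀.add_mem hw hw'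
      smul_mem' := fun a w hw => by
        obtain ⟨f, rfl⟩ := Ideal.Quotient.mk_surjective a
        change Ideal.Quotient.mk I f • (w : (Fin d → ℤ) →₀ E) ∈ N₀
        rw [quotient_mk_smul]
        refine smul_mem_of_monomial_smul_mem (fun m c => ?_) f
        change g j • (MvPolynomial.monomial m c • (w : (Fin d → ℤ) →₀ E))
          (fun _ => -1) = 0
        rw [monomial_smul_apply]
        by_cases hm : leftExp m = 0
        · rw [hm, add_zero, smul_comm, show g j • (w : (Fin d → ℤ) →₀ E) (fun _ => -1) =
            0 from hw, smul_zero]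
        -- A monomial containing a first variable brings in the value at an exponent that is
        -- nonnegative at some place, where the tail vanishes.
        · obtain ⟨i, hi⟩ := Function.ne_iff.1 hm
          rw [w.2, smul_zero, smul_zero]
          intro h
          have h1 := h i (Nat.zero_le _)
          have h2 := leftExp_nonneg m i
          simp only [Pi.add_apply, Pi.zero_apply] at h1 h2 hi
          omega }
  have hmem (i : Fin τ) : negTailsGen I v i ∈ N ↔ i ≠ j := by
    change g j • (Finsupp.single (fun _ => -1) (v i) :
      (Fin d → ℤ) →₀ E) (fun _ => -1) = 0 ↔ _
    rw [Finsupp.single_eq_same, ← map_eq_zero_iff θ hθ, map_smul, polynomial_smul, hg,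
      mono_zero_eq_zero_iff]
    by_cases hij : j = i
    · simp [hij]
    · simp [hij, Ne.symm hij]
  have hTN : T ⊆ N := by
    intro w hw
    obtain ⟨i, rfl⟩ := hle hw
    refine (hmem i).2 ?_
    rintro rfl
    exact hj hw
  have h1 : negTailsGen I v j ∈ N := by
    have h2 := Submodule.span_le.2 hTN
    rw [hT] at h2
    exact h2 Submodule.mem_top
  exact (hmem j).1 h1 rfl

end Canonical

/-! ### The graded level property -/

section Level

variable {d e τ b : ℕ} {K : Type u} [Field K] {H : Fin τ → DP (Fin e) K}
  {I : Ideal (MvPolynomial (Fin d ⊕ Fin e) K)}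

theorem isGradedLevel_of_eq_map
    (hI : I = (Submodule.span (MvPolynomial (Fin e) K) (Set.range H)).annihilator.map
      (MvPolynomial.rename (R := K) (Sum.inr : Fin e → Fin d ⊕ Fin e)))
    (hτ : 0 < τ) (hH : IndepTop b H) (hhom : ∀ j, (H j).IsHomogeneous b) :
    IsGradedLevel I d τ where
  homogeneous := by
    rw [hI, ← annihilator_span_coneTerm_eq_map_polynomial]
    refine isHomogeneous_annihilator_span ?_
    rintro _ ⟨n, j, _, rfl⟩
    exact isHomogeneous_coneTerm (hhom j) n
  cohenMacaulay := isCohenMacaulayOfDim_quotient_polynomial hI hτ hH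
  type := hasType_quotient_polynomial hI hτ hH
  level := by
    obtain ⟨_, _⟩ := exists_quotient_module (isTorsionBySet_tails hI)
    let v (j : Fin τ) : baseModule H := ⟨H j, Submodule.subset_span ⟨j, rfl⟩⟩
    have hv : Submodule.span (MvPolynomial (Fin e) K) (Set.range v) = ⊤ :=
      by
      rw [← Submodule.span_span_coe_preimage (s := Set.range H)]
      congr 1
      ext w
      constructor
      · rintro ⟨j, rfl⟩
        exact ⟨j, rfl⟩
      · rintro ⟨j, hj⟩
        exact ⟨j, Subtype.ext hj⟩
    have hθ := (baseModule H).injective_subtype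
    -- The canonical module is the module of tails with negative exponents, generated in the single
    -- degree `d - b`.
    refine ⟨ModuleCat.of _ (negTails (baseModule H) I), negTailsDeg I (baseModule H).subtype,
      ⟨⟨Submodule.fg_def.2 ⟨_, Set.finite_range _, span_negTailsGen hv⟩⟩,
        isInternal_negTailsDeg hθ hv hhom, fun _ _ _ _ hf hw => smul_mem_negTailsDeg hf hw,
        (isExtConcentrated_tails hI hτ hH).1, (isExtConcentrated_tails hI hτ hH).2⟩,
      d - b, Set.range (negTailsGen I v), ?_, minimal_negTailsGen hθ hv hH⟩
    rintro _ ⟨j, rfl⟩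
    exact negTailsGen_mem hhom j

end Level

end LevelAlgebra

end

theorem mainTheorem9 {K : Type u} [Field K] [Infinite K] (d e τ b : ℕ) (hd : 0 < d) (hτ : 0 < τ)
    (H : Fin τ → LevelAlgebra.DP (Fin e) K)
    (hdeg : ∀ j, (H j).degree = b)
    (hind : LinearIndependent K fun j => LevelAlgebra.DP.form b (H j)) :
    -- The local case: power series rings.
    (∀ W : Submodule (MvPowerSeries (Fin d ⊕ Fin e) K) (LevelAlgebra.DP (Fin d ⊕ Fin e) K),
      W = Submodule.span (MvPowerSeries (Fin d ⊕ Fin e) K)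
          {F | ∃ (n : Fin d → ℕ) (j : Fin τ), (∀ i, 0 < n i) ∧
            F = LevelAlgebra.DP.coneTerm n (H j)} →
        LevelAlgebra.IsLocalAdmissibleWrt (fun i => MvPowerSeries.X (Sum.inl i))
          (fun n j => LevelAlgebra.DP.coneTerm n (H j)) W ∧
        LevelAlgebra.IsLocalAdmissible d τ W ∧
        LevelAlgebra.IsLocalLevel W.annihilator d τ ∧
        W.annihilator =
          (Submodule.span (MvPowerSeries (Fin e) K) (Set.range H)).annihilator.map
            (MvPowerSeries.rename (R := K) (Sum.inr : Fin e → Fin d ⊕ Fin e))) ∧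
    -- The graded case: polynomial rings and homogeneous generators.
    ((∀ j, (H j).IsHomogeneous b) →
      ∀ W : Submodule (MvPolynomial (Fin d ⊕ Fin e) K) (LevelAlgebra.DP (Fin d ⊕ Fin e) K),
      W = Submodule.span (MvPolynomial (Fin d ⊕ Fin e) K)
          {F | ∃ (n : Fin d → ℕ) (j : Fin τ), (∀ i, 0 < n i) ∧
            F = LevelAlgebra.DP.coneTerm n (H j)} →
        LevelAlgebra.IsGradedAdmissibleWrt (fun i => MvPolynomial.X (Sum.inl i))
          (fun n j => LevelAlgebra.DP.coneTerm n (H j)) W ∧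
        LevelAlgebra.IsGradedAdmissible d τ W ∧
        LevelAlgebra.IsGradedLevel W.annihilator d τ ∧
        W.annihilator =
          (Submodule.span (MvPolynomial (Fin e) K) (Set.range H)).annihilator.map
            (MvPolynomial.rename (R := K) (Sum.inr : Fin e → Fin d ⊕ Fin e))) := by
  have hH : LevelAlgebra.DP.IndepTop b H := LevelAlgebra.DP.indepTop_iff.2 ⟨hdeg, hind⟩
  refine ⟨?_, fun hhom => ?_⟩
  · rintro W hW
    have hadm := LevelAlgebra.isLocalAdmissibleWrt_X hd hH hW
    have hann : W.annihilator = _ := hW ▸ LevelAlgebra.annihilator_span_coneTerm_eq_map H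
    exact ⟨hadm, ⟨_, _, hadm⟩, LevelAlgebra.isLocalLevel_of_eq_map hann hd hτ hH, hann⟩
  · rintro W hW
    have hadm := LevelAlgebra.isGradedAdmissibleWrt_X hH hhom hW
    have hann : W.annihilator = _ :=
      hW ▸ LevelAlgebra.annihilator_span_coneTerm_eq_map_polynomial H
    exact ⟨hadm, ⟨_, _, hadm⟩, LevelAlgebra.isGradedLevel_of_eq_map hann hτ hH hhom, hann⟩
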